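/- Let $d\ge 1$ be an integer and $s\ge 1$ a real number with $s>d/2$. For integers $H,W,S$ and real $B$ let $\Phi(H,W,S,B)$ be the class of functions $\mathbb R^d\to\mathbb R$ of the form $$x\mapsto [W^{(H)}A(\cdot)+b^{(H)}]\circ\cdots\circ[W^{(2)}A(\cdot)+b^{(2)}]\circ[W^{(1)}x+b^{(1)}],\qquad A(t)=\max(t,0)\ \text{entrywise},$$ with $H$ affine layers, all hidden layers of width $W$, and scalar output, such that the weight matrices and bias vectors have in total at most $S$ nonzero entries and all their entries are at most $B$ in absolute value. For a bounded convex set $\Omega\subset\mathbb R^d$ with nonempty interior and $L>0$ let $\mathcal F$ be the set of functions $f\in C^{\lfloor s\rfloor}(\Omega)$ with $$\max_{|v|<\lfloor s\rfloor}\sup_{\Omega}|D^{v}f|+\max_{|v|=\lfloor s\rfloor}\ \sup_{x\ne x'\in\Omega}\frac{|D^{v}f(x)-D^{v}f(x')|}{\|x-x'\|^{s-\lfloor s\rfloor}}\le L .$$ Then there are a real constant $C_0>0$ and an integer constant $W_0\ge 1$, depending only on $d$ and $s$, such that the following holds for all such $\Omega$ and $L$. For $0<\delta<1$ put $N=\lceil|\delta\log\delta|^{-d/s}\rceil$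 and $$H=3+2\Big\lceil\log_2\frac{3^{\max(d,\lfloor s+2\rfloor)}}{\delta C_0}+5\Big\rceil_+\big\lceil\log_2\max(d,\lfloor s+2\rfloor)\big\rceil,\quad W=W_0N,\quad S=[(H-1)W_0^2+1]N,\quad B=N^{1/d},$$ where $\lceil t\rceil_+=\max(\lceil t\rceil,0)$, so that $\lceil t\rceil_+=\lceil t\rceil$ in this formula for all sufficiently small $\delta$. Let $\Phi_\delta=\Phi(H,W,S,B)$ and $\|g\|_{L_\infty}=\sup_{x\in\Omega}|g(x)|$. Then for all $0<\delta<1$, all $n\ge1$ and all points $x_1,\dots,x_n\in\Omega$, with the empirical norm $\|g\|_n=\big(\frac1n\sum_{i=1}^n g(x_i)^2\big)^{1/2}$, $$\sup_{f\in\mathcal F}\inf_{f^*\in\Phi_\delta}\|f-f^*\|_n\ \le\ \sup_{f\in\mathcal F}\inf_{f^*\in\Phi_\delta}\|f-f^*\|_{L_\infty},$$ and $$\sup_{f\in\mathcal F}\inf_{f^*\in\Phi_\delta}\|f-f^*\|_{L_\infty}=\mathcal O(\delta)\qquad(\delta\to0^+),$$ where the constant in $\mathcal O$ and the range of small $\delta$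 may depend on $d,s,\Omega,L$ only. -/

import Mathlib

open Filter Topology
open scoped ENNReal

noncomputable section

namespace ReLUApprox

/-- The mixed partial derivative `D^v f = ∂^{|v|} f / (∂x_1^{v_1} ⋯ ∂x_d^{v_d})` of a function `f`
on the set `Ω ⊆ ℝ^d`, at the point `x`: the `|v|`-th derivative of `f` within `Ω`, applied to
`v_1` copies of the first basis vector, `v_2` copies of the second one, and so on. -/
def mixedPartial {d : ℕ} (Ω : Set (EuclideanSpace ℝ (Fin d))) (v : Fin d → ℕ)
    (f : EuclideanSpace ℝ (Fin d) → ℝ) (x : EuclideanSpace ℝ (Fin d)) : ℝ :=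
  iteratedFDerivWithin ℝ (∑ i, v i) f Ω x
    (fun j => EuclideanSpace.single (finSigmaFinEquiv.symm j).1 (1 : ℝ))

/-- The Hölder norm
`max_{|v| < ⌊s⌋} ‖D^v f‖_{L∞(Ω)}
  + max_{|v| = ⌊s⌋} sup_{x ≠ x' in Ω} |D^v f(x) - D^v f(x')| / ‖x - x'‖^(s - ⌊s⌋)`,
with values in `[0, ∞]`. -/
def holderNorm {d : ℕ} (s : ℝ) (Ω : Set (EuclideanSpace ℝ (Fin d)))
    (f : EuclideanSpace ℝ (Fin d) → ℝ) : ℝ≥0∞ :=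
  (⨆ (v : Fin d → ℕ) (_ : ∑ i, v i < ⌊s⌋₊) (x ∈ Ω), ‖mixedPartial Ω v f x‖ₑ) +
  (⨆ (v : Fin d → ℕ) (_ : ∑ i, v i = ⌊s⌋₊) (x ∈ Ω) (x' ∈ Ω) (_ : x ≠ x'),
    ‖mixedPartial Ω v f x - mixedPartial Ω v f x'‖ₑ /
      ENNReal.ofReal (‖x - x'‖ ^ (s - (⌊s⌋₊ : ℝ))))

/-- The Hölder-`s` ball of radius `L` on `Ω`. Only the values of `f` on `Ω` matter. -/
def holderBall {d : ℕ} (s L : ℝ) (Ω : Set (EuclideanSpace ℝ (Fin d))) :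
    Set (EuclideanSpace ℝ (Fin d) → ℝ) :=
  {f | ContDiffOn ℝ ((⌊s⌋₊ : ℕ) : WithTop ℕ∞) f Ω ∧ holderNorm s Ω f ≤ ENNReal.ofReal L}

/-- Parameters of a scalar feed-forward network: `Net W H k` has `H` affine layers, input dimension
`k` and width `W`. The first layer given is the one applied first; the last layer has one output. -/
inductive Net (W : ℕ) : ℕ → ℕ → Type
  | output {k : ℕ} (w : Fin k → ℝ) (b : ℝ) : Net W 1 k
  | layer {H k : ℕ} (M : Matrix (Fin W) (Fin k) ℝ) (b : Fin W → ℝ) (rest : Net W H W) :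
      Net W (H + 1) k

/-- The function computed by the network: the positive part is applied entrywise
between consecutive affine layers (neither to the input nor to the output). -/
def Net.eval {W : ℕ} : {H k : ℕ} → Net W H k → (Fin k → ℝ) → ℝ
  | _, _, .output w b, x => (∑ j, w j * x j) + b
  | _, _, .layer M b rest, x => rest.eval (fun i => max ((M.mulVec x + b) i) 0)

/-- The number of nonzero entries of a vector or of a matrix given as a family. -/
def nnz {ι : Type} [Fintype ι] (a : ι → ℝ) : ℕ := (Finset.univ.filter fun i => a i ≠ 0).card

/-- The total number of nonzero weights and biases. -/
def Net.sparsity {W : ℕ} : {H k : ℕ} → Net W H k → ℕ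
  | _, _, .output w b => nnz w + nnz (fun _ : Unit => b)
  | _, _, .layer M b rest => nnz (fun p : _ × _ => M p.1 p.2) + nnz b + rest.sparsity

/-- All weights and biases are at most `B` in absolute value. -/
def Net.BoundedBy {W : ℕ} (B : ℝ) : {H k : ℕ} → Net W H k → Prop
  | _, _, .output w b => (∀ j, |w j| ≤ B) ∧ |b| ≤ B
  | _, _, .layer M b rest => (∀ i j, |M i j| ≤ B) ∧ (∀ i, |b i| ≤ B) ∧ rest.BoundedBy B

/-- The class `Φ(H, W, S, B)` of ReLU networks on `ℝ^d`. -/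
def reluClass (d H W S : ℕ) (B : ℝ) : Set (EuclideanSpace ℝ (Fin d) → ℝ) :=
  {g | ∃ φ : Net W H d, φ.sparsity ≤ S ∧ φ.BoundedBy B ∧ ∀ x, g x = φ.eval (fun i => x i)}

/-- `N = ⌈|δ log δ|^(-d/s)⌉`. -/
def numN (d : ℕ) (s δ : ℝ) : ℕ := ⌈|δ * Real.log δ| ^ (-((d : ℝ) / s))⌉₊

/-- `d ∨ ⌊s + 2⌋`. -/
def degM (d : ℕ) (s : ℝ) : ℕ := max d ⌊s + 2⌋₊

/-- `H = 3 + 2 ⌈log₂ (3^(d ∨ ⌊s+2⌋) / (δ C₀)) + 5⌉ ⌈log₂ (d ∨ ⌊s+2⌋)⌉`. -/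
def depthH (d : ℕ) (s C₀ δ : ℝ) : ℕ :=
  3 + 2 * ⌈Real.logb 2 (3 ^ degM d s / (δ * C₀)) + 5⌉₊ * ⌈Real.logb 2 (degM d s)⌉₊

/-- The class `Φ(H, W, S, B)` with `W = W₀ N`, `S = [(H - 1) W₀² + 1] N`, `B = N^(1/d)` and
`H`, `N` the functions of `δ` above. -/
def sieve (d : ℕ) (s C₀ : ℝ) (W₀ : ℕ) (δ : ℝ) : Set (EuclideanSpace ℝ (Fin d) → ℝ) :=
  reluClass d (depthH d s C₀ δ) (W₀ * numN d s δ)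
    (((depthH d s C₀ δ - 1) * W₀ ^ 2 + 1) * numN d s δ)
    ((numN d s δ : ℝ) ^ (1 / (d : ℝ)))

/-- The sup norm over `Ω`, with values in `[0, ∞]`. -/
def supNorm {d : ℕ} (Ω : Set (EuclideanSpace ℝ (Fin d)))
    (g : EuclideanSpace ℝ (Fin d) → ℝ) : ℝ≥0∞ :=
  ⨆ x ∈ Ω, ‖g x‖ₑ

/-- The empirical norm `(1/n ∑ g(x_i)²)^(1/2)` at the sample `x_1, …, x_n`. -/
def empNorm {d n : ℕ} (x : Fin n → EuclideanSpace ℝ (Fin d))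
    (g : EuclideanSpace ℝ (Fin d) → ℝ) : ℝ≥0∞ :=
  ENNReal.ofReal (Real.sqrt ((1 / (n : ℝ)) * ∑ i, g (x i) ^ 2))

/-- The approximation error `sup_{f ∈ F} inf_{g ∈ G} ν(f - g)`, with values in `[0, ∞]`. -/
def approxError {α : Type} (ν : (α → ℝ) → ℝ≥0∞) (F G : Set (α → ℝ)) : ℝ≥0∞ :=
  ⨆ f ∈ F, ⨅ g ∈ G, ν (f - g)

end ReLUApprox

end

/-!
Put `T = log₂ (1 / δ)`. Up to constants `N ^ (-s / d)` is `δ T`, so approximation by polynomials on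
`N` cubes, whose error is `N ^ (-s / d)`, misses the claim by a logarithm. The missing factor is
gained by reading corrections from tables that are stored in single weights (bit extraction), which
is where `s > d / 2` is used.

Cover `Ω` by about `N` blocks of side `D`, with `D ^ s = O(δ T)`, and divide each of them into `m ^ d`
cells with `m` about `T ^ (1 / s)`. On a block `f` has a Taylor polynomial, and in each cell the
Taylor polynomial of the remainder at a point of the cell is a correction, with coefficients of size
`D ^ s` in the local coordinates and error `(D / m) ^ s = O(δ)` (`exists_block_poly`). It thus
suffices to know the corrections up to a relative error `1 / T`, that is, with `O(log T)` bits. The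
`m ^ d` cells of a block are the entries of a square table with about `T ^ (d / (2 s))` rows. A
network of bounded width selects the weight that holds a row and then reads the bits of that weight
one by one (`St.exists_lookup`, `St.exists_cell_lookup`). This takes depth
`O(T ^ (d / (2 s)) log T) = o(T)`, because `d / (2 s) < 1`.

The lookup goes wrong close to the left walls of the cells, since the digits of the coordinates are
discontinuous there. Therefore the blocks come in `2 ^ d` grids, shifted by half a cell in some of
the coordinates, and the pieces are glued by products of triangle waves that vanish on the walls
(`sum_prod_tri`): a wrong entry is at most `D ^ s`, is weighted by `O(1 / T)`, and so does no harm.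
The products are computed by a binary tree of approximate multiplications, built from iterated tent
maps and exact at zero (`St.exists_prod`), so that only the at most `2 ^ d` blocks that are active at
a point contribute (`exists_block`, `exists_out`). With precision `δ` for each multiplication the tree
has depth about `(c + 1) T` for `c = ⌈log₂ (max d ⌊s + 2⌋)⌉`, while the allowed depth is more than
`2 c T`; as `c ≥ 2`, at least `T` layers are left for the lookup (`le_depthH`). The bound
`N ^ (1 / d)` for the entries is harmless, because it exceeds every power of `T`.

The inequality between the two approximation errors holds because the empirical norm is at most the
supremum norm for each single function.
-/

namespace ReLUApprox

/-! ### A calculus of hidden layers -/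

section Nnz

variable {ι κ : Type} [Fintype ι] [Fintype κ]

lemma nnz_eq_sum (a : ι → ℝ) : nnz a = ∑ i, if a i ≠ 0 then 1 else 0 := by
  simp [nnz, Finset.card_filter]

lemma nnz_le_card (a : ι → ℝ) : nnz a ≤ Fintype.card ι :=
  Finset.card_filter_le _ _

lemma nnz_zero : nnz (fun _ : ι => (0 : ℝ)) = 0 := by
  simp [nnz]

lemma nnz_append {m n : ℕ} (a : Fin m → ℝ) (b : Fin n → ℝ) :
    nnz (Fin.append a b) = nnz a + nnz b := by
  simp [nnz_eq_sum, Fin.sum_univ_add]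

lemma nnz_append_rows {m n k : ℕ} (a : Fin m → Fin k → ℝ) (b : Fin n → Fin k → ℝ) :
    nnz (fun p : Fin (m + n) × Fin k => Fin.append a b p.1 p.2) =
      nnz (fun p : Fin m × Fin k => a p.1 p.2) + nnz (fun p : Fin n × Fin k => b p.1 p.2) := by
  simp [nnz_eq_sum, Fintype.sum_prod_type, Fin.sum_univ_add]

end Nnz

/-- The block diagonal matrix with blocks `a` and `b`. -/
def blockDiag {m n : ℕ} (a : Matrix (Fin m) (Fin m) ℝ) (b : Matrix (Fin n) (Fin n) ℝ) :
    Matrix (Fin (m + n)) (Fin (m + n)) ℝ :=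
  Fin.append (fun i => Fin.append (a i) 0) (fun i => Fin.append 0 (b i))

lemma nnz_blockDiag {m n : ℕ} (a : Matrix (Fin m) (Fin m) ℝ) (b : Matrix (Fin n) (Fin n) ℝ) :
    nnz (fun p : Fin (m + n) × Fin (m + n) => blockDiag a b p.1 p.2) =
      nnz (fun p : Fin m × Fin m => a p.1 p.2) + nnz (fun p : Fin n × Fin n => b p.1 p.2) := by
  simp [nnz_eq_sum, Fintype.sum_prod_type, Fin.sum_univ_add, blockDiag]

lemma Fin.forall_append {m n : ℕ} {α : Type*} {a : Fin m → α} {b : Fin n → α} {p : α → Prop}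
    (ha : ∀ i, p (a i)) (hb : ∀ i, p (b i)) (i : Fin (m + n)) : p (Fin.append a b i) := by
  refine Fin.addCases (fun i => ?_) (fun i => ?_) i
  · simpa using ha i
  · simpa using hb i

/-- `Hid d B w S h v` says that the functions `v 0, …, v (w - 1)` of the input `x ∈ ℝ^d` are the
activations of the `h`-th hidden layer of a ReLU network whose hidden layers all have width `w`,
whose entries are at most `B` in absolute value, and which has `S` nonzero entries up to there. -/
inductive Hid (d : ℕ) (B : ℝ) (w : ℕ) : ℕ → ℕ → (Fin w → (Fin d → ℝ) → ℝ) → Prop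
  | first (M : Matrix (Fin w) (Fin d) ℝ) (b : Fin w → ℝ) (hM : ∀ i j, |M i j| ≤ B)
      (hb : ∀ i, |b i| ≤ B) :
      Hid d B w (nnz (fun p : Fin w × Fin d => M p.1 p.2) + nnz b) 1
        (fun i x => max ((M.mulVec x + b) i) 0)
  | next {S h : ℕ} {v : Fin w → (Fin d → ℝ) → ℝ} (M : Matrix (Fin w) (Fin w) ℝ) (b : Fin w → ℝ)
      (hM : ∀ i j, |M i j| ≤ B) (hb : ∀ i, |b i| ≤ B) (hv : Hid d B w S h v) :
      Hid d B w (S + (nnz (fun p : Fin w × Fin w => M p.1 p.2) + nnz b)) (h + 1)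
        (fun i x => max ((M.mulVec (fun j => v j x) + b) i) 0)

variable {d : ℕ} {B : ℝ}

lemma Hid.pos {w S h : ℕ} {v : Fin w → (Fin d → ℝ) → ℝ} (hv : Hid d B w S h v) : 1 ≤ h := by
  cases hv <;> omega

/-- Two networks side by side. -/
lemma Hid.append {w₁ w₂ S₁ S₂ h : ℕ} {v₁ : Fin w₁ → (Fin d → ℝ) → ℝ}
    {v₂ : Fin w₂ → (Fin d → ℝ) → ℝ} (hB : 0 ≤ B)
    (h₁ : Hid d B w₁ S₁ h v₁) (h₂ : Hid d B w₂ S₂ h v₂) :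
    Hid d B (w₁ + w₂) (S₁ + S₂) h (Fin.append v₁ v₂) := by
  induction h₁ generalizing S₂ v₂ with
  | first M b hM hb =>
    cases h₂ with
    | first M' b' hM' hb' =>
      have := Hid.first (d := d) (B := B) (w := w₁ + w₂) (Fin.append (fun i => M i) fun i => M' i)
        (Fin.append b b')
        (fun i j => Fin.forall_append (p := fun r : Fin d → ℝ => |r j| ≤ B) (fun i => hM i j)
          (fun i => hM' i j) i)
        (Fin.forall_append (p := fun r : ℝ => |r| ≤ B) hb hb')
      convert this using 1
      · have e := congrArg₂ (· + ·) (nnz_append_rows M M') (nnz_append b b')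
        refine Eq.trans ?_ e.symm
        ring
      · funext i x
        refine Fin.addCases (fun i => ?_) (fun i => ?_) i <;> simp [Matrix.mulVec]
    | next M' b' hM' hb' hv' => exact absurd hv'.pos (by omega)
  | @next S h v M b hM hb hv ih =>
    cases h₂ with
    | first M' b' hM' hb' => exact absurd hv.pos (by omega)
    | @next S' _ v' M' b' hM' hb' hv' =>
      have := Hid.next (blockDiag M M') (Fin.append b b') (fun i j => ?_)
        (Fin.forall_append (p := fun r : ℝ => |r| ≤ B) hb hb') (ih hv')
      · rw [nnz_blockDiag, nnz_append] at this
        convert this using 1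
        · ring
        · funext i x
          refine Fin.addCases (fun i => ?_) (fun i => ?_) i <;>
            simp [Matrix.mulVec, blockDiag, dotProduct, Fin.sum_univ_add]
      · refine Fin.addCases (fun i => ?_) (fun i => ?_) i <;>
          refine Fin.addCases (fun j => ?_) (fun j => ?_) j <;>
          simp [blockDiag, hM, hM', hB]

lemma Hid.zero (hB : 0 ≤ B) (w h : ℕ) (hh : 1 ≤ h) : Hid d B w 0 h (fun _ _ => 0) := by
  induction h, hh using Nat.le_induction with
  | base =>
    have := Hid.first (d := d) (B := B) (w := w) 0 0 (by simp [hB]) (by simp [hB])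
    convert this using 1
    · simp [nnz]
    · simp
  | succ h _ ih =>
    have := Hid.next (d := d) (B := B) (w := w) 0 0 (by simp [hB]) (by simp [hB]) ih
    convert this using 1
    · simp [nnz]
    · simp

/-- Feeding the last hidden layer into a further network. -/
lemma Hid.exists_net {w S h : ℕ} {v : Fin w → (Fin d → ℝ) → ℝ} (hv : Hid d B w S h v) {H : ℕ}
    (φ : Net w H w) (hφ : φ.BoundedBy B) :
    ∃ ψ : Net w (H + h) d, ψ.sparsity = S + φ.sparsity ∧ ψ.BoundedBy B ∧
      ∀ x, ψ.eval x = φ.eval (fun j => v j x) := by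
  induction hv generalizing H with
  | first M b hM hb =>
    exact ⟨.layer M b φ, by simp [Net.sparsity], ⟨hM, hb, hφ⟩, fun x => rfl⟩
  | @next S h v M b hM hb hv ih =>
    obtain ⟨ψ, h1, h2, h3⟩ := ih (.layer M b φ) ⟨hM, hb, hφ⟩
    rw [show H + (h + 1) = H + 1 + h by ring]
    refine ⟨ψ, by rw [h1]; simp only [Net.sparsity]; ring, h2, fun x => by rw [h3]; rfl⟩

/-- `Out d B w S h f`: the function `f` is the output of a network without output bias, with `h`
hidden layers of width `w`, entries at most `B`, and at most `S` nonzero entries before the output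
layer. -/
def Out (d : ℕ) (B : ℝ) (w S h : ℕ) (f : (Fin d → ℝ) → ℝ) : Prop :=
  ∃ v S', S' ≤ S ∧ Hid d B w S' h v ∧ ∃ m : Fin w → ℝ, (∀ j, |m j| ≤ B) ∧
    ∀ x, f x = ∑ j, m j * v j x

lemma Out.add {w₁ w₂ S₁ S₂ h : ℕ} {f₁ f₂ : (Fin d → ℝ) → ℝ} (hB : 0 ≤ B)
    (h₁ : Out d B w₁ S₁ h f₁) (h₂ : Out d B w₂ S₂ h f₂) :
    Out d B (w₁ + w₂) (S₁ + S₂) h (fun x => f₁ x + f₂ x) := by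
  obtain ⟨v₁, T₁, hT₁, hv₁, m₁, hm₁, e₁⟩ := h₁
  obtain ⟨v₂, T₂, hT₂, hv₂, m₂, hm₂, e₂⟩ := h₂
  refine ⟨_, _, add_le_add hT₁ hT₂, hv₁.append hB hv₂, Fin.append m₁ m₂,
    Fin.forall_append (p := fun r : ℝ => |r| ≤ B) hm₁ hm₂, fun x => ?_⟩
  simp [Fin.sum_univ_add, e₁, e₂]

lemma Out.zero (hB : 0 ≤ B) (w S h : ℕ) (hh : 1 ≤ h) : Out d B w S h (fun _ => 0) :=
  ⟨_, 0, Nat.zero_le _, Hid.zero hB w h hh, 0, by simp [hB], by simp⟩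

lemma Out.sum {ι : Type*} {w S h : ℕ} (hB : 0 ≤ B) (hh : 1 ≤ h) (s : Finset ι)
    {f : ι → (Fin d → ℝ) → ℝ} (hf : ∀ i ∈ s, Out d B w S h (f i)) :
    Out d B (s.card * w) (s.card * S) h (fun x => ∑ i ∈ s, f i x) := by
  classical
  induction s using Finset.induction_on with
  | empty => simpa using Out.zero hB 0 0 h hh
  | insert a s ha ih =>
    have := (hf a (by simp)).add hB (ih fun i hi => hf i (by simp [hi]))
    rw [Finset.card_insert_of_notMem ha]
    simp only [Finset.sum_insert ha]
    convert this using 1 <;> ring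

lemma Out.mono_width {w w' S h : ℕ} {f : (Fin d → ℝ) → ℝ} (hB : 0 ≤ B) (hh : 1 ≤ h)
    (hf : Out d B w S h f) (hw : w ≤ w') : Out d B w' S h f := by
  obtain ⟨k, rfl⟩ := Nat.exists_eq_add_of_le hw
  simpa using hf.add hB (Out.zero hB k 0 h hh)

lemma Out.mem_reluClass {w S S' h : ℕ} {f : (Fin d → ℝ) → ℝ} (hB : 0 ≤ B)
    (hf : Out d B w S h f) (hS : S + w ≤ S') :
    (fun x : EuclideanSpace ℝ (Fin d) => f (fun i => x i)) ∈ reluClass d (h + 1) w S' B := by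
  obtain ⟨v, S₀, hS₀, hv, m, hm, e⟩ := hf
  obtain ⟨ψ, h1, h2, h3⟩ := hv.exists_net (.output m 0) ⟨hm, by simpa using hB⟩
  rw [add_comm h 1]
  refine ⟨ψ, ?_, h2, fun x => ?_⟩
  · have h4 := nnz_le_card m
    have h5 : nnz (fun _ : Unit => (0 : ℝ)) = 0 := nnz_zero
    simp only [Fintype.card_fin] at h4
    rw [h1]
    simp only [Net.sparsity, h5]
    omega
  · simp [h3, e, Net.eval]

/-- A bound for the number of entries of a layer of width `w`. -/
def layerSize (d w : ℕ) : ℕ := w * (w + d + 1)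

lemma layerSize_add (w₁ w₂ : ℕ) : layerSize d w₁ + layerSize d w₂ ≤ layerSize d (w₁ + w₂) := by
  simp only [layerSize]
  nlinarith [Nat.zero_le (w₁ * w₂)]

/-- `St d B w h L`: the functions in the list `L` occur among the activations of the `h`-th hidden
layer of a network of width `w` with entries at most `B`. -/
def St (d : ℕ) (B : ℝ) (w h : ℕ) (L : List ((Fin d → ℝ) → ℝ)) : Prop :=
  ∃ v S, S ≤ h * layerSize d w ∧ Hid d B w S h v ∧ ∀ g ∈ L, ∃ j, v j = g

lemma St.pos {w h : ℕ} {L : List ((Fin d → ℝ) → ℝ)} (hL : St d B w h L) : 1 ≤ h := by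
  obtain ⟨v, S, -, hv, -⟩ := hL
  exact hv.pos

lemma St.subset {w h : ℕ} {L L' : List ((Fin d → ℝ) → ℝ)} (hL : St d B w h L) (h' : L' ⊆ L) :
    St d B w h L' := by
  obtain ⟨v, S, hS, hv, e⟩ := hL
  exact ⟨v, S, hS, hv, fun g hg => e g (h' hg)⟩

lemma St.append {w₁ w₂ h : ℕ} {L₁ L₂ : List ((Fin d → ℝ) → ℝ)} (hB : 0 ≤ B)
    (h₁ : St d B w₁ h L₁) (h₂ : St d B w₂ h L₂) : St d B (w₁ + w₂) h (L₁ ++ L₂) := by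
  obtain ⟨v₁, S₁, hS₁, hv₁, e₁⟩ := h₁
  obtain ⟨v₂, S₂, hS₂, hv₂, e₂⟩ := h₂
  refine ⟨_, _, ?_, hv₁.append hB hv₂, fun g hg => ?_⟩
  · calc S₁ + S₂ ≤ h * layerSize d w₁ + h * layerSize d w₂ := add_le_add hS₁ hS₂
      _ = h * (layerSize d w₁ + layerSize d w₂) := by ring
      _ ≤ _ := Nat.mul_le_mul_left _ (layerSize_add _ _)
  · rcases List.mem_append.1 hg with hg | hg
    · obtain ⟨j, rfl⟩ := e₁ g hg
      exact ⟨Fin.castAdd _ j, by simp⟩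
    · obtain ⟨j, rfl⟩ := e₂ g hg
      exact ⟨Fin.natAdd _ j, by simp⟩

lemma St.nil (hB : 0 ≤ B) (w h : ℕ) (hh : 1 ≤ h) : St d B w h [] :=
  ⟨_, 0, Nat.zero_le _, Hid.zero hB w h hh, by simp⟩

lemma St.mono_width {w w' h : ℕ} {L : List ((Fin d → ℝ) → ℝ)} (hB : 0 ≤ B) (hL : St d B w h L)
    (hw : w ≤ w') : St d B w' h L := by
  obtain ⟨k, rfl⟩ := Nat.exists_eq_add_of_le hw
  simpa using hL.append hB (St.nil hB k h hL.pos)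

lemma St.flatMap {α : Type*} {w h : ℕ} (hB : 0 ≤ B) (hh : 1 ≤ h) (l : List α)
    {L : α → List ((Fin d → ℝ) → ℝ)} (hL : ∀ a ∈ l, St d B w h (L a)) :
    St d B (l.length * w) h (l.flatMap L) := by
  induction l with
  | nil => simpa using St.nil hB 0 h hh
  | cons a l ih =>
    have := (hL a (by simp)).append hB (ih fun i hi => hL i (by simp [hi]))
    simp only [List.flatMap_cons, List.length_cons]
    convert this using 1
    ring

lemma St.out {w h : ℕ} {g : (Fin d → ℝ) → ℝ} (hg : St d B w h [g]) (hB : 0 ≤ B) {c : ℝ}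
    (hc : |c| ≤ B) : Out d B w (h * layerSize d w) h (fun x => c * g x) := by
  classical
  obtain ⟨v, S, hS, hv, e⟩ := hg
  obtain ⟨j, rfl⟩ := e g (by simp)
  refine ⟨v, S, hS, hv, Pi.single j c, fun i => ?_, fun x => ?_⟩
  · by_cases hij : i = j
    · subst hij; simpa using hc
    · simpa [hij] using hB
  · simp [Pi.single_apply]

/-- `Aff L B ℓ`: the function `ℓ` is an affine combination of the functions in `L`, where the
absolute values of the coefficients have sum at most `B` and the constant is at most `B`. -/
def Aff (L : List ((Fin d → ℝ) → ℝ)) (B : ℝ) (ℓ : (Fin d → ℝ) → ℝ) : Prop :=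
  ∀ (w : ℕ) (v : Fin w → (Fin d → ℝ) → ℝ), (∀ g ∈ L, ∃ j, v j = g) →
    ∃ (m : Fin w → ℝ) (c : ℝ), ∑ j, |m j| ≤ B ∧ |c| ≤ B ∧ ∀ x, ℓ x = (∑ j, m j * v j x) + c

/-- The linear combination of the functions in a list; superfluous coefficients or functions are
ignored. -/
def lin : List ℝ → List ((Fin d → ℝ) → ℝ) → (Fin d → ℝ) → ℝ
  | c :: cs, g :: L, x => c * g x + lin cs L x
  | _, _, _ => 0

lemma Aff.const (L : List ((Fin d → ℝ) → ℝ)) {c : ℝ} (hc : |c| ≤ B) : Aff L B (fun _ => c) := by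
  intro w v _
  exact ⟨0, c, by simpa using (abs_nonneg c).trans hc, hc, by simp⟩

lemma Aff.smul_mem {L : List ((Fin d → ℝ) → ℝ)} {g : (Fin d → ℝ) → ℝ} (hg : g ∈ L) {c : ℝ} :
    Aff L |c| (fun x => c * g x) := by
  classical
  intro w v h
  obtain ⟨j, rfl⟩ := h g hg
  refine ⟨Pi.single j c, 0, ?_, by simp, fun x => by simp [Pi.single_apply]⟩
  rw [Finset.sum_eq_single j (fun i _ hi => by simp [hi]) (by simp)]
  simp

lemma Aff.add {L : List ((Fin d → ℝ) → ℝ)} {B₁ B₂ : ℝ} {f g : (Fin d → ℝ) → ℝ}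
    (hf : Aff L B₁ f) (hg : Aff L B₂ g) : Aff L (B₁ + B₂) (fun x => f x + g x) := by
  intro w v h
  obtain ⟨m₁, c₁, h1, h2, h3⟩ := hf w v h
  obtain ⟨m₂, c₂, k1, k2, k3⟩ := hg w v h
  refine ⟨m₁ + m₂, c₁ + c₂, ?_, (abs_add_le _ _).trans (add_le_add h2 k2), fun x => ?_⟩
  · calc ∑ j, |(m₁ + m₂) j| ≤ ∑ j, (|m₁ j| + |m₂ j|) := Finset.sum_le_sum fun j _ => abs_add_le _ _
      _ ≤ _ := by rw [Finset.sum_add_distrib]; exact add_le_add h1 k1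
  · simp only [h3, k3, Pi.add_apply, add_mul, Finset.sum_add_distrib]
    ring

lemma Aff.mono {L : List ((Fin d → ℝ) → ℝ)} {B₁ B₂ : ℝ} {f : (Fin d → ℝ) → ℝ}
    (hf : Aff L B₁ f) (h : B₁ ≤ B₂) : Aff L B₂ f := by
  intro w v hv
  obtain ⟨m, c, h1, h2, h3⟩ := hf w v hv
  exact ⟨m, c, h1.trans h, h2.trans h, h3⟩

lemma Aff.sum {ι : Type*} {L : List ((Fin d → ℝ) → ℝ)} {B : ι → ℝ} (s : Finset ι)
    {f : ι → (Fin d → ℝ) → ℝ} (hf : ∀ i ∈ s, Aff L (B i) (f i)) :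
    Aff L (∑ i ∈ s, B i) (fun x => ∑ i ∈ s, f i x) := by
  classical
  induction s using Finset.induction_on with
  | empty => simpa using Aff.const L (B := 0) (c := 0) (by simp)
  | insert a s ha ih =>
    simp only [Finset.sum_insert ha]
    exact (hf a (by simp)).add (ih fun i hi => hf i (by simp [hi]))

lemma Aff.lin (L : List ((Fin d → ℝ) → ℝ)) (cs : List ℝ) :
    Aff L (cs.map abs).sum (lin cs L) := by
  induction cs generalizing L with
  | nil => simpa [ReLUApprox.lin] using Aff.const L (B := 0) (c := 0) (by simp)
  | cons c cs ih =>
    have hnn : 0 ≤ ((c :: cs).map abs).sum := List.sum_nonneg (by simp)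
    cases L with
    | nil => exact Aff.const [] (c := 0) (by simpa using hnn)
    | cons g L =>
      have h1 : Aff (g :: L) |c| (fun x => c * g x) := Aff.smul_mem (by simp)
      have h2 : Aff (g :: L) (cs.map abs).sum (ReLUApprox.lin cs L) := by
        intro w v h
        exact ih L w v fun f hf => h f (by simp [hf])
      simpa [ReLUApprox.lin] using h1.add h2

/-- One further hidden layer. The bound for the sum of the weights in `Aff` makes each single entry
at most `B` even if functions in the list coincide. -/
lemma St.step_aff {w h : ℕ} {L L' : List ((Fin d → ℝ) → ℝ)} (hB : 0 ≤ B) (hL : St d B w h L)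
    (hw : L'.length ≤ w) (hL' : ∀ g ∈ L', ∃ ℓ, Aff L B ℓ ∧ ∀ x, g x = max (ℓ x) 0) :
    St d B w (h + 1) L' := by
  obtain ⟨v, S, hS, hv, e⟩ := hL
  have key : ∀ j : Fin w, ∃ (m : Fin w → ℝ) (c : ℝ), (∀ j, |m j| ≤ B) ∧ |c| ≤ B ∧
      ∀ x, L'.getD j (fun _ => 0) x = max ((∑ j, m j * v j x) + c) 0 := by
    intro j
    by_cases hj : (j : ℕ) < L'.length
    · rw [List.getD_eq_getElem _ _ hj]
      obtain ⟨ℓ, hℓ, h1⟩ := hL' _ (List.getElem_mem hj)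
      obtain ⟨m, c, h2, h3, h4⟩ := hℓ w v e
      refine ⟨m, c, fun k => ?_, h3, fun x => by rw [h1, h4]⟩
      exact (Finset.single_le_sum (f := fun j => |m j|) (fun i _ => abs_nonneg _)
        (Finset.mem_univ k)).trans h2
    · rw [List.getD_eq_default _ _ (by omega)]
      exact ⟨0, 0, by simp [hB], by simp [hB], by simp⟩
  choose m c hm hc hx using key
  refine ⟨_, _, ?_, hv.next (Matrix.of m) c hm hc, fun g hg => ?_⟩
  · have h1 := nnz_le_card (fun p : Fin w × Fin w => Matrix.of m p.1 p.2)
    have h2 := nnz_le_card c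
    simp only [Fintype.card_prod, Fintype.card_fin] at h1 h2
    simp only [layerSize] at hS ⊢
    nlinarith
  · obtain ⟨i, hi, rfl⟩ := List.getElem_of_mem hg
    refine ⟨⟨i, by omega⟩, ?_⟩
    funext x
    have := hx ⟨i, by omega⟩ x
    rw [List.getD_eq_getElem _ _ hi] at this
    rw [this]
    simp [Matrix.mulVec, dotProduct]

/-- One further hidden layer, with its weights given as lists. -/
lemma St.step {w h : ℕ} {L L' : List ((Fin d → ℝ) → ℝ)} (hB : 0 ≤ B) (hL : St d B w h L)
    (hw : L'.length ≤ w)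
    (hL' : ∀ g ∈ L', ∃ b cs, (cs.map abs).sum + |b| ≤ B ∧
      ∀ x, g x = max (lin cs L x + b) 0) :
    St d B w (h + 1) L' := by
  refine hL.step_aff hB hw fun g hg => ?_
  obtain ⟨b, cs, h2, h3⟩ := hL' g hg
  exact ⟨_, ((Aff.lin L cs).add (Aff.const L le_rfl)).mono h2, h3⟩

/-- Nonnegative activations can be carried through further layers. -/
lemma St.pad {w h : ℕ} {L : List ((Fin d → ℝ) → ℝ)} (hB : 1 ≤ B) (hL : St d B w h L)
    (hw : L.length ≤ w) (h0 : ∀ g ∈ L, ∀ x, 0 ≤ g x) {h' : ℕ} (hh : h ≤ h') :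
    St d B w h' L := by
  induction h', hh using Nat.le_induction with
  | base => exact hL
  | succ h' _ ih =>
    refine ih.step_aff (by linarith) hw fun g hg =>
      ⟨fun x => 1 * g x, (Aff.smul_mem hg).mono (by simpa using hB), fun x => ?_⟩
    simp [h0 g hg x]

/-- A single neuron reading one coordinate of the input. -/
lemma St.input (i : Fin d) {c b : ℝ} (hc : |c| ≤ B) (hb : |b| ≤ B) :
    St d B 1 1 [fun x => max (c * x i + b) 0] := by
  classical
  have hB : 0 ≤ B := (abs_nonneg c).trans hc
  refine ⟨_, _, ?_, Hid.first (Matrix.of fun _ => Pi.single i c) (fun _ => b) (fun _ j => ?_)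
    (fun _ => hb), fun g hg => ⟨0, ?_⟩⟩
  · refine (add_le_add (nnz_le_card _) (nnz_le_card _)).trans ?_
    simp only [layerSize, Fintype.card_prod, Fintype.card_fin]
    omega
  · by_cases hij : j = i
    · subst hij; simpa using hc
    · simpa [hij] using hB
  · rw [List.mem_singleton.1 hg]
    funext x
    simp [Matrix.mulVec, dotProduct, Pi.single_apply]

/-! ### Approximate multiplication -/

/-- The projection of `ℝ` onto `[0, 1]`, in the form in which two hidden layers compute it. -/
noncomputable def clip (t : ℝ) : ℝ := max (1 - max (1 - t) 0) 0

lemma clip_nonneg (t : ℝ) : 0 ≤ clip t := le_max_right _ _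

lemma clip_le_one (t : ℝ) : clip t ≤ 1 :=
  max_le (by linarith [le_max_right (1 - t) 0]) zero_le_one

lemma clip_of_nonpos {t : ℝ} (h : t ≤ 0) : clip t = 0 := by
  rw [clip, max_eq_left (a := 1 - t) (by linarith), max_eq_right (by linarith)]

lemma clip_of_one_le {t : ℝ} (h : 1 ≤ t) : clip t = 1 := by
  rw [clip, max_eq_right (a := 1 - t) (by linarith), max_eq_left (by linarith), sub_zero]

lemma clip_of_mem {t : ℝ} (h0 : 0 ≤ t) (h1 : t ≤ 1) : clip t = t := by
  rw [clip, max_eq_left (a := 1 - t) (by linarith), max_eq_left (by linarith)]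
  ring

lemma abs_clip_sub_le {s t : ℝ} (h0 : 0 ≤ t) (h1 : t ≤ 1) : |clip s - t| ≤ |s - t| := by
  rcases le_total s 0 with h | h
  · rw [clip_of_nonpos h, abs_of_nonpos (by linarith), abs_of_nonpos (by linarith)]
    linarith
  · rcases le_total s 1 with h' | h'
    · rw [clip_of_mem h h']
    · rw [clip_of_one_le h', abs_of_nonneg (by linarith), abs_of_nonneg (by linarith)]
      linarith

/-- The tent map on `[0, 1]`; outside of that interval only the form of the network matters. -/
noncomputable def tent (t : ℝ) : ℝ := max (2 * t - 4 * max (t - 1 / 2) 0) 0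

lemma tent_of_le {t : ℝ} (h0 : 0 ≤ t) (h : t ≤ 1 / 2) : tent t = 2 * t := by
  rw [tent, max_eq_right (a := t - 1 / 2) (by linarith), max_eq_left (by linarith)]
  ring

lemma tent_of_ge {t : ℝ} (h : 1 / 2 ≤ t) (h1 : t ≤ 1) : tent t = 2 - 2 * t := by
  rw [tent, max_eq_left (a := t - 1 / 2) (by linarith), max_eq_left (by linarith)]
  ring

lemma tent_eq {t : ℝ} (h0 : 0 ≤ t) (h1 : t ≤ 1) : tent t = 2 * t - 4 * max (t - 1 / 2) 0 := by
  rcases le_total t (1 / 2) with h | h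
  · rw [tent_of_le h0 h, max_eq_right (by linarith)]
    ring
  · rw [tent_of_ge h h1, max_eq_left (by linarith)]
    ring

lemma tent_mem {t : ℝ} (ht : t ∈ Set.Icc (0 : ℝ) 1) : tent t ∈ Set.Icc (0 : ℝ) 1 := by
  rcases le_total t (1 / 2) with h | h
  · rw [tent_of_le ht.1 h]
    exact ⟨by linarith [ht.1], by linarith⟩
  · rw [tent_of_ge h ht.2]
    exact ⟨by linarith [ht.2], by linarith⟩

lemma tent_iterate_mem {t : ℝ} (ht : t ∈ Set.Icc (0 : ℝ) 1) (m : ℕ) :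
    tent^[m] t ∈ Set.Icc (0 : ℝ) 1 := by
  induction m with
  | zero => exact ht
  | succ m ih =>
    rw [Function.iterate_succ_apply']
    exact tent_mem ih

/-- The piecewise linear interpolation of `t ^ 2` at the multiples of `2 ^ (-m)` in `[0, 1]`,
written as a sum of iterated tent maps. -/
noncomputable def sqApprox (m : ℕ) (t : ℝ) : ℝ :=
  t - ∑ k ∈ Finset.range m, tent^[k + 1] t / 4 ^ (k + 1)

lemma sqApprox_succ (m : ℕ) (t : ℝ) :
    sqApprox (m + 1) t = sqApprox m t - tent (tent^[m] t) / 4 ^ (m + 1) := by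
  simp only [sqApprox, Finset.sum_range_succ, Function.iterate_succ_apply']
  ring

/-- The self-similarity `t (1 - t) = tent t / 4 + tent t (1 - tent t) / 4`, iterated. -/
lemma sqApprox_eq {t : ℝ} (ht : t ∈ Set.Icc (0 : ℝ) 1) (m : ℕ) :
    sqApprox m t = t ^ 2 + tent^[m] t * (1 - tent^[m] t) / 4 ^ m := by
  induction m with
  | zero => simp [sqApprox]; ring
  | succ m ih =>
    rw [sqApprox_succ, ih, Function.iterate_succ_apply', pow_succ]
    have hu := tent_iterate_mem ht m
    set u := tent^[m] t
    have key : u * (1 - u) = tent u / 4 + tent u * (1 - tent u) / 4 := by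
      rcases le_total u (1 / 2) with h | h
      · rw [tent_of_le hu.1 h]; ring
      · rw [tent_of_ge h hu.2]; ring
    rw [key]
    field_simp
    ring

lemma sqApprox_bounds {t : ℝ} (ht : t ∈ Set.Icc (0 : ℝ) 1) (m : ℕ) :
    t ^ 2 ≤ sqApprox m t ∧ sqApprox m t ≤ t ^ 2 + 1 / 4 ^ m := by
  rw [sqApprox_eq ht]
  obtain ⟨h0, h1⟩ := tent_iterate_mem ht m
  set u := tent^[m] t
  have h4 : (0 : ℝ) < 4 ^ m := by positivity
  refine ⟨?_, ?_⟩
  · have : 0 ≤ u * (1 - u) / 4 ^ m := div_nonneg (mul_nonneg h0 (by linarith)) h4.le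
    linarith
  · have : u * (1 - u) / 4 ^ m ≤ 1 / 4 ^ m := by
      gcongr
      nlinarith
    linarith

/-- The approximate product, from `x y = ((x + y) / 2) ^ 2 - (|x - y| / 2) ^ 2`. -/
noncomputable def mulApprox (m : ℕ) (x y : ℝ) : ℝ :=
  clip (sqApprox m ((x + y) / 2) - sqApprox m (max ((x - y) / 2) 0 + max ((y - x) / 2) 0))

lemma max_add_max_eq_abs (x y : ℝ) : max ((x - y) / 2) 0 + max ((y - x) / 2) 0 = |x - y| / 2 := by
  rcases le_total x y with h | h
  · rw [max_eq_right (by linarith), max_eq_left (by linarith), abs_of_nonpos (by linarith)]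
    ring
  · rw [max_eq_left (by linarith), max_eq_right (by linarith), abs_of_nonneg (by linarith)]
    ring

lemma abs_sub_div_two_mem {x y : ℝ} (hx : x ∈ Set.Icc (0 : ℝ) 1) (hy : y ∈ Set.Icc (0 : ℝ) 1) :
    |x - y| / 2 ∈ Set.Icc (0 : ℝ) 1 := by
  have h : |x - y| ≤ 1 := abs_sub_le_iff.2 ⟨by linarith [hx.2, hy.1], by linarith [hy.2, hx.1]⟩
  exact ⟨by positivity, by linarith⟩

lemma add_div_two_mem {x y : ℝ} (hx : x ∈ Set.Icc (0 : ℝ) 1) (hy : y ∈ Set.Icc (0 : ℝ) 1) :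
    (x + y) / 2 ∈ Set.Icc (0 : ℝ) 1 :=
  ⟨by linarith [hx.1, hy.1], by linarith [hx.2, hy.2]⟩

lemma mulApprox_mem (m : ℕ) (x y : ℝ) : mulApprox m x y ∈ Set.Icc (0 : ℝ) 1 :=
  ⟨clip_nonneg _, clip_le_one _⟩

lemma abs_mulApprox_sub_le {x y : ℝ} (hx : x ∈ Set.Icc (0 : ℝ) 1) (hy : y ∈ Set.Icc (0 : ℝ) 1)
    (m : ℕ) : |mulApprox m x y - x * y| ≤ 1 / 4 ^ m := by
  refine (abs_clip_sub_le (mul_nonneg hx.1 hy.1) (mul_le_one₀ hx.2 hy.1 hy.2)).trans ?_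
  rw [max_add_max_eq_abs]
  have h1 := sqApprox_bounds (add_div_two_mem hx hy) m
  have h2 := sqApprox_bounds (abs_sub_div_two_mem hx hy) m
  have h3 : (|x - y| / 2) ^ 2 = (x - y) ^ 2 / 4 := by rw [div_pow, sq_abs]; norm_num
  rw [h3] at h2
  rw [abs_le]
  constructor <;> nlinarith [h1.1, h1.2, h2.1, h2.2]

lemma mulApprox_zero_left {y : ℝ} (hy : 0 ≤ y) (m : ℕ) : mulApprox m 0 y = 0 := by
  rw [mulApprox, max_add_max_eq_abs]
  rw [show (0 + y) / 2 = |0 - y| / 2 by rw [zero_sub, abs_neg, abs_of_nonneg hy, zero_add]]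
  exact clip_of_nonpos (by simp)

lemma mulApprox_zero_right {x : ℝ} (hx : 0 ≤ x) (m : ℕ) : mulApprox m x 0 = 0 := by
  rw [mulApprox, max_add_max_eq_abs]
  rw [show (x + 0) / 2 = |x - 0| / 2 by rw [sub_zero, abs_of_nonneg hx, add_zero]]
  exact clip_of_nonpos (by simp)

variable {d : ℕ} {B : ℝ}

/-- The interpolation of the squares of two functions, side by side. -/
lemma St.interpolate_sq {w h : ℕ} {g g' : (Fin d → ℝ) → ℝ} (hB : 8 ≤ B) (hw : 6 ≤ w)
    (hL : St d B w h [g, g']) (hg : ∀ x, g x ∈ Set.Icc (0 : ℝ) 1)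
    (hg' : ∀ x, g' x ∈ Set.Icc (0 : ℝ) 1) (m : ℕ) :
    St d B w (h + 2 * m) [fun x => tent^[m] (g x), fun x => sqApprox m (g x),
      fun x => tent^[m] (g' x), fun x => sqApprox m (g' x)] := by
  induction m with
  | zero => simpa [sqApprox] using hL.subset (L' := [g, g, g', g']) (by simp)
  | succ m ih =>
    have s1 := ih.step (L' := [fun x => tent^[m] (g x), fun x => max (tent^[m] (g x) - 1 / 2) 0,
      fun x => sqApprox m (g x), fun x => tent^[m] (g' x),
      fun x => max (tent^[m] (g' x) - 1 / 2) 0, fun x => sqApprox m (g' x)])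
      (by linarith) (by simpa using hw) ?_
    · refine s1.step (by linarith) (by simp; omega) ?_
      have h4 : (1 : ℝ) ≤ 4 ^ (m + 1) := one_le_pow₀ (by norm_num)
      have h5 : (4 ^ (m + 1) : ℝ)⁻¹ ≤ 1 := inv_le_one_of_one_le₀ h4
      have h6 : (0 : ℝ) < (4 ^ (m + 1) : ℝ)⁻¹ := by positivity
      have e : ∀ t ∈ Set.Icc (0 : ℝ) 1, sqApprox (m + 1) t =
          max (-2 * (4 ^ (m + 1) : ℝ)⁻¹ * tent^[m] t +
            (4 * (4 ^ (m + 1) : ℝ)⁻¹ * max (tent^[m] t - 1 / 2) 0 +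
              sqApprox m t)) 0 := by
        intro t ht
        have h0 := (sq_nonneg t).trans (sqApprox_bounds ht (m + 1)).1
        have hu := tent_iterate_mem ht m
        rw [max_eq_left, sqApprox_succ, tent_eq hu.1 hu.2]
        · ring
        · rw [sqApprox_succ, tent_eq hu.1 hu.2] at h0
          refine h0.trans (le_of_eq ?_)
          ring
      simp only [List.forall_mem_cons, List.not_mem_nil, false_imp_iff, implies_true, and_true]
      refine ⟨⟨0, [2, -4], ?_, fun x => ?_⟩,
        ⟨0, [-2 * (4 ^ (m + 1) : ℝ)⁻¹, 4 * (4 ^ (m + 1) : ℝ)⁻¹, 1], ?_, fun x => ?_⟩,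
        ⟨0, [0, 0, 0, 2, -4], ?_, fun x => ?_⟩,
        ⟨0, [0, 0, 0, -2 * (4 ^ (m + 1) : ℝ)⁻¹, 4 * (4 ^ (m + 1) : ℝ)⁻¹, 1], ?_, fun x => ?_⟩⟩
      · norm_num; linarith
      · rw [Function.iterate_succ_apply', tent]
        simp [lin, sub_eq_add_neg]
      · simp [abs_mul, abs_of_pos h6]; linarith
      · simpa [lin] using e _ (hg x)
      · norm_num; linarith
      · rw [Function.iterate_succ_apply', tent]
        simp [lin, sub_eq_add_neg]
      · simp [abs_mul, abs_of_pos h6]; linarith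
      · simpa [lin] using e _ (hg' x)
    · have e1 := fun x => (tent_iterate_mem (hg x) m).1
      have e2 := fun x => (tent_iterate_mem (hg' x) m).1
      have e3 := fun x => (sq_nonneg _).trans (sqApprox_bounds (hg x) m).1
      have e4 := fun x => (sq_nonneg _).trans (sqApprox_bounds (hg' x) m).1
      simp only [List.forall_mem_cons, List.not_mem_nil, false_imp_iff, implies_true, and_true]
      refine ⟨⟨0, [1], ?_, fun x => ?_⟩, ⟨-1 / 2, [1], ?_, fun x => ?_⟩,
        ⟨0, [0, 1], ?_, fun x => ?_⟩, ⟨0, [0, 0, 1], ?_, fun x => ?_⟩,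
        ⟨-1 / 2, [0, 0, 1], ?_, fun x => ?_⟩, ⟨0, [0, 0, 0, 1], ?_, fun x => ?_⟩⟩
      · norm_num; linarith
      · simp [lin, e1]
      · norm_num [abs_div]; linarith
      · simp [lin, sub_eq_add_neg, neg_div]
      · norm_num; linarith
      · simp [lin, e3]
      · norm_num; linarith
      · simp [lin, e2]
      · norm_num [abs_div]; linarith
      · simp [lin, sub_eq_add_neg, neg_div]
      · norm_num; linarith
      · simp [lin, e4]

/-- One approximate multiplication. -/
lemma St.mul {w h : ℕ} {g g' : (Fin d → ℝ) → ℝ} (hB : 8 ≤ B) (hw : 6 ≤ w)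
    (hL : St d B w h [g, g']) (hg : ∀ x, g x ∈ Set.Icc (0 : ℝ) 1)
    (hg' : ∀ x, g' x ∈ Set.Icc (0 : ℝ) 1) (m : ℕ) :
    St d B w (h + (2 * m + 4)) [fun x => mulApprox m (g x) (g' x)] := by
  have s1 := hL.step (L' := [fun x => (g x + g' x) / 2, fun x => max ((g x - g' x) / 2) 0,
    fun x => max ((g' x - g x) / 2) 0]) (by linarith) (by simp; omega) (by
      simp only [List.forall_mem_cons, List.not_mem_nil, false_imp_iff, implies_true, and_true]
      refine ⟨⟨0, [1 / 2, 1 / 2], ?_, fun x => ?_⟩, ⟨0, [1 / 2, -1 / 2], ?_, fun x => ?_⟩,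
        ⟨0, [-1 / 2, 1 / 2], ?_, fun x => ?_⟩⟩
      · norm_num; linarith
      · rw [max_eq_left] <;> simp only [lin] <;> linarith [(hg x).1, (hg' x).1]
      · norm_num [abs_div]; linarith
      · congr 1; simp only [lin]; ring
      · norm_num [abs_div]; linarith
      · congr 1; simp only [lin]; ring)
  have s2 := s1.step (L' := [fun x => (g x + g' x) / 2,
    fun x => max ((g x - g' x) / 2) 0 + max ((g' x - g x) / 2) 0]) (by linarith)
    (by simp; omega) (by
      simp only [List.forall_mem_cons, List.not_mem_nil, false_imp_iff, implies_true, and_true]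
      refine ⟨⟨0, [1], ?_, fun x => ?_⟩, ⟨0, [0, 1, 1], ?_, fun x => ?_⟩⟩
      · norm_num; linarith
      · rw [max_eq_left] <;> simp only [lin] <;> linarith [(hg x).1, (hg' x).1]
      · norm_num; linarith
      · have h1 := le_max_right ((g x - g' x) / 2) 0
        have h2 := le_max_right ((g' x - g x) / 2) 0
        simp only [lin]
        rw [max_eq_left (a := _ + (_ : ℝ)) (by linarith)]
        ring)
  have s3 := s2.interpolate_sq hB hw (fun x => add_div_two_mem (hg x) (hg' x))
    (fun x => by rw [max_add_max_eq_abs]; exact abs_sub_div_two_mem (hg x) (hg' x)) m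
  have s4 := s3.step (L' := [fun x => max (1 - (sqApprox m ((g x + g' x) / 2) -
    sqApprox m (max ((g x - g' x) / 2) 0 + max ((g' x - g x) / 2) 0))) 0])
    (by linarith) (by simp; omega) (by
      simp only [List.forall_mem_cons, List.not_mem_nil, false_imp_iff, implies_true, and_true]
      refine ⟨1, [0, -1, 0, 1], ?_, fun x => ?_⟩
      · norm_num; linarith
      · congr 1; simp only [lin]; ring)
  have s5 := s4.step (L' := [fun x => mulApprox m (g x) (g' x)])
    (by linarith) (by simp; omega) (by
      simp only [List.forall_mem_cons, List.not_mem_nil, false_imp_iff, implies_true, and_true]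
      refine ⟨1, [-1], ?_, fun x => ?_⟩
      · norm_num; linarith
      · rw [mulApprox, clip]; congr 1; simp only [lin]; ring)
  convert s5 using 1
  ring

/-- Products of `2 ^ r` factors in `[0, 1]`, by a binary tree of approximate multiplications. The
approximation vanishes exactly wherever one of the factors does. -/
lemma St.exists_prod {w h : ℕ} (hB : 8 ≤ B) (hw : 6 ≤ w) (m r : ℕ)
    {g : ℕ → (Fin d → ℝ) → ℝ} (hg : ∀ i x, g i x ∈ Set.Icc (0 : ℝ) 1)
    (hL : ∀ i, St d B w h [g i]) :
    ∃ P : (Fin d → ℝ) → ℝ, St d B (2 ^ r * w) (h + r * (2 * m + 4)) [P] ∧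
      (∀ x, P x ∈ Set.Icc (0 : ℝ) 1) ∧ (∀ i < 2 ^ r, ∀ x, g i x = 0 → P x = 0) ∧
      ∀ x, |P x - ∏ i ∈ Finset.range (2 ^ r), g i x| ≤ (2 ^ r - 1) / 4 ^ m := by
  induction r generalizing g with
  | zero => exact ⟨g 0, by simpa using hL 0, hg 0, by simp +contextual, by simp⟩
  | succ r ih =>
    obtain ⟨P, hP, hP1, hP2, hP3⟩ := ih hg hL
    obtain ⟨Q, hQ, hQ1, hQ2, hQ3⟩ := ih (g := fun i => g (2 ^ r + i)) (fun i => hg _)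
      (fun i => hL _)
    have hr : 1 ≤ 2 ^ r := Nat.one_le_two_pow
    refine ⟨fun x => mulApprox m (P x) (Q x), ?_, fun x => mulApprox_mem _ _ _, ?_, fun x => ?_⟩
    · have := (hP.append (by linarith) hQ).mul hB (by nlinarith) hP1 hQ1 m
      convert this using 1 <;> ring
    · intro i hi x hx
      rcases lt_or_ge i (2 ^ r) with h | h
      · simp only [hP2 i h x hx]
        exact mulApprox_zero_left (hQ1 x).1 m
      · obtain ⟨k, rfl⟩ := Nat.exists_eq_add_of_le h
        simp only [hQ2 k (by rw [pow_succ] at hi; omega) x hx]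
        exact mulApprox_zero_right (hP1 x).1 m
    · rw [pow_succ, mul_two, Finset.prod_range_add, pow_succ, mul_two]
      set p := ∏ i ∈ Finset.range (2 ^ r), g i x
      set q := ∏ i ∈ Finset.range (2 ^ r), g (2 ^ r + i) x
      have hp : |p| ≤ 1 := by
        rw [abs_of_nonneg (Finset.prod_nonneg fun i _ => (hg i x).1)]
        exact Finset.prod_le_one (fun i _ => (hg i x).1) fun i _ => (hg i x).2
      have hQx : |Q x| ≤ 1 := by rw [abs_of_nonneg (hQ1 x).1]; exact (hQ1 x).2
      calc |mulApprox m (P x) (Q x) - p * q|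
          = |(mulApprox m (P x) (Q x) - P x * Q x) + (P x - p) * Q x + p * (Q x - q)| := by
            congr 1; ring
        _ ≤ |mulApprox m (P x) (Q x) - P x * Q x| + |P x - p| * |Q x| + |p| * |Q x - q| := by
            rw [← abs_mul, ← abs_mul]
            exact (abs_add_le _ _).trans (add_le_add (abs_add_le _ _) le_rfl)
        _ ≤ 1 / 4 ^ m + (2 ^ r - 1) / 4 ^ m * 1 + 1 * ((2 ^ r - 1) / 4 ^ m) := by
            have h1 := hP3 x
            have h2 := hQ3 x
            have h3 := abs_mulApprox_sub_le (hP1 x) (hQ1 x) m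
            gcongr
            exact (abs_nonneg _).trans h1
        _ = (2 ^ r + 2 ^ r - 1) / 4 ^ m := by ring

/-! ### Reading off binary digits and table lookup -/

/-- The continuous step with slope `σ` starting at `1 / 2`: the leading binary digit of
`t ∈ [0, 1)`, unless `t` lies just above `1 / 2`. -/
noncomputable def leadBit (σ t : ℝ) : ℝ := clip (σ * (t - 1 / 2))

/-- One step of the digit extraction: the leading binary digit is removed from the first component
and appended to the second one. -/
noncomputable def digitStep (σ : ℝ) (p : ℝ × ℝ) : ℝ × ℝ :=
  (max (2 * p.1 - leadBit σ p.1) 0, 2 * p.2 + leadBit σ p.1)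

lemma digitStep_iterate_nonneg {σ : ℝ} {p : ℝ × ℝ} (h1 : 0 ≤ p.1) (h2 : 0 ≤ p.2) (k : ℕ) :
    0 ≤ ((digitStep σ)^[k] p).1 ∧ 0 ≤ ((digitStep σ)^[k] p).2 := by
  induction k with
  | zero => exact ⟨h1, h2⟩
  | succ k ih =>
    rw [Function.iterate_succ_apply']
    have h0 : 0 ≤ leadBit σ ((digitStep σ)^[k] p).1 := clip_nonneg _
    exact ⟨le_max_right _ _, by simp only [digitStep]; linarith [ih.2]⟩

/-- Digit extraction is exact at the points whose distance to the next dyadic number on the left is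
large compared with the reciprocal of the slope. -/
lemma digitStep_iterate_eq {σ θ : ℝ} (hσ : 0 ≤ σ) (a : ℕ) (hσθ : 2 ^ a ≤ σ * θ) {f : ℝ}
    (hθ : θ ≤ f) (hf0 : 0 ≤ f) (hf1 : f < 1) (j : ℕ) (hj : j < 2 ^ a) (A : ℝ) :
    (digitStep σ)^[a] (((j : ℝ) + f) / 2 ^ a, A) = (f, 2 ^ a * A + j) := by
  induction a generalizing j A with
  | zero =>
    have : j = 0 := by simpa using hj
    simp [this]
  | succ a ih =>
    have h2 : (0 : ℝ) < 2 ^ a := by positivity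
    have hσθ' : 2 ^ a ≤ σ * θ := by
      refine le_trans ?_ hσθ
      rw [pow_succ]; linarith
    rw [Function.iterate_succ_apply]
    rcases lt_or_ge j (2 ^ a) with h | h
    · have hb : leadBit σ (((j : ℝ) + f) / 2 ^ (a + 1)) = 0 := by
        refine clip_of_nonpos (mul_nonpos_of_nonneg_of_nonpos hσ ?_)
        have : (j : ℝ) + 1 ≤ 2 ^ a := by exact_mod_cast h
        rw [sub_nonpos, div_le_iff₀ (by positivity), pow_succ]
        linarith
      have e : digitStep σ (((j : ℝ) + f) / 2 ^ (a + 1), A) = (((j : ℝ) + f) / 2 ^ a, 2 * A) := by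
        simp only [digitStep, hb]
        rw [max_eq_left (by simp only [sub_zero]; positivity)]
        ext
        · simp only [pow_succ]; field_simp; ring
        · simp
      rw [e, ih hσθ' j h]
      ext
      · rfl
      · simp only [pow_succ]; ring
    · obtain ⟨k, rfl⟩ := Nat.exists_eq_add_of_le h
      have hk : k < 2 ^ a := by rw [pow_succ] at hj; omega
      have e1 : (((2 ^ a + k : ℕ) : ℝ) + f) / 2 ^ (a + 1) - 1 / 2 = ((k : ℝ) + f) / 2 ^ (a + 1) := by
        push_cast
        rw [pow_succ]
        field_simp
        ring
      have hb : leadBit σ ((((2 ^ a + k : ℕ) : ℝ) + f) / 2 ^ (a + 1)) = 1 := by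
        refine clip_of_one_le ?_
        rw [e1, ← mul_div_assoc, le_div_iff₀ (by positivity), one_mul]
        refine hσθ.trans ?_
        gcongr
        linarith [(Nat.cast_nonneg k : (0 : ℝ) ≤ k)]
      have e : digitStep σ ((((2 ^ a + k : ℕ) : ℝ) + f) / 2 ^ (a + 1), A) =
          (((k : ℝ) + f) / 2 ^ a, 2 * A + 1) := by
        simp only [digitStep, hb]
        have e2 : 2 * ((((2 ^ a + k : ℕ) : ℝ) + f) / 2 ^ (a + 1)) - 1 = ((k : ℝ) + f) / 2 ^ a := by
          have : 2 * ((((2 ^ a + k : ℕ) : ℝ) + f) / 2 ^ (a + 1)) - 1 =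
            2 * ((((2 ^ a + k : ℕ) : ℝ) + f) / 2 ^ (a + 1) - 1 / 2) := by ring
          rw [this, e1, pow_succ]
          field_simp
        rw [e2, max_eq_left (by positivity)]
      rw [e, ih hσθ' k hk]
      ext
      · rfl
      · push_cast; simp only [pow_succ]; ring

/-- The hat function centred at `p`. -/
noncomputable def hat (a p : ℝ) : ℝ := max (1 - max (a - p) 0 - max (p - a) 0) 0

lemma hat_self (a : ℝ) : hat a a = 1 := by simp [hat]

lemma hat_natCast_of_ne {a p : ℕ} (h : a ≠ p) : hat a p = 0 := by
  rw [hat, max_eq_right]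
  rcases lt_or_gt_of_ne h with h | h
  · have : (a : ℝ) + 1 ≤ p := by exact_mod_cast h
    linarith [le_max_right ((a : ℝ) - p) 0, le_max_left ((p : ℝ) - a) 0]
  · have : (p : ℝ) + 1 ≤ a := by exact_mod_cast h
    linarith [le_max_left ((a : ℝ) - p) 0, le_max_right ((p : ℝ) - a) 0]

lemma hat_natCast (a p : ℕ) : hat a p = if a = p then 1 else 0 := by
  split_ifs with h
  · rw [h, hat_self]
  · exact hat_natCast_of_ne h

lemma hat_nonneg (a p : ℝ) : 0 ≤ hat a p := le_max_right _ _

/-- The number with base-`4` digits `β 0, …, β (n - 1)` after the point. For digits in `{0, 1}` the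
first digit is a Lipschitz function of this number. -/
noncomputable def code : (ℕ → ℝ) → ℕ → ℝ
  | _, 0 => 0
  | β, n + 1 => (β 0 + code (fun i => β (i + 1)) n) / 4

lemma code_mem {β : ℕ → ℝ} (hβ : ∀ i, β i = 0 ∨ β i = 1) (n : ℕ) :
    0 ≤ code β n ∧ code β n ≤ 1 / 3 := by
  induction n generalizing β with
  | zero => norm_num [code]
  | succ n ih =>
    have h := ih (β := fun i => β (i + 1)) fun i => hβ _
    rw [code]
    rcases hβ 0 with h0 | h0 <;> rw [h0] <;> constructor <;> linarith [h.1, h.2]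

/-- The first digit of a number with base-`4` digits in `{0, 1}`. -/
noncomputable def bitFour (t : ℝ) : ℝ := clip (8 * t - 1)

lemma bitFour_code {β : ℕ → ℝ} (hβ : ∀ i, β i = 0 ∨ β i = 1) (n : ℕ) :
    bitFour (code β (n + 1)) = β 0 := by
  have h := code_mem (β := fun i => β (i + 1)) (fun i => hβ _) n
  rw [code, bitFour]
  rcases hβ 0 with h0 | h0 <;> rw [h0]
  · exact clip_of_nonpos (by linarith)
  · exact clip_of_one_le (by linarith)

/-- The state after reading `r` base-`4` digits of `t`: the remaining number, and the sum of `ω i`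
times the `i`-th digit over those `i < r` with `pos i = b`, if `b` and the `pos i` are integers. -/
noncomputable def readState (ω pos : ℕ → ℝ) (t b : ℝ) : ℕ → ℝ × ℝ
  | 0 => (t, 0)
  | r + 1 => (max (4 * (readState ω pos t b r).1 - bitFour (readState ω pos t b r).1) 0,
      (readState ω pos t b r).2 +
        ω r * max (bitFour (readState ω pos t b r).1 + hat b (pos r) - 1) 0)

lemma readState_nonneg {ω pos : ℕ → ℝ} (hω : ∀ i, 0 ≤ ω i) {t : ℝ} (ht : 0 ≤ t) (b : ℝ) (r : ℕ) :
    0 ≤ (readState ω pos t b r).1 ∧ 0 ≤ (readState ω pos t b r).2 := by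
  induction r with
  | zero => exact ⟨ht, le_rfl⟩
  | succ r ih =>
    exact ⟨le_max_right _ _, add_nonneg ih.2 (mul_nonneg (hω r) (le_max_right _ _))⟩

/-- If `b` and the `pos i` are integers, then a digit `β i` is counted exactly if `pos i = b`: the
term `max (β i + hat b (pos i) - 1) 0` is the product of two numbers in `{0, 1}`. -/
lemma readState_code {β : ℕ → ℝ} (hβ : ∀ i, β i = 0 ∨ β i = 1) (ω pos : ℕ → ℝ) (b : ℝ)
    (R r : ℕ) :
    readState ω pos (code β (R + r)) b r =
      (code (fun i => β (i + r)) R, ∑ i ∈ Finset.range r, ω i * max (β i + hat b (pos i) - 1) 0) := by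
  induction r generalizing R with
  | zero => simp [readState]
  | succ r ih =>
    have hβ' : ∀ i, β (i + r) = 0 ∨ β (i + r) = 1 := fun i => hβ _
    have e := ih (R + 1)
    rw [show R + 1 + r = R + (r + 1) by ring] at e
    rw [readState, e, bitFour_code hβ']
    simp only [zero_add, Finset.sum_range_succ]
    congr 1
    rw [code]
    have h := code_mem (β := fun i => β (i + 1 + r)) (fun i => hβ _) R
    simp only [zero_add]
    rw [max_eq_left]
    · rw [show (fun i => β (i + (r + 1))) = fun i => β (i + 1 + r) by
        funext i; congr 1; ring]
      ring
    · linarith [h.1]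

/-- Every number in `[0, 1]`, including `1`, has `l` binary digits that approximate it up to
`2 ^ (-l)`. -/
lemma exists_binary_digits (l : ℕ) {z : ℝ} (hz : z ∈ Set.Icc (0 : ℝ) 1) :
    ∃ β : ℕ → ℝ, (∀ i, β i = 0 ∨ β i = 1) ∧
      |∑ i ∈ Finset.range l, 1 / 2 ^ (i + 1) * β i - z| ≤ 1 / 2 ^ l := by
  induction l generalizing z with
  | zero => exact ⟨0, by simp, by simpa [abs_of_nonneg hz.1] using hz.2⟩
  | succ l ih =>
    have : ∃ b : ℝ, (b = 0 ∨ b = 1) ∧ 2 * z - b ∈ Set.Icc (0 : ℝ) 1 := by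
      rcases le_total z (1 / 2) with h | h
      · exact ⟨0, by simp, by linarith [hz.1], by linarith⟩
      · exact ⟨1, by simp, by linarith, by linarith [hz.2]⟩
    obtain ⟨b, hb, hz'⟩ := this
    obtain ⟨β, hβ, h⟩ := ih hz'
    refine ⟨fun i => Nat.casesOn i b β, fun i => by cases i <;> simp [hb, hβ], ?_⟩
    rw [Finset.sum_range_succ']
    have e : ∑ i ∈ Finset.range l, 1 / 2 ^ (i + 1 + 1) * β i =
        (∑ i ∈ Finset.range l, 1 / 2 ^ (i + 1) * β i) / 2 := by
      rw [Finset.sum_div]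
      refine Finset.sum_congr rfl fun i _ => ?_
      rw [pow_succ (2 : ℝ) (i + 1)]
      field_simp
    simp only [e]
    change |_ + 1 / 2 ^ (0 + 1) * b - z| ≤ _
    rw [show (∑ i ∈ Finset.range l, 1 / 2 ^ (i + 1) * β i) / 2 + 1 / 2 ^ (0 + 1) * b - z =
      (∑ i ∈ Finset.range l, 1 / 2 ^ (i + 1) * β i - (2 * z - b)) / 2 by ring, abs_div, abs_two,
      pow_succ, ← div_div]
    gcongr

lemma sum_range_mul (n l : ℕ) (f : ℕ → ℝ) :
    ∑ r ∈ Finset.range (n * l), f r =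
      ∑ p ∈ Finset.range n, ∑ i ∈ Finset.range l, f (p * l + i) := by
  induction n with
  | zero => simp
  | succ n ih => rw [Nat.succ_mul, Finset.sum_range_add, ih, Finset.sum_range_succ]

variable {d : ℕ} {B : ℝ}

/-- Extraction of `k` digits in `3 k` layers. -/
lemma St.digits {w h : ℕ} {p : (Fin d → ℝ) → ℝ × ℝ} {σ : ℝ} (hB : 8 ≤ B) (hσ : 0 ≤ σ)
    (hσB : 2 * σ + 1 ≤ B) (hw : 3 ≤ w) (hp : ∀ x, 0 ≤ (p x).1 ∧ 0 ≤ (p x).2)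
    (hL : St d B w h [fun x => (p x).1, fun x => (p x).2]) (k : ℕ) :
    St d B w (h + 3 * k) [fun x => ((digitStep σ)^[k] (p x)).1,
      fun x => ((digitStep σ)^[k] (p x)).2] := by
  induction k with
  | zero => exact hL
  | succ k ih =>
    have hq := fun x => digitStep_iterate_nonneg (σ := σ) (hp x).1 (hp x).2 k
    simp only [Function.iterate_succ_apply']
    set q := fun x => (digitStep σ)^[k] (p x)
    have hq1 : ∀ x, 0 ≤ (q x).1 := fun x => (hq x).1
    have hq2 : ∀ x, 0 ≤ (q x).2 := fun x => (hq x).2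
    change St d B w (h + 3 * k) [fun x => (q x).1, fun x => (q x).2] at ih
    have hb : ∀ t, 0 ≤ leadBit σ t := fun t => clip_nonneg _
    have s1 := ih.step (L' := [fun x => max (1 - σ * ((q x).1 - 1 / 2)) 0, fun x => (q x).1,
      fun x => (q x).2]) (by linarith) (by simpa using hw) (by
        simp only [List.forall_mem_cons, List.not_mem_nil, false_imp_iff, implies_true, and_true]
        refine ⟨⟨1 + σ / 2, [-σ], ?_, fun x => ?_⟩, ⟨0, [1], ?_, fun x => ?_⟩,
          ⟨0, [0, 1], ?_, fun x => ?_⟩⟩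
        · simp only [List.map_cons, abs_neg, abs_of_nonneg hσ, List.map_nil, List.sum_cons,
            List.sum_nil]
          rw [abs_of_nonneg (by linarith)]
          linarith
        · congr 1; simp only [lin]; ring
        · norm_num; linarith
        · simp [lin, hq1]
        · norm_num; linarith
        · simp [lin, hq2])
    have s2 := s1.step (L' := [fun x => leadBit σ (q x).1, fun x => (q x).1,
      fun x => (q x).2]) (by linarith) (by simpa using hw) (by
        simp only [List.forall_mem_cons, List.not_mem_nil, false_imp_iff, implies_true, and_true]
        refine ⟨⟨1, [-1], ?_, fun x => ?_⟩, ⟨0, [0, 1], ?_, fun x => ?_⟩,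
          ⟨0, [0, 0, 1], ?_, fun x => ?_⟩⟩
        · norm_num; linarith
        · rw [leadBit, clip]; congr 1; simp only [lin]; ring
        · norm_num; linarith
        · simp [lin, hq1]
        · norm_num; linarith
        · simp [lin, hq2])
    have s3 := s2.step (L' := [fun x => (digitStep σ (q x)).1, fun x => (digitStep σ (q x)).2])
      (by linarith) (by simp; omega) (by
        simp only [List.forall_mem_cons, List.not_mem_nil, false_imp_iff, implies_true, and_true]
        refine ⟨⟨0, [-1, 2], ?_, fun x => ?_⟩, ⟨0, [1, 0, 2], ?_, fun x => ?_⟩⟩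
        · norm_num; linarith
        · simp only [digitStep]; congr 1; simp only [lin]; ring
        · norm_num; linarith
        · simp only [digitStep, lin]
          rw [max_eq_left (by linarith [hq2 x, hb (q x).1])]
          ring)
    exact s3

/-- Selecting the entry of number `a x` from a table of length `n`. -/
lemma St.select {w h n : ℕ} {a b : (Fin d → ℝ) → ℝ} {c : ℕ → ℝ} (hB : 8 ≤ B) (hn : n + 1 ≤ B)
    (hw : 6 ≤ w) (ha : ∀ x, 0 ≤ a x) (hb : ∀ x, 0 ≤ b x) (hc : ∀ i, c i ∈ Set.Icc (0 : ℝ) 1)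
    (hL : St d B w h [a, b]) {k : ℕ} (hk : k ≤ n) :
    St d B w (h + 1 + 3 * k) [a, b, fun x => ∑ p ∈ Finset.range k, c p * hat (a x) p] := by
  induction k with
  | zero =>
    refine hL.step (by linarith) (by simp; omega) ?_
    simp only [List.forall_mem_cons, List.not_mem_nil, false_imp_iff, implies_true, and_true]
    refine ⟨⟨0, [1], ?_, fun x => ?_⟩, ⟨0, [0, 1], ?_, fun x => ?_⟩, ⟨0, [], ?_, fun x => ?_⟩⟩
    · norm_num; linarith
    · simp [lin, ha]
    · norm_num; linarith
    · simp [lin, hb]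
    · norm_num; linarith
    · simp [lin]
  | succ k ih =>
    have s0 := ih (by omega)
    have hs : ∀ x, 0 ≤ ∑ p ∈ Finset.range k, c p * hat (a x) p := fun x =>
      Finset.sum_nonneg fun i _ => mul_nonneg (hc i).1 (hat_nonneg _ _)
    have hkB : (k : ℝ) + 1 + 1 ≤ B := by
      have : (k : ℝ) + 1 ≤ n := by exact_mod_cast hk
      linarith
    simp only [Finset.sum_range_succ]
    set s := fun x => ∑ p ∈ Finset.range k, c p * hat (a x) p
    have hk0 : (0 : ℝ) ≤ k := Nat.cast_nonneg k
    have s1 := s0.step (L' := [fun x => max (a x - k) 0, fun x => max (k - a x) 0, a, b, s])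
      (by linarith) (by simp; omega) (by
        simp only [List.forall_mem_cons, List.not_mem_nil, false_imp_iff, implies_true, and_true]
        refine ⟨⟨-k, [1], ?_, fun x => ?_⟩, ⟨k, [-1], ?_, fun x => ?_⟩, ⟨0, [1], ?_, fun x => ?_⟩,
          ⟨0, [0, 1], ?_, fun x => ?_⟩, ⟨0, [0, 0, 1], ?_, fun x => ?_⟩⟩
        · simp only [List.map_cons, abs_neg, List.map_nil, List.sum_cons, List.sum_nil,
            abs_one, abs_of_nonneg hk0]
          linarith
        · congr 1; simp only [lin]; ring
        · simp only [List.map_cons, abs_neg, List.map_nil, List.sum_cons, List.sum_nil,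
            abs_one, abs_of_nonneg hk0]
          linarith
        · congr 1; simp only [lin]; ring
        · norm_num; linarith
        · simp [lin, ha]
        · norm_num; linarith
        · simp [lin, hb]
        · norm_num; linarith
        · simp [lin, hs, s])
    have s2 := s1.step (L' := [fun x => hat (a x) k, a, b, s])
      (by linarith) (by simp; omega) (by
        simp only [List.forall_mem_cons, List.not_mem_nil, false_imp_iff, implies_true, and_true]
        refine ⟨⟨1, [-1, -1], ?_, fun x => ?_⟩, ⟨0, [0, 0, 1], ?_, fun x => ?_⟩,
          ⟨0, [0, 0, 0, 1], ?_, fun x => ?_⟩, ⟨0, [0, 0, 0, 0, 1], ?_, fun x => ?_⟩⟩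
        · norm_num; linarith
        · rw [hat]; congr 1; simp only [lin]; ring
        · norm_num; linarith
        · simp [lin, ha]
        · norm_num; linarith
        · simp [lin, hb]
        · norm_num; linarith
        · simp [lin, hs, s])
    refine s2.step (L' := [a, b, fun x => s x + c k * hat (a x) k]) (by linarith)
      (by simp; omega) ?_
    simp only [List.forall_mem_cons, List.not_mem_nil, false_imp_iff, implies_true, and_true]
    refine ⟨⟨0, [0, 1], ?_, fun x => ?_⟩, ⟨0, [0, 0, 1], ?_, fun x => ?_⟩,
      ⟨0, [c k, 0, 0, 1], ?_, fun x => ?_⟩⟩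
    · norm_num; linarith
    · simp [lin, ha]
    · norm_num; linarith
    · simp [lin, hb]
    · simp [abs_of_nonneg (hc k).1]; linarith [(hc k).2]
    · have := mul_nonneg (hc k).1 (hat_nonneg (a x) k)
      have h2 : 0 ≤ s x := hs x
      simp only [lin]
      rw [max_eq_left (by linarith)]
      ring

/-- Reading `r` base-`4` digits of `t` in `4 r` layers. -/
lemma St.read {w h n : ℕ} {t b : (Fin d → ℝ) → ℝ} {ω : ℕ → ℝ} {pos : ℕ → ℕ} (hB : 10 ≤ B)
    (hn : n + 1 ≤ B) (hw : 6 ≤ w) (ht : ∀ x, 0 ≤ t x) (hb : ∀ x, 0 ≤ b x)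
    (hω : ∀ i, ω i ∈ Set.Icc (0 : ℝ) 1) (hL : St d B w h [t, b]) {r : ℕ}
    (hpos : ∀ i < r, pos i ≤ n) :
    St d B w (h + 1 + 4 * r) [fun x => (readState ω (fun i => pos i) (t x) (b x) r).1, b,
      fun x => (readState ω (fun i => pos i) (t x) (b x) r).2] := by
  induction r with
  | zero =>
    refine hL.step (by linarith) (by simp; omega) ?_
    simp only [List.forall_mem_cons, List.not_mem_nil, false_imp_iff, implies_true, and_true]
    refine ⟨⟨0, [1], ?_, fun x => ?_⟩, ⟨0, [0, 1], ?_, fun x => ?_⟩, ⟨0, [], ?_, fun x => ?_⟩⟩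
    · norm_num; linarith
    · simp [lin, ht, readState]
    · norm_num; linarith
    · simp [lin, hb]
    · norm_num; linarith
    · simp [lin, readState]
  | succ r ih =>
    have s0 := ih fun i hi => hpos i (by omega)
    have hq := fun x => readState_nonneg (pos := fun i => pos i) (fun i => (hω i).1) (ht x) (b x) r
    simp only [readState]
    set q := fun x => readState ω (fun i => pos i) (t x) (b x) r
    have hq1 : ∀ x, 0 ≤ (q x).1 := fun x => (hq x).1
    have hq2 : ∀ x, 0 ≤ (q x).2 := fun x => (hq x).2
    change St d B w (h + 1 + 4 * r) [fun x => (q x).1, b, fun x => (q x).2] at s0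
    have hkB : (pos r : ℝ) + 1 ≤ B := by
      have : (pos r : ℝ) ≤ n := by exact_mod_cast hpos r (by omega)
      linarith
    have hk0 : (0 : ℝ) ≤ pos r := Nat.cast_nonneg _
    have s1 := s0.step (L' := [fun x => max (1 - (8 * (q x).1 - 1)) 0,
      fun x => max (b x - pos r) 0, fun x => max (pos r - b x) 0, fun x => (q x).1, b,
      fun x => (q x).2]) (by linarith) (by simp; omega) (by
        simp only [List.forall_mem_cons, List.not_mem_nil, false_imp_iff, implies_true, and_true]
        refine ⟨⟨2, [-8], ?_, fun x => ?_⟩, ⟨-pos r, [0, 1], ?_, fun x => ?_⟩,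
          ⟨pos r, [0, -1], ?_, fun x => ?_⟩, ⟨0, [1], ?_, fun x => ?_⟩,
          ⟨0, [0, 1], ?_, fun x => ?_⟩, ⟨0, [0, 0, 1], ?_, fun x => ?_⟩⟩
        · norm_num; linarith
        · congr 1; simp only [lin]; ring
        · simp only [List.map_cons, abs_neg, List.map_nil, List.sum_cons, List.sum_nil,
            abs_one, abs_of_nonneg hk0, abs_zero]
          linarith
        · congr 1; simp only [lin]; ring
        · simp only [List.map_cons, abs_neg, List.map_nil, List.sum_cons, List.sum_nil,
            abs_one, abs_of_nonneg hk0, abs_zero]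
          linarith
        · congr 1; simp only [lin]; ring
        · norm_num; linarith
        · simp [lin, hq1]
        · norm_num; linarith
        · simp [lin, hb]
        · norm_num; linarith
        · simp [lin, hq2])
    have s2 := s1.step (L' := [fun x => bitFour (q x).1, fun x => hat (b x) (pos r),
      fun x => (q x).1, b, fun x => (q x).2]) (by linarith) (by simp; omega) (by
        simp only [List.forall_mem_cons, List.not_mem_nil, false_imp_iff, implies_true, and_true]
        refine ⟨⟨1, [-1], ?_, fun x => ?_⟩, ⟨1, [0, -1, -1], ?_, fun x => ?_⟩,
          ⟨0, [0, 0, 0, 1], ?_, fun x => ?_⟩, ⟨0, [0, 0, 0, 0, 1], ?_, fun x => ?_⟩,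
          ⟨0, [0, 0, 0, 0, 0, 1], ?_, fun x => ?_⟩⟩
        · norm_num; linarith
        · rw [bitFour, clip]; congr 1; simp only [lin]; ring
        · norm_num; linarith
        · rw [hat]; congr 1; simp only [lin]; ring
        · norm_num; linarith
        · simp [lin, hq1]
        · norm_num; linarith
        · simp [lin, hb]
        · norm_num; linarith
        · simp [lin, hq2])
    have s3 := s2.step (L' := [fun x => max (4 * (q x).1 - bitFour (q x).1) 0,
      fun x => max (bitFour (q x).1 + hat (b x) (pos r) - 1) 0, b, fun x => (q x).2])
      (by linarith) (by simp; omega) (by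
        simp only [List.forall_mem_cons, List.not_mem_nil, false_imp_iff, implies_true, and_true]
        refine ⟨⟨0, [-1, 0, 4], ?_, fun x => ?_⟩, ⟨-1, [1, 1], ?_, fun x => ?_⟩,
          ⟨0, [0, 0, 0, 1], ?_, fun x => ?_⟩, ⟨0, [0, 0, 0, 0, 1], ?_, fun x => ?_⟩⟩
        · norm_num; linarith
        · congr 1; simp only [lin]; ring
        · norm_num; linarith
        · congr 1; simp only [lin]; ring
        · norm_num; linarith
        · simp [lin, hb]
        · norm_num; linarith
        · simp [lin, hq2])
    have s4 := s3.step (L' := [fun x => max (4 * (q x).1 - bitFour (q x).1) 0, b,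
      fun x => (q x).2 + ω r * max (bitFour (q x).1 + hat (b x) (pos r) - 1) 0])
      (by linarith) (by simp; omega) (by
        simp only [List.forall_mem_cons, List.not_mem_nil, false_imp_iff, implies_true, and_true]
        refine ⟨⟨0, [1], ?_, fun x => ?_⟩, ⟨0, [0, 0, 1], ?_, fun x => ?_⟩,
          ⟨0, [0, ω r, 0, 1], ?_, fun x => ?_⟩⟩
        · norm_num; linarith
        · simp [lin]
        · norm_num; linarith
        · simp [lin, hb]
        · simp [abs_of_nonneg (hω r).1]; linarith [(hω r).2]
        · have := mul_nonneg (hω r).1 (le_max_right (bitFour (q x).1 + hat (b x) (pos r) - 1) 0)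
          simp only [lin]
          rw [max_eq_left (a := 0 * _ + _ + 0) (by linarith [hq2 x])]
          ring)
    exact s4

lemma St.comp_clip {w h : ℕ} {g : (Fin d → ℝ) → ℝ} (hB : 2 ≤ B) (hw : 1 ≤ w)
    (hL : St d B w h [g]) : St d B w (h + 2) [fun x => clip (g x)] := by
  have s1 := hL.step (L' := [fun x => max (1 - g x) 0]) (by linarith) (by simpa using hw) (by
    simp only [List.forall_mem_cons, List.not_mem_nil, false_imp_iff, implies_true, and_true]
    refine ⟨1, [-1], ?_, fun x => ?_⟩
    · norm_num; linarith
    · congr 1; simp only [lin]; ring)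
  refine s1.step (L' := [fun x => clip (g x)]) (by linarith) (by simpa using hw) ?_
  simp only [List.forall_mem_cons, List.not_mem_nil, false_imp_iff, implies_true, and_true]
  refine ⟨1, [-1], ?_, fun x => ?_⟩
  · norm_num; linarith
  · rw [clip]; congr 1; simp only [lin]; ring

/-- Table lookup by bit extraction: an `n × n` table of numbers in `[0, 1]` is read with precision
`2 ^ (-l)` by a network of bounded width and of depth `O(n l)`. The `l` binary digits of each of the
`n` entries of a row are packed into one weight. -/
lemma St.exists_lookup {w h : ℕ} (n l : ℕ) {a b : (Fin d → ℝ) → ℝ} (hB : 10 ≤ B)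
    (hn : n + 1 ≤ B) (hw : 6 ≤ w) (ha : ∀ x, 0 ≤ a x) (hb : ∀ x, 0 ≤ b x)
    (hL : St d B w h [a, b]) {ρ : ℕ → ℕ → ℝ} (hρ : ∀ i j, ρ i j ∈ Set.Icc (0 : ℝ) 1) :
    ∃ g : (Fin d → ℝ) → ℝ, St d B w (h + (3 * n + 4 * (n * l) + 4)) [g] ∧
      (∀ x, g x ∈ Set.Icc (0 : ℝ) 1) ∧
      ∀ x, ∀ i < n, ∀ j < n, a x = i → b x = j → |g x - ρ i j| ≤ 1 / 2 ^ l := by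
  choose β hβ01 hβ using fun i j => exists_binary_digits l (hρ i j)
  let bits : ℕ → ℕ → ℝ := fun i r => β i (r / l) (r % l)
  have hbits : ∀ i r, bits i r = 0 ∨ bits i r = 1 := fun i r => hβ01 _ _ _
  let ω : ℕ → ℝ := fun r => 1 / 2 ^ (r % l + 1)
  have hω : ∀ r, ω r ∈ Set.Icc (0 : ℝ) 1 := fun r =>
    ⟨by positivity, div_le_one_of_le₀ (one_le_pow₀ (by norm_num)) (by positivity)⟩
  let pos : ℕ → ℕ := fun r => r / l
  let c : ℕ → ℝ := fun i => code (bits i) (n * l)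
  have hc : ∀ i, c i ∈ Set.Icc (0 : ℝ) 1 := fun i =>
    ⟨(code_mem (hbits i) _).1, (code_mem (hbits i) _).2.trans (by norm_num)⟩
  let t : (Fin d → ℝ) → ℝ := fun x => ∑ p ∈ Finset.range n, c p * hat (a x) p
  have ht : ∀ x, 0 ≤ t x := fun x =>
    Finset.sum_nonneg fun i _ => mul_nonneg (hc i).1 (hat_nonneg _ _)
  have s1 : St d B w (h + 1 + 3 * n) [a, b, t] :=
    hL.select (by linarith) hn hw ha hb hc le_rfl
  have s2 : St d B w (h + 1 + 3 * n) [t, b] := s1.subset (by simp)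
  have s3 := s2.read (ω := ω) (pos := pos) (r := n * l) hB hn hw ht hb hω (fun i hi =>
    (Nat.div_lt_of_lt_mul (by rwa [mul_comm] at hi)).le)
  have s4 := (s3.subset (L' := [fun x => (readState ω (fun i => pos i) (t x) (b x) (n * l)).2])
    (by simp)).comp_clip (by linarith) (by omega)
  refine ⟨fun x => clip (readState ω (fun i => pos i) (t x) (b x) (n * l)).2, ?_,
    fun x => ⟨clip_nonneg _, clip_le_one _⟩, fun x i hi j hj hai hbj => ?_⟩
  · convert s4 using 1
    ring
  · have h1 : t x = code (bits i) (0 + n * l) := by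
      simp only [t, hai, hat_natCast]
      rw [Finset.sum_eq_single i (fun k _ hk => by simp [hk.symm]) (by simp [hi])]
      simp [c]
    beta_reduce
    rw [h1, readState_code (hbits i)]
    refine (abs_clip_sub_le (hρ i j).1 (hρ i j).2).trans ?_
    suffices e : ∑ r ∈ Finset.range (n * l), ω r * max (bits i r + hat (b x) (pos r) - 1) 0 =
        ∑ k ∈ Finset.range l, 1 / 2 ^ (k + 1) * β i j k by
      simp only [e]
      exact hβ i j
    rw [sum_range_mul, Finset.sum_eq_single j]
    · refine Finset.sum_congr rfl fun k hk => ?_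
      have hk := Finset.mem_range.1 hk
      have e1 : (j * l + k) / l = j := by
        rw [mul_comm, Nat.mul_add_div (by omega), Nat.div_eq_of_lt hk, add_zero]
      have e2 : (j * l + k) % l = k := by
        rw [mul_comm, Nat.mul_add_mod, Nat.mod_eq_of_lt hk]
      simp only [ω, pos, bits, e1, e2, hbj, hat_self, add_sub_cancel_right]
      rw [max_eq_left]
      rcases hβ01 i j k with h | h <;> simp [h]
    · intro p _ hp
      refine Finset.sum_eq_zero fun k hk => ?_
      have hk := Finset.mem_range.1 hk
      have e1 : (p * l + k) / l = p := by
        rw [mul_comm, Nat.mul_add_div (by omega), Nat.div_eq_of_lt hk, add_zero]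
      simp only [pos, e1, hbj, hat_natCast_of_ne hp.symm]
      rw [max_eq_right, mul_zero]
      rcases hbits i (p * l + k) with h | h <;> rw [h] <;> norm_num
    · intro hj'
      exact absurd (Finset.mem_range.2 hj) hj'

/-! ### The triangle wave -/

/-- The triangle wave of period `1`: twice the distance to the nearest integer. -/
noncomputable def tri (y : ℝ) : ℝ := 1 - |2 * Int.fract y - 1|

lemma tri_eq {y : ℝ} (j : ℤ) (h0 : j ≤ y) (h1 : y ≤ j + 1) : tri y = 1 - |2 * (y - j) - 1| := by
  rcases h1.lt_or_eq with h | h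
  · rw [tri, Int.fract, Int.floor_eq_iff.2 ⟨h0, h⟩]
  · have : Int.fract y = 0 := by
      rw [h, ← Int.cast_one, ← Int.cast_add, Int.fract_intCast]
    rw [tri, this, h]
    norm_num

lemma tri_mem (y : ℝ) : tri y ∈ Set.Icc (0 : ℝ) 1 := by
  have h0 := Int.fract_nonneg y
  have h1 := (Int.fract_lt_one y).le
  have : |2 * Int.fract y - 1| ≤ 1 := abs_le.2 ⟨by linarith, by linarith⟩
  exact ⟨by rw [tri]; linarith, by rw [tri]; linarith [abs_nonneg (2 * Int.fract y - 1)]⟩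

lemma tri_le (y : ℝ) : tri y ≤ 2 * Int.fract y := by
  rw [tri]
  linarith [neg_abs_le (2 * Int.fract y - 1)]

lemma tri_natCast (n : ℕ) : tri n = 0 := by
  rw [tri, Int.fract_natCast]
  norm_num

lemma tri_add_tri (y : ℝ) : tri y + tri (y + 1 / 2) = 1 := by
  have h0 := Int.floor_le y
  have h1 := (Int.lt_floor_add_one y).le
  rcases le_total (y - ⌊y⌋) (1 / 2) with h | h
  · rw [tri_eq ⌊y⌋ h0 h1, tri_eq ⌊y⌋ (by linarith) (by linarith), abs_of_nonpos (by linarith),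
      abs_of_nonneg (by linarith)]
    ring
  · rw [tri_eq ⌊y⌋ h0 h1, tri_eq (⌊y⌋ + 1) (by push_cast; linarith) (by push_cast; linarith),
      abs_of_nonneg (by linarith), abs_of_nonpos (by push_cast; linarith)]
    push_cast
    ring

lemma tent_eq_tri {t : ℝ} (ht : t ∈ Set.Icc (0 : ℝ) 1) : tent t = tri t := by
  rw [tri_eq 0 (by simpa using ht.1) (by simpa using ht.2)]
  rcases le_total t (1 / 2) with h | h
  · rw [tent_of_le ht.1 h, abs_of_nonpos (by push_cast; linarith)]
    push_cast
    ring
  · rw [tent_of_ge h ht.2, abs_of_nonneg (by push_cast; linarith)]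
    push_cast
    ring

lemma tent_tri (y : ℝ) : tent (tri y) = tri (2 * y) := by
  have h0 := Int.floor_le y
  have h1 := (Int.lt_floor_add_one y).le
  rw [tent_eq_tri (tri_mem y)]
  rcases le_total (y - ⌊y⌋) (1 / 2) with h | h
  · have e : tri y = 2 * (y - ⌊y⌋) := by
      rw [tri_eq ⌊y⌋ h0 h1, abs_of_nonpos (by linarith)]
      ring
    rw [e, tri_eq 0 (by push_cast; linarith) (by push_cast; linarith),
      tri_eq (2 * ⌊y⌋) (by push_cast; linarith) (by push_cast; linarith)]
    congr 2
    push_cast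
    ring
  · have e : tri y = 2 - 2 * (y - ⌊y⌋) := by
      rw [tri_eq ⌊y⌋ h0 h1, abs_of_nonneg (by linarith)]
      ring
    rw [e, tri_eq 0 (by push_cast; linarith) (by push_cast; linarith),
      tri_eq (2 * ⌊y⌋ + 1) (by push_cast; linarith) (by push_cast; linarith), ← abs_neg]
    congr 2
    push_cast
    ring

lemma tent_iterate_eq_tri {t : ℝ} (ht : t ∈ Set.Icc (0 : ℝ) 1) (a : ℕ) :
    tent^[a + 1] t = tri (2 ^ a * t) := by
  induction a with
  | zero => simpa using tent_eq_tri ht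
  | succ a ih =>
    rw [Function.iterate_succ_apply', ih, tent_tri, pow_succ]
    congr 1
    ring

/-! ### The subnetworks -/

section

variable {d : ℕ} {B : ℝ}

/-- The local coordinates of a block: the affine function `g x_i + h_i` cut off to `[0, 1]`. -/
noncomputable def localCoord (g : ℝ) (h : Fin d → ℝ) (x : Fin d → ℝ) (i : Fin d) : ℝ :=
  clip (g * x i + h i)

lemma localCoord_mem (g : ℝ) (h x : Fin d → ℝ) (i : Fin d) :
    localCoord g h x i ∈ Set.Icc (0 : ℝ) 1 :=
  ⟨clip_nonneg _, clip_le_one _⟩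

lemma St.input_localCoord (hB : 2 ≤ B) {g : ℝ} {h : Fin d → ℝ} (hg : |g| ≤ B)
    (hh : ∀ i, |1 - h i| ≤ B) (i : Fin d) : St d B 1 2 [fun x => localCoord g h x i] := by
  have s1 := St.input (B := B) i (c := -g) (b := 1 - h i) (by rwa [abs_neg]) (hh i)
  refine s1.step (by linarith) (by simp) ?_
  simp only [List.forall_mem_cons, List.not_mem_nil, false_imp_iff, implies_true, and_true]
  refine ⟨1, [-1], ?_, fun x => ?_⟩
  · norm_num; linarith
  · rw [localCoord, clip]
    simp only [lin]
    congr 1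
    rw [show 1 - (g * x i + h i) = -g * x i + (1 - h i) by ring]
    ring

/-- The digits of the local coordinate number `i`, in two groups of `k` binary digits. -/
lemma St.exists_digits (hB : 8 ≤ B) {σ θ : ℝ} (hσ : 0 ≤ σ) (hσB : 2 * σ + 1 ≤ B)
    {g : ℝ} {h : Fin d → ℝ} (hg : |g| ≤ B) (hh : ∀ i, |1 - h i| ≤ B) (k : ℕ)
    (hσθ : 2 ^ (2 * k) ≤ σ * θ) (i : Fin d) :
    ∃ u v : (Fin d → ℝ) → ℝ, St d B 6 (6 * k + 4) [u, v] ∧ (∀ x, 0 ≤ u x) ∧ (∀ x, 0 ≤ v x) ∧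
      ∀ (x : Fin d → ℝ) (a b : ℕ) (f : ℝ), a < 2 ^ k → b < 2 ^ k → θ ≤ f → 0 ≤ f → f < 1 →
        localCoord g h x i = (((a * 2 ^ k + b : ℕ) : ℝ) + f) / 2 ^ (2 * k) → u x = a ∧ v x = b := by
  have hV := fun x => localCoord_mem g h x i
  have s0 := (St.input_localCoord (by linarith) hg hh i).mono_width (w' := 3) (by linarith) (by norm_num)
  have s1 := s0.step (L' := [fun x => localCoord g h x i, fun _ => 0]) (by linarith) (by simp) (by
    simp only [List.forall_mem_cons, List.not_mem_nil, false_imp_iff, implies_true, and_true]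
    refine ⟨⟨0, [1], ?_, fun x => ?_⟩, ⟨0, [], ?_, fun x => ?_⟩⟩
    · norm_num; linarith
    · simp [lin, (hV x).1]
    · norm_num; linarith
    · simp [lin])
  have s2 := St.digits (p := fun x => (localCoord g h x i, 0)) hB hσ hσB le_rfl
    (fun x => ⟨(hV x).1, le_rfl⟩) s1 k
  have hp := fun x => digitStep_iterate_nonneg (σ := σ)
    (p := (localCoord g h x i, 0)) (hV x).1 le_rfl k
  set p := fun x => (digitStep σ)^[k] (localCoord g h x i, 0)
  have hp1 : ∀ x, 0 ≤ (p x).1 := fun x => (hp x).1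
  have s3 := s2.step (L' := [fun x => (p x).1, fun _ => 0]) (by linarith) (by simp) (by
    simp only [List.forall_mem_cons, List.not_mem_nil, false_imp_iff, implies_true, and_true]
    refine ⟨⟨0, [1], ?_, fun x => ?_⟩, ⟨0, [], ?_, fun x => ?_⟩⟩
    · norm_num; linarith
    · simp [lin, hp1, p]
    · norm_num; linarith
    · simp [lin])
  have s4 := St.digits (p := fun x => ((p x).1, 0)) hB hσ hσB le_rfl
    (fun x => ⟨hp1 x, le_rfl⟩) s3 k
  have hq := fun x => digitStep_iterate_nonneg (σ := σ) (p := ((p x).1, 0)) (hp1 x) le_rfl k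
  set q := fun x => (digitStep σ)^[k] ((p x).1, 0)
  have s5 : St d B 3 (6 * k + 4) [fun x => (p x).2] := by
    refine (s2.subset (L' := [fun x => (p x).2]) (by simp [p])).pad (by linarith) (by simp) ?_
      (by omega)
    simpa using fun x => (hp x).2
  have s6 : St d B 3 (6 * k + 4) [fun x => (q x).2] := by
    have := s4.subset (L' := [fun x => (q x).2]) (by simp [q])
    convert this using 1
    ring
  refine ⟨_, _, s5.append (by linarith) s6, fun x => (hp x).2, fun x => (hq x).2, ?_⟩
  intro x a b f ha hb hf hf0 hf1 e
  have h2 : (0 : ℝ) < 2 ^ k := by positivity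
  have hb' : (b : ℝ) + 1 ≤ 2 ^ k := by exact_mod_cast hb
  have h22 : (2 : ℝ) ^ (2 * k) = 2 ^ k * 2 ^ k := by rw [two_mul, pow_add]
  have h1k : (1 : ℝ) ≤ 2 ^ k := one_le_pow₀ (by norm_num)
  have e1 : p x = (((b : ℝ) + f) / 2 ^ k, (a : ℝ)) := by
    have := digitStep_iterate_eq (θ := θ / 2 ^ k) hσ k
      (by rw [← mul_div_assoc, le_div_iff₀ h2, ← h22]; exact hσθ)
      (f := ((b : ℝ) + f) / 2 ^ k) (by gcongr; linarith [(Nat.cast_nonneg b : (0 : ℝ) ≤ b)])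
      (by positivity) (by rw [div_lt_one h2]; linarith) a ha 0
    simp only [mul_zero, zero_add] at this
    rw [← this]
    simp only [p, e]
    congr 2
    push_cast
    rw [h22]
    field_simp
    ring
  have e2 : q x = (f, (b : ℝ)) := by
    have := digitStep_iterate_eq (θ := θ) hσ k (le_trans (by rw [h22]; nlinarith) hσθ) hf hf0 hf1
      b hb 0
    simp only [mul_zero, zero_add] at this
    simp only [q, e1, this]
  simp [e1, e2]

/-- The lookup of the entry of a table indexed by the cells of the block that contains `x`. It is
correct if `x` keeps a distance from the left walls of its cell. -/
lemma St.exists_cell_lookup (hd : 1 ≤ d) (hB : 10 ≤ B) {σ θ : ℝ} (hσ : 0 ≤ σ)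
    (hσB : 2 * σ + 1 ≤ B) {g : ℝ} {h : Fin d → ℝ} (hg : |g| ≤ B) (hh : ∀ i, |1 - h i| ≤ B)
    (k l : ℕ) (hσθ : 2 ^ (2 * k) ≤ σ * θ) (hn : (d * (2 ^ k) ^ d + 1 : ℝ) ≤ B)
    {ρ : (Fin d → ℕ) → ℝ} (hρ : ∀ j, ρ j ∈ Set.Icc (0 : ℝ) 1) :
    ∃ z : (Fin d → ℝ) → ℝ,
      St d B (6 * d) (6 * k + 3 * (2 ^ k) ^ d + 4 * ((2 ^ k) ^ d * l) + 9) [z] ∧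
      (∀ x, z x ∈ Set.Icc (0 : ℝ) 1) ∧
      ∀ (x : Fin d → ℝ) (j : Fin d → ℕ) (f : Fin d → ℝ),
        (∀ i, j i < 2 ^ (2 * k) ∧ θ ≤ f i ∧ 0 ≤ f i ∧ f i < 1 ∧
          localCoord g h x i = ((j i : ℝ) + f i) / 2 ^ (2 * k)) → |z x - ρ j| ≤ 1 / 2 ^ l := by
  choose u v huv hu hv hdig using
    fun i => St.exists_digits (d := d) (B := B) (by linarith) hσ hσB hg hh k hσθ i
  set K := 2 ^ k with hK
  set n := K ^ d with hnn
  have hK1 : 1 ≤ K := Nat.one_le_two_pow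
  have hKr : (1 : ℝ) ≤ 2 ^ k := one_le_pow₀ (by norm_num)
  have s1 := St.flatMap (by linarith) (by omega) (List.finRange d) (fun i _ => huv i)
  rw [List.length_finRange] at s1
  let a : (Fin d → ℝ) → ℝ := fun x => ∑ i : Fin d, (2 ^ k : ℝ) ^ (i : ℕ) * u i x
  let b : (Fin d → ℝ) → ℝ := fun x => ∑ i : Fin d, (2 ^ k : ℝ) ^ (i : ℕ) * v i x
  have ha : ∀ x, 0 ≤ a x := fun x => Finset.sum_nonneg fun i _ => mul_nonneg (by positivity) (hu i x)
  have hb : ∀ x, 0 ≤ b x := fun x => Finset.sum_nonneg fun i _ => mul_nonneg (by positivity) (hv i x)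
  have hsum : ∑ i : Fin d, |(2 ^ k : ℝ) ^ (i : ℕ)| ≤ B := by
    refine le_trans ?_ (le_trans (lt_add_one _).le hn)
    refine (Finset.sum_le_card_nsmul _ _ ((2 ^ k : ℝ) ^ d) fun i _ => ?_).trans (by simp)
    rw [abs_of_nonneg (by positivity)]
    exact pow_le_pow_right₀ hKr i.2.le
  have s2 := s1.step_aff (L' := [a, b]) (by linarith) (by simp; omega) (by
    simp only [List.forall_mem_cons, List.not_mem_nil, false_imp_iff, implies_true, and_true]
    refine ⟨⟨a, (Aff.sum Finset.univ fun i _ => Aff.smul_mem ?_).mono hsum, fun x => ?_⟩,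
      ⟨b, (Aff.sum Finset.univ fun i _ => Aff.smul_mem ?_).mono hsum, fun x => ?_⟩⟩
    · exact List.mem_flatMap.2 ⟨i, List.mem_finRange i, by simp⟩
    · rw [max_eq_left (ha x)]
    · exact List.mem_flatMap.2 ⟨i, List.mem_finRange i, by simp⟩
    · rw [max_eq_left (hb x)])
  -- The table, with the rows and columns numbered by the digits in base `2 ^ k`.
  let ρ' : ℕ → ℕ → ℝ := fun p q => if hpq : p < n ∧ q < n then
    ρ (fun i => (finFunctionFinEquiv.symm ⟨p, hpq.1⟩ i : ℕ) * K +
      (finFunctionFinEquiv.symm ⟨q, hpq.2⟩ i : ℕ)) else 0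
  have hρ' : ∀ p q, ρ' p q ∈ Set.Icc (0 : ℝ) 1 := by
    intro p q
    simp only [ρ']
    split_ifs
    · exact hρ _
    · simp
  have hnB : (n : ℝ) + 1 ≤ B := by
    refine le_trans ?_ hn
    have hd' : (1 : ℝ) ≤ d := by exact_mod_cast hd
    have : (0 : ℝ) ≤ (2 ^ k) ^ d := by positivity
    rw [hnn, hK]
    push_cast
    nlinarith
  obtain ⟨z, hz, hz1, hz2⟩ := St.exists_lookup n l hB hnB (by omega) ha hb s2 hρ'
  refine ⟨z, ?_, hz1, fun x j f hj => ?_⟩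
  · convert hz using 1
    · ring
    · ring
  · have hjK : ∀ i, j i < K * K := fun i => by
      have := (hj i).1
      rwa [two_mul, pow_add] at this
    let A : Fin d → Fin K := fun i => ⟨j i / K, Nat.div_lt_of_lt_mul (hjK i)⟩
    let C : Fin d → Fin K := fun i => ⟨j i % K, Nat.mod_lt _ (by omega)⟩
    have hAC : ∀ i, (A i : ℕ) * K + C i = j i := fun i => Nat.div_add_mod' _ _
    have hd : ∀ i, u i x = (A i : ℕ) ∧ v i x = (C i : ℕ) := fun i =>
      hdig i x (A i) (C i) (f i) (A i).2 (C i).2 (hj i).2.1 (hj i).2.2.1 (hj i).2.2.2.1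
        (by rw [hAC]; exact (hj i).2.2.2.2)
    have e1 : a x = ((finFunctionFinEquiv A : Fin n) : ℕ) := by
      rw [finFunctionFinEquiv_apply]
      simp only [a, hd, hK]
      push_cast
      exact Finset.sum_congr rfl fun i _ => mul_comm _ _
    have e2 : b x = ((finFunctionFinEquiv C : Fin n) : ℕ) := by
      rw [finFunctionFinEquiv_apply]
      simp only [b, hd, hK]
      push_cast
      exact Finset.sum_congr rfl fun i _ => mul_comm _ _
    have := hz2 x _ (finFunctionFinEquiv A).2 _ (finFunctionFinEquiv C).2 e1 e2
    have e3 : ρ' (finFunctionFinEquiv A : Fin n) (finFunctionFinEquiv C : Fin n) = ρ j := by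
      simp only [ρ']
      rw [dif_pos ⟨(finFunctionFinEquiv A).2, (finFunctionFinEquiv C).2⟩]
      simp only [Fin.eta, Equiv.symm_apply_apply, hAC]
    rwa [e3] at this

/-- A monomial in the local coordinates `t`: a word of `q` letters, each of which is a coordinate
or the constant `1`. -/
def wordProd {q : ℕ} (t : Fin d → ℝ) (w : Fin q → Option (Fin d)) : ℝ :=
  ∏ k, (w k).elim 1 t

lemma wordProd_mem {q : ℕ} {t : Fin d → ℝ} (ht : ∀ i, t i ∈ Set.Icc (0 : ℝ) 1)
    (w : Fin q → Option (Fin d)) : wordProd t w ∈ Set.Icc (0 : ℝ) 1 := by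
  have h : ∀ k, (w k).elim 1 t ∈ Set.Icc (0 : ℝ) 1 := by
    intro k
    cases w k with
    | none => simp
    | some i => exact ht i
  exact ⟨Finset.prod_nonneg fun k _ => (h k).1, Finset.prod_le_one (fun k _ => (h k).1)
    fun k _ => (h k).2⟩

/-- The subnetwork for one block and one monomial: it approximates the product of the `d` triangle
waves, the monomial and a coefficient `base + scale * z`. -/
lemma St.exists_term (hd : 1 ≤ d) (hB : 10 ≤ B) {g : ℝ} {h : Fin d → ℝ} (hg : |g| ≤ B)
    (hh : ∀ i, |1 - h i| ≤ B) (k m r q : ℕ) (hr : d + q + 1 ≤ 2 ^ r) {H : ℕ}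
    (hH : 4 * k + 4 ≤ H) {z : (Fin d → ℝ) → ℝ} (hz : St d B (6 * d) H [z])
    (hz1 : ∀ x, z x ∈ Set.Icc (0 : ℝ) 1) {base scale : ℝ} (hb : 0 ≤ base) (hs : 0 ≤ scale)
    (hbs : base + scale ≤ 1) (w : Fin q → Option (Fin d)) :
    ∃ P : (Fin d → ℝ) → ℝ, St d B (2 ^ r * (6 * d)) (H + 1 + r * (2 * m + 4)) [P] ∧
      (∀ x, (∃ i, tri (2 ^ (2 * k) * localCoord g h x i) = 0) → P x = 0) ∧
      ∀ x, |P x - (∏ i, tri (2 ^ (2 * k) * localCoord g h x i)) * wordProd (localCoord g h x) w *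
        (base + scale * z x)| ≤ 2 ^ r / 4 ^ m := by
  have hw : 6 ≤ 6 * d := by omega
  have hV : ∀ i, St d B (6 * d) 2 [fun x => localCoord g h x i] := fun i =>
    (St.input_localCoord (by linarith) hg hh i).mono_width (by linarith) (by omega)
  have hV1 := localCoord_mem g h
  have hz' : St d B (6 * d) (H + 1) [fun x => base + scale * z x] := by
    refine hz.step (by linarith) (by simp; omega) ?_
    simp only [List.forall_mem_cons, List.not_mem_nil, false_imp_iff, implies_true, and_true]
    refine ⟨base, [scale], ?_, fun x => ?_⟩
    · simp [abs_of_nonneg hb, abs_of_nonneg hs]; linarith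
    · rw [max_eq_left]
      · simp only [lin]; ring
      · have := mul_nonneg hs (hz1 x).1
        simp only [lin]
        linarith
  have hone : St d B (6 * d) (H + 1) [fun _ => 1] := by
    have s1 := (St.input (B := B) (⟨0, hd⟩ : Fin d) (c := 0) (b := 1)
      (by simp; linarith) (by simp; linarith)).mono_width (w' := 6 * d) (by linarith) (by omega)
    have s2 := s1.pad (h' := H + 1) (by linarith) (by simp; omega) (by simp) (by omega)
    simpa using s2
  have htri : ∀ i, St d B (6 * d) (H + 1)
      [fun x => tri (2 ^ (2 * k) * localCoord g h x i)] := by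
    intro i
    have s1 := ((hV i).subset (L' := [fun x => localCoord g h x i,
      fun x => localCoord g h x i]) (by simp)).interpolate_sq (by linarith) hw
      (fun x => hV1 x i) (fun x => hV1 x i) (2 * k + 1)
    have s2 := (s1.subset (L' := [fun x => tent^[2 * k + 1] (localCoord g h x i)])
      (by simp)).pad (h' := H + 1) (by linarith) (by simp; omega)
      (by
        simp only [List.mem_singleton, forall_eq]
        exact fun x => (tent_iterate_mem (hV1 x i) _).1) (by omega)
    simpa only [tent_iterate_eq_tri (hV1 _ i)] using s2
  have hmon : ∀ o : Option (Fin d), St d B (6 * d) (H + 1)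
      [fun x => o.elim 1 (localCoord g h x)] := by
    intro o
    cases o with
    | none => simpa using hone
    | some i =>
      refine (hV i).pad (by linarith) (by simp; omega) ?_ (by omega)
      simpa using fun x => (hV1 x i).1
  let G : ℕ → (Fin d → ℝ) → ℝ := fun n x =>
    if hn : n < d then tri (2 ^ (2 * k) * localCoord g h x ⟨n, hn⟩)
    else if hn' : n - d < q then (w ⟨n - d, hn'⟩).elim 1 (localCoord g h x)
    else if n = d + q then base + scale * z x else 1
  have hGS : ∀ n, St d B (6 * d) (H + 1) [G n] := by
    intro n
    by_cases hn : n < d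
    · simpa [G, hn] using htri ⟨n, hn⟩
    · by_cases hn' : n - d < q
      · simpa [G, hn, hn'] using hmon (w ⟨n - d, hn'⟩)
      · by_cases hn'' : n = d + q
        · simpa [G, hn''] using hz'
        · simpa [G, hn, hn', hn''] using hone
  have hG1 : ∀ n x, G n x ∈ Set.Icc (0 : ℝ) 1 := by
    intro n x
    simp only [G]
    split_ifs with hn hn' hn''
    · exact tri_mem _
    · cases w ⟨n - d, hn'⟩ with
      | none => simp
      | some i => exact hV1 x i
    · have h1 := mul_nonneg hs (hz1 x).1
      have h2 := mul_le_of_le_one_right hs (hz1 x).2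
      exact ⟨by linarith, by linarith⟩
    · simp
  obtain ⟨P, hP, -, hP2, hP3⟩ := St.exists_prod (by linarith) hw m r hG1 hGS
  refine ⟨P, hP, fun x ⟨i, hi⟩ => hP2 i (by omega) x (by simpa [G] using hi), fun x => ?_⟩
  have e : ∏ n ∈ Finset.range (2 ^ r), G n x =
      (∏ i, tri (2 ^ (2 * k) * localCoord g h x i)) *
        wordProd (localCoord g h x) w * (base + scale * z x) := by
    obtain ⟨e, he⟩ := Nat.exists_eq_add_of_le hr
    rw [he, Finset.prod_range_add, Finset.prod_range_succ, Finset.prod_range_add]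
    have e1 : ∏ n ∈ Finset.range d, G n x =
        ∏ i, tri (2 ^ (2 * k) * localCoord g h x i) := by
      rw [Finset.prod_range]
      exact Finset.prod_congr rfl fun i _ => by simp [G]
    have e2 : ∏ n ∈ Finset.range q, G (d + n) x = wordProd (localCoord g h x) w := by
      rw [Finset.prod_range, wordProd]
      exact Finset.prod_congr rfl fun i _ => by simp [G]
    have e3 : ∏ n ∈ Finset.range e, G (d + q + 1 + n) x = 1 := by
      refine Finset.prod_eq_one fun n _ => ?_
      have h1 : ¬ d + q + 1 + n < d := by omega
      have h2 : ¬ d + q + 1 + n - d < q := by omega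
      have h3 : ¬ d + q + 1 + n = d + q := by omega
      simp [G, h1, h2, h3]
    have e4 : G (d + q) x = base + scale * z x := by simp [G]
    rw [e1, e2, e3, e4, mul_one]
  rw [← e]
  refine (hP3 x).trans ?_
  gcongr
  linarith

end

/-! ### Mixed partial derivatives on a convex set -/

section Partial

variable {d : ℕ}

local notation "E" => EuclideanSpace ℝ (Fin d)

/-- The iterated partial derivative of `f` within `Ω` along a list of coordinates; the head of the
list is differentiated last. -/
noncomputable def listPartial (Ω : Set E) (f : E → ℝ) : List (Fin d) → E → ℝ
  | [] => f
  | i :: l => fun x => fderivWithin ℝ (listPartial Ω f l) Ω x (EuclideanSpace.single i 1)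

lemma contDiffOn_listPartial {Ω : Set E} (hΩ : UniqueDiffOn ℝ Ω) {f : E → ℝ} (l : List (Fin d))
    {n : ℕ} (hf : ContDiffOn ℝ ((n + l.length : ℕ) : WithTop ℕ∞) f Ω) :
    ContDiffOn ℝ (n : WithTop ℕ∞) (listPartial Ω f l) Ω := by
  induction l generalizing n with
  | nil => simpa [listPartial] using hf
  | cons i l ih =>
    have h := ih (n := n + 1) (by convert hf using 2; simp only [List.length_cons]; ring)
    exact (h.fderivWithin hΩ (m := n) (by push_cast; exact le_rfl)).clm_apply contDiffOn_const

/-- Partial derivatives within `Ω` commute, as `Ω` is contained in the closure of its interior. -/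
lemma listPartial_perm {Ω : Set E} (hΩ : UniqueDiffOn ℝ Ω) (hΩ' : Ω ⊆ closure (interior Ω))
    {f : E → ℝ} {l l' : List (Fin d)} (h : l.Perm l')
    (hf : ContDiffOn ℝ (l.length : WithTop ℕ∞) f Ω) {x : E} (hx : x ∈ Ω) :
    listPartial Ω f l x = listPartial Ω f l' x := by
  induction h generalizing x with
  | nil => rfl
  | @cons i l l' _ ih =>
    have hf' := hf.of_le (m := (l.length : WithTop ℕ∞)) (by exact_mod_cast Nat.le_succ _)
    simp only [listPartial]
    rw [fderivWithin_congr (fun y hy => ih hf' hy) (ih hf' hx)]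
  | swap i j l =>
    have h2 : ContDiffOn ℝ (2 : ℕ) (listPartial Ω f l) Ω := by
      refine contDiffOn_listPartial hΩ l ?_
      convert hf using 2
      simp only [List.length_cons]; ring
    have h1 : DifferentiableWithinAt ℝ (fderivWithin ℝ (listPartial Ω f l) Ω) Ω x :=
      ((h2.fderivWithin hΩ (m := 1) (by norm_num)).differentiableOn (by norm_num)) x hx
    have hs := ContDiffWithinAt.isSymmSndFDerivWithinAt (h2 x hx) (by simp) hΩ (hΩ' hx) hx
    simp only [listPartial]
    rw [fderivWithin_clm_apply (hΩ x hx) h1 (differentiableWithinAt_const _),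
      fderivWithin_clm_apply (hΩ x hx) h1 (differentiableWithinAt_const _)]
    simpa using hs _ _
  | trans h1 _ ih1 ih2 =>
    rw [ih1 hf hx, ih2 (by rwa [← h1.length_eq]) hx]

lemma iteratedFDerivWithin_eq_listPartial {Ω : Set E} (hΩ : UniqueDiffOn ℝ Ω) {f : E → ℝ} {n : ℕ}
    (hf : ContDiffOn ℝ (n : WithTop ℕ∞) f Ω) (w : Fin n → Fin d) {x : E} (hx : x ∈ Ω) :
    iteratedFDerivWithin ℝ n f Ω x (fun j => EuclideanSpace.single (w j) 1) =
      listPartial Ω f (List.ofFn w) x := by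
  induction n generalizing x with
  | zero => simp [listPartial]
  | succ n ih =>
    have hf' := hf.of_le (m := (n : WithTop ℕ∞)) (by exact_mod_cast Nat.le_succ _)
    have hd : DifferentiableWithinAt ℝ (iteratedFDerivWithin ℝ n f Ω) Ω x :=
      hf.differentiableOn_iteratedFDerivWithin (by exact_mod_cast Nat.lt_succ_self n) hΩ x hx
    rw [iteratedFDerivWithin_succ_apply_left, List.ofFn_succ]
    simp only [listPartial]
    rw [← fderivWithin_congr (fun y hy => ih hf' (fun j => w j.succ) hy)
      (ih hf' (fun j => w j.succ) hx)]
    rw [fderivWithin_continuousMultilinear_apply_const_apply (hΩ x hx) hd]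
    rfl

/-- The coordinates of the partial derivative with multi-index `v`, in increasing order. -/
def sortedWord (v : Fin d → ℕ) : List (Fin d) :=
  List.ofFn fun j : Fin (∑ i, v i) => (finSigmaFinEquiv.symm j).1

lemma length_sortedWord (v : Fin d → ℕ) : (sortedWord v).length = ∑ i, v i := by
  simp [sortedWord]

lemma count_sortedWord (v : Fin d → ℕ) (i : Fin d) : (sortedWord v).count i = v i := by
  classical
  have e1 : sortedWord v = (List.finRange (∑ i, v i)).map
      fun j => (finSigmaFinEquiv.symm j).1 := by
    rw [sortedWord, List.ofFn_eq_map]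
  have e2 : (sortedWord v).count i = (Finset.univ.filter
      fun j : Fin (∑ i, v i) => (finSigmaFinEquiv.symm j).1 = i).card := by
    rw [e1, ← Multiset.coe_count, ← Multiset.map_coe, Multiset.count_map]
    simp only [Finset.card_def, Finset.filter_val, eq_comm]
    rfl
  rw [e2, ← Fintype.card_subtype]
  have e3 : {j : Fin (∑ i, v i) // (finSigmaFinEquiv.symm j).1 = i} ≃ Fin (v i) :=
    (finSigmaFinEquiv.symm.subtypeEquiv (q := fun p : (k : Fin d) × Fin (v k) => p.1 = i)
      (by simp)).trans (Equiv.sigmaSubtype i)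
  simpa using Fintype.card_congr e3

lemma mixedPartial_eq_listPartial {Ω : Set E} (hΩ : UniqueDiffOn ℝ Ω) {f : E → ℝ}
    {v : Fin d → ℕ} (hf : ContDiffOn ℝ ((∑ i, v i : ℕ) : WithTop ℕ∞) f Ω) {x : E} (hx : x ∈ Ω) :
    mixedPartial Ω v f x = listPartial Ω f (sortedWord v) x :=
  iteratedFDerivWithin_eq_listPartial hΩ hf _ hx

lemma mixedPartial_zero {Ω : Set E} (hΩ : UniqueDiffOn ℝ Ω) {f : E → ℝ}
    (hf : ContDiffOn ℝ 0 f Ω) {x : E} (hx : x ∈ Ω) : mixedPartial Ω 0 f x = f x := by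
  have h : sortedWord (0 : Fin d → ℕ) = [] := by
    rw [← List.length_eq_zero_iff, length_sortedWord]
    simp
  rw [mixedPartial_eq_listPartial hΩ (by simpa using hf) hx, h]
  rfl

lemma sum_add_single (v : Fin d → ℕ) (i : Fin d) :
    ∑ k, (v + Pi.single i 1 : Fin d → ℕ) k = (∑ k, v k) + 1 := by
  simp [Finset.sum_add_distrib]

/-- A family of functions indexed by multi-indices of degree at most `q` which behaves on `Ω` like
the partial derivatives of a function. -/
def IsJet (q : ℕ) (Ω : Set E) (F : (Fin d → ℕ) → E → ℝ) : Prop :=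
  ∀ v, ∑ i, v i < q → ∀ x ∈ Ω, HasFDerivWithinAt (F v)
    (∑ i, F (v + Pi.single i 1) x • (EuclideanSpace.proj i : E →L[ℝ] ℝ)) Ω x

lemma isJet_mixedPartial {Ω : Set E} (hΩ : UniqueDiffOn ℝ Ω) (hΩ' : Ω ⊆ closure (interior Ω))
    {f : E → ℝ} {q : ℕ} (hf : ContDiffOn ℝ (q : WithTop ℕ∞) f Ω) :
    IsJet q Ω (fun v => mixedPartial Ω v f) := by
  intro v hv x hx
  have hle : ∀ n : ℕ, n ≤ q → ContDiffOn ℝ (n : WithTop ℕ∞) f Ω := fun n hn =>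
    hf.of_le (by exact_mod_cast hn)
  have h1 : ContDiffOn ℝ (1 : ℕ) (listPartial Ω f (sortedWord v)) Ω :=
    contDiffOn_listPartial hΩ _ (hle _ (by rw [length_sortedWord]; omega))
  have h2 := ((h1.differentiableOn (by norm_num)) x hx).hasFDerivWithinAt
  have h3 := h2.congr (fun y hy => mixedPartial_eq_listPartial hΩ (hle _ hv.le) hy)
    (mixedPartial_eq_listPartial hΩ (hle _ hv.le) hx)
  refine h3.congr_fderiv ?_
  have key : ∀ i, mixedPartial Ω (v + Pi.single i 1) f x =
      fderivWithin ℝ (listPartial Ω f (sortedWord v)) Ω x (EuclideanSpace.single i 1) := by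
    intro i
    rw [mixedPartial_eq_listPartial hΩ (hle _ (by rw [sum_add_single]; omega)) hx]
    change _ = listPartial Ω f (i :: sortedWord v) x
    refine listPartial_perm hΩ hΩ' ?_ (hle _ ?_) hx
    · rw [List.perm_iff_count]
      intro k
      rw [count_sortedWord, List.count_cons, count_sortedWord]
      by_cases h : k = i
      · subst h; simp
      · simp [h, Ne.symm h]
    · rw [length_sortedWord, sum_add_single]; omega
  simp only [key]
  set φ := fderivWithin ℝ (listPartial Ω f (sortedWord v)) Ω x
  ext y
  have hy : y = ∑ i, y i • EuclideanSpace.single i (1 : ℝ) := by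
    ext k
    simp [Finset.sum_apply, Pi.single_apply]
  conv_lhs => rw [hy]
  simp [mul_comm]

end Partial

/-! ### Taylor polynomials of jets -/

section Taylor

variable {d : ℕ}

local notation "E" => EuclideanSpace ℝ (Fin d)

/-- The normalized monomial `y ^ u / u!`. -/
noncomputable def monomialDiv (u : Fin d → ℕ) (y : Fin d → ℝ) : ℝ :=
  ∏ i, y i ^ u i / (u i).factorial

/-- The multi-indices with all entries at most `q`. -/
def indexBox (d q : ℕ) : Finset (Fin d → ℕ) := Fintype.piFinset fun _ => Finset.range (q + 1)

lemma mem_indexBox {q : ℕ} {u : Fin d → ℕ} : u ∈ indexBox d q ↔ ∀ i, u i ≤ q := by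
  simp [indexBox]

lemma card_indexBox (q : ℕ) : (indexBox d q).card = (q + 1) ^ d := by
  simp [indexBox]

/-- The coefficients `c`, set to zero in degrees above `q`. -/
def cutoff (q : ℕ) (c : (Fin d → ℕ) → ℝ) (u : Fin d → ℕ) : ℝ :=
  if ∑ i, u i ≤ q then c u else 0

/-- The jet of the polynomial of degree `q` whose partial derivatives at `z` are the numbers
`c v`. -/
noncomputable def taylorJet (q : ℕ) (c : (Fin d → ℕ) → ℝ) (z : E) (v : Fin d → ℕ) (x : E) : ℝ :=
  ∑ u ∈ indexBox d q, cutoff q c (v + u) * monomialDiv u fun i => x i - z i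

lemma hasFDerivAt_monomialDiv (u : Fin d → ℕ) (z x : E) :
    HasFDerivAt (fun x : E => monomialDiv u fun i => x i - z i)
      (∑ i, (if u i = 0 then 0 else monomialDiv (u - Pi.single i 1) fun i => x i - z i) •
        (EuclideanSpace.proj i : E →L[ℝ] ℝ)) x := by
  classical
  have h1 : ∀ i : Fin d, HasFDerivAt (fun x : E => (x i - z i) ^ u i / (u i).factorial)
      ((u i * (x i - z i) ^ (u i - 1) / (u i).factorial) •
        (EuclideanSpace.proj i : E →L[ℝ] ℝ)) x := by
    intro i
    have h2 : HasFDerivAt (fun x : E => x i - z i) (EuclideanSpace.proj i : E →L[ℝ] ℝ) x :=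
      ((EuclideanSpace.proj i : E →L[ℝ] ℝ).hasFDerivAt (x := x)).sub_const _
    have h3 := (h2.pow (u i)).mul_const (((u i).factorial : ℝ)⁻¹)
    simp only [← div_eq_mul_inv] at h3
    refine h3.congr_fderiv ?_
    ext y
    simp
    ring
  have h4 := HasFDerivAt.finsetProd (u := Finset.univ) (fun i _ => h1 i)
  refine h4.congr_fderiv ?_
  refine Finset.sum_congr rfl fun i _ => ?_
  rw [smul_smul]
  congr 1
  split_ifs with hi
  · simp [hi]
  · rw [monomialDiv, ← Finset.mul_prod_erase Finset.univ _ (Finset.mem_univ i), mul_comm]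
    congr 1
    · obtain ⟨n, hn⟩ := Nat.exists_eq_succ_of_ne_zero hi
      simp only [Pi.sub_apply, hn, Pi.single_eq_same, Nat.succ_eq_add_one, Nat.add_sub_cancel,
        Nat.factorial_succ]
      have : (n.factorial : ℝ) ≠ 0 := by positivity
      push_cast
      field_simp
    · refine Finset.prod_congr rfl fun k hk => ?_
      simp [Finset.ne_of_mem_erase hk]

lemma cutoff_of_gt {q : ℕ} {c : (Fin d → ℕ) → ℝ} {u : Fin d → ℕ} (h : q < ∑ i, u i) :
    cutoff q c u = 0 := if_neg (by omega)

lemma hasFDerivAt_taylorJet (q : ℕ) (c : (Fin d → ℕ) → ℝ) (z : E) (v : Fin d → ℕ) (x : E) :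
    HasFDerivAt (taylorJet q c z v)
      (∑ i, taylorJet q c z (v + Pi.single i 1) x • (EuclideanSpace.proj i : E →L[ℝ] ℝ)) x := by
  have h1 := HasFDerivAt.fun_sum (u := indexBox d q) fun u _ =>
    (hasFDerivAt_monomialDiv u z x).const_mul (cutoff q c (v + u))
  refine h1.congr_fderiv ?_
  simp only [Finset.smul_sum]
  rw [Finset.sum_comm]
  refine Finset.sum_congr rfl fun i _ => ?_
  simp only [taylorJet, Finset.sum_smul, smul_smul]
  -- The terms with `u i = 0` on the left and those with `u i = q` on the right vanish; the others
  -- are matched by `u ↦ u - e_i`.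
  have eL : ∀ u ∈ indexBox d q, ((cutoff q c (v + u) * if u i = 0 then 0 else
      monomialDiv (u - Pi.single i 1) fun i => x i - z i) • (EuclideanSpace.proj i : E →L[ℝ] ℝ)) =
      if u i ≠ 0 then (cutoff q c (v + u) * monomialDiv (u - Pi.single i 1) fun i => x i - z i) •
        (EuclideanSpace.proj i : E →L[ℝ] ℝ) else 0 := by
    intro u _
    by_cases h : u i = 0 <;> simp [h]
  have eR : ∀ u ∈ indexBox d q, ((cutoff q c (v + Pi.single i 1 + u) *
      monomialDiv u fun i => x i - z i) • (EuclideanSpace.proj i : E →L[ℝ] ℝ)) =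
      if u i ≠ q then (cutoff q c (v + Pi.single i 1 + u) * monomialDiv u fun i => x i - z i) •
        (EuclideanSpace.proj i : E →L[ℝ] ℝ) else 0 := by
    intro u _
    by_cases h : u i = q
    · have h3 : q < ∑ k, (v + Pi.single i 1 + u : Fin d → ℕ) k := by
        refine lt_of_lt_of_le ?_ (Finset.single_le_sum (f := (v + Pi.single i 1 + u : Fin d → ℕ))
          (fun _ _ => Nat.zero_le _) (Finset.mem_univ i))
        simp only [Pi.add_apply, Pi.single_eq_same, h]
        omega
      rw [cutoff_of_gt h3]
      simp
    · simp [h]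
  rw [Finset.sum_congr rfl eL, Finset.sum_congr rfl eR, ← Finset.sum_filter, ← Finset.sum_filter]
  refine Finset.sum_nbij' (fun u => u - Pi.single i 1) (fun u => u + Pi.single i 1) ?_ ?_ ?_ ?_ ?_
  · intro u hu
    simp only [Finset.mem_filter, mem_indexBox] at hu ⊢
    refine ⟨fun k => (Nat.sub_le _ _).trans (hu.1 k), ?_⟩
    have := hu.1 i
    simp only [Pi.sub_apply, Pi.single_eq_same]
    omega
  · intro u hu
    simp only [Finset.mem_filter, mem_indexBox] at hu ⊢
    refine ⟨fun k => ?_, by simp⟩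
    have := hu.1 k
    by_cases hk : k = i
    · subst hk
      simp only [Pi.add_apply, Pi.single_eq_same]
      omega
    · simpa [hk] using this
  · intro u hu
    simp only [Finset.mem_filter] at hu
    ext k
    by_cases hk : k = i
    · subst hk
      simp only [Pi.add_apply, Pi.sub_apply, Pi.single_eq_same]
      omega
    · simp [hk]
  · intro u _
    ext k
    simp
  · intro u hu
    simp only [Finset.mem_filter] at hu
    have : v + Pi.single i 1 + (u - Pi.single i 1) = v + u := by
      ext k
      by_cases hk : k = i
      · subst hk
        simp only [Pi.add_apply, Pi.sub_apply, Pi.single_eq_same]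
        omega
      · simp [hk]
    rw [this]

lemma isJet_taylorJet (q : ℕ) (c : (Fin d → ℕ) → ℝ) (z : E) (Ω : Set E) :
    IsJet q Ω (taylorJet q c z) :=
  fun v _ x _ => (hasFDerivAt_taylorJet q c z v x).hasFDerivWithinAt

lemma IsJet.sub {q : ℕ} {Ω : Set E} {F G : (Fin d → ℕ) → E → ℝ} (hF : IsJet q Ω F)
    (hG : IsJet q Ω G) : IsJet q Ω (fun v x => F v x - G v x) := by
  intro v hv x hx
  refine ((hF v hv x hx).fun_sub (hG v hv x hx)).congr_fderiv ?_
  simp only [sub_smul, Finset.sum_sub_distrib]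

lemma monomialDiv_zero (y : Fin d → ℝ) : monomialDiv 0 y = 1 := by
  simp [monomialDiv]

lemma taylorJet_center (q : ℕ) (c : (Fin d → ℕ) → ℝ) (z : E) {v : Fin d → ℕ}
    (hv : ∑ i, v i ≤ q) : taylorJet q c z v z = c v := by
  rw [taylorJet, Finset.sum_eq_single 0]
  · simp [monomialDiv_zero, cutoff, hv]
  · intro u _ hu
    obtain ⟨i, hi⟩ : ∃ i, u i ≠ 0 := by
      by_contra! h
      exact hu (funext h)
    rw [monomialDiv, Finset.prod_eq_zero (Finset.mem_univ i) (by simp [hi]), mul_zero]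
  · exact fun h => absurd (mem_indexBox.2 fun i => Nat.zero_le _) h

lemma taylorJet_top (q : ℕ) (c : (Fin d → ℕ) → ℝ) (z : E) {v : Fin d → ℕ}
    (hv : ∑ i, v i = q) (x : E) : taylorJet q c z v x = c v := by
  rw [taylorJet, Finset.sum_eq_single 0]
  · simp [monomialDiv_zero, cutoff, hv]
  · intro u _ hu
    obtain ⟨i, hi⟩ : ∃ i, u i ≠ 0 := by
      by_contra! h
      exact hu (funext h)
    rw [cutoff_of_gt, zero_mul]
    have : u i ≤ ∑ k, u k :=
      Finset.single_le_sum (f := u) (fun _ _ => Nat.zero_le _) (Finset.mem_univ i)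
    simp only [Pi.add_apply, Finset.sum_add_distrib, hv]
    omega
  · exact fun h => absurd (mem_indexBox.2 fun i => Nat.zero_le _) h

lemma norm_sum_smul_proj_le (a : Fin d → ℝ) {K : ℝ} (ha : ∀ i, |a i| ≤ K) :
    ‖∑ i, a i • (EuclideanSpace.proj i : E →L[ℝ] ℝ)‖ ≤ d * K := by
  have hp : ∀ i, ‖(EuclideanSpace.proj i : E →L[ℝ] ℝ)‖ ≤ 1 := fun i =>
    ContinuousLinearMap.opNorm_le_bound _ zero_le_one fun x => by
      rw [one_mul]; exact EuclideanSpace.norm_eq x ▸ (by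
        rw [← EuclideanSpace.norm_eq]; exact PiLp.norm_apply_le x i)
  refine (norm_sum_le _ _).trans ?_
  refine (Finset.sum_le_card_nsmul _ _ K fun i _ => ?_).trans (by simp)
  rw [norm_smul, Real.norm_eq_abs]
  exact (mul_le_of_le_one_right (abs_nonneg _) (hp i)).trans (ha i)

/-- The size of a jet that vanishes at `z`, from its size in the top degree: Taylor's theorem
without explicit remainders, by the mean value inequality in each degree. -/
lemma IsJet.abs_le {q : ℕ} {Ω : Set E} (hΩ : Convex ℝ Ω) {G : (Fin d → ℕ) → E → ℝ}
    (hG : IsJet q Ω G) {z : E} (hz : z ∈ Ω) (h0 : ∀ v, ∑ i, v i < q → G v z = 0) {ρ K : ℝ}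
    (hρ : 0 ≤ ρ) (htop : ∀ v, ∑ i, v i = q → ∀ x ∈ Ω, ‖x - z‖ ≤ ρ → |G v x| ≤ K)
    (n : ℕ) {v : Fin d → ℕ} (hv : ∑ i, v i + n = q) {x : E} (hx : x ∈ Ω) (hxz : ‖x - z‖ ≤ ρ) :
    |G v x| ≤ K * (d * ρ) ^ n := by
  induction n generalizing v x with
  | zero => simpa using htop v (by simpa using hv) x hx hxz
  | succ n ih =>
    have hconv : Convex ℝ (Ω ∩ Metric.closedBall z ρ) := hΩ.inter (convex_closedBall z ρ)
    have hder : ∀ y ∈ Ω ∩ Metric.closedBall z ρ, HasFDerivWithinAt (G v)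
        (∑ i, G (v + Pi.single i 1) y • (EuclideanSpace.proj i : E →L[ℝ] ℝ))
        (Ω ∩ Metric.closedBall z ρ) y := fun y hy =>
      (hG v (by omega) y hy.1).mono Set.inter_subset_left
    have hbd : ∀ y ∈ Ω ∩ Metric.closedBall z ρ,
        ‖∑ i, G (v + Pi.single i 1) y • (EuclideanSpace.proj i : E →L[ℝ] ℝ)‖ ≤
          d * (K * (d * ρ) ^ n) := fun y hy =>
      norm_sum_smul_proj_le _ fun i => ih (by rw [sum_add_single]; omega) hy.1
        (by simpa [dist_eq_norm] using hy.2)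
    have := hconv.norm_image_sub_le_of_norm_hasFDerivWithin_le hder hbd
      (x := z) (y := x) ⟨hz, by simpa using hρ⟩ ⟨hx, by simpa [dist_eq_norm] using hxz⟩
    rw [h0 v (by omega), sub_zero, Real.norm_eq_abs] at this
    refine this.trans ?_
    have hnn : 0 ≤ d * (K * (d * ρ) ^ n) := (norm_nonneg _).trans (hbd z ⟨hz, by simpa using hρ⟩)
    calc d * (K * (d * ρ) ^ n) * ‖x - z‖ ≤ d * (K * (d * ρ) ^ n) * ρ := by gcongr
      _ = K * (d * ρ) ^ (n + 1) := by ring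

end Taylor

/-! ### Polynomials in word form -/

section Words

variable {d : ℕ}

/-- `p` is a polynomial of degree `q`, given by coefficients of absolute value at most `C` for the
words of `q` letters (see `wordProd`). -/
def IsWordPoly (q : ℕ) (C : ℝ) (p : (Fin d → ℝ) → ℝ) : Prop :=
  ∃ c : (Fin q → Option (Fin d)) → ℝ, (∀ w, |c w| ≤ C) ∧ ∀ t, p t = ∑ w, c w * wordProd t w

lemma IsWordPoly.const (c : ℝ) : IsWordPoly (d := d) 0 |c| (fun _ => c) :=
  ⟨fun _ => c, fun _ => le_rfl, fun t => by simp [wordProd]⟩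

lemma IsWordPoly.mul {q₁ q₂ : ℕ} {C₁ C₂ : ℝ} {p₁ p₂ : (Fin d → ℝ) → ℝ}
    (h₁ : IsWordPoly q₁ C₁ p₁) (h₂ : IsWordPoly q₂ C₂ p₂) :
    IsWordPoly (q₁ + q₂) (C₁ * C₂) (fun t => p₁ t * p₂ t) := by
  obtain ⟨c₁, b₁, e₁⟩ := h₁
  obtain ⟨c₂, b₂, e₂⟩ := h₂
  refine ⟨fun w => c₁ (fun i => w (Fin.castAdd q₂ i)) * c₂ (fun i => w (Fin.natAdd q₁ i)),
    fun w => ?_, fun t => ?_⟩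
  · rw [abs_mul]
    exact mul_le_mul (b₁ _) (b₂ _) (abs_nonneg _) ((abs_nonneg _).trans (b₁ fun _ => none))
  · beta_reduce
    rw [e₁, e₂, Finset.sum_mul_sum, ← Finset.sum_product', Finset.univ_product_univ,
      ← (Fin.appendEquiv q₁ q₂).sum_comp]
    refine Finset.sum_congr rfl fun w _ => ?_
    simp only [Fin.appendEquiv, Equiv.coe_fn_mk, Fin.append_left, Fin.append_right, wordProd,
      Fin.prod_univ_add]
    ring

lemma IsWordPoly.coord_add (i : Fin d) {e : ℝ} (he : |e| ≤ 1) :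
    IsWordPoly 1 1 (fun t => t i + e) := by
  classical
  refine ⟨fun w => if w 0 = some i then 1 else if w 0 = none then e else 0, fun w => ?_,
    fun t => ?_⟩
  · beta_reduce
    split_ifs <;> simp [he]
  · rw [← (Equiv.funUnique (Fin 1) (Option (Fin d))).symm.sum_comp]
    simp [wordProd, Fintype.sum_option]
    ring

lemma IsWordPoly.one (q : ℕ) : IsWordPoly (d := d) q 1 (fun _ => 1) := by
  classical
  refine ⟨fun w => if w = fun _ => none then 1 else 0, fun w => ?_, fun t => ?_⟩
  · beta_reduce
    split_ifs <;> simp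
  · simp [wordProd]

lemma IsWordPoly.mono {q q' : ℕ} {C C' : ℝ} {p : (Fin d → ℝ) → ℝ} (h : IsWordPoly q C p)
    (hq : q ≤ q') (hC : C ≤ C') : IsWordPoly q' C' p := by
  obtain ⟨k, rfl⟩ := Nat.exists_eq_add_of_le hq
  obtain ⟨c, b, e⟩ := h.mul (IsWordPoly.one (d := d) k)
  exact ⟨c, fun w => (b w).trans (by simpa using hC), fun t => by rw [← e]; simp⟩

lemma IsWordPoly.pow (i : Fin d) {e : ℝ} (he : |e| ≤ 1) (n : ℕ) :
    IsWordPoly n 1 (fun t => (t i + e) ^ n) := by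
  induction n with
  | zero => simpa using IsWordPoly.const (d := d) 1
  | succ n ih => simpa [pow_succ] using ih.mul (IsWordPoly.coord_add i he)

lemma IsWordPoly.prod (u : Fin d → ℕ) {e : Fin d → ℝ} (he : ∀ i, |e i| ≤ 1) :
    IsWordPoly (∑ i, u i) 1 (fun t => ∏ i, (t i + e i) ^ u i) := by
  classical
  suffices h : ∀ s : Finset (Fin d),
      IsWordPoly (∑ i ∈ s, u i) 1 (fun t => ∏ i ∈ s, (t i + e i) ^ u i) from h Finset.univ
  intro s
  induction s using Finset.induction_on with
  | empty => simpa using IsWordPoly.const (d := d) 1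
  | insert a s ha ih =>
    simp only [Finset.sum_insert ha, Finset.prod_insert ha]
    simpa using (IsWordPoly.pow a (he a) (u a)).mul ih

lemma IsWordPoly.sum {ι : Type*} {q : ℕ} {C : ℝ} (s : Finset ι) {p : ι → (Fin d → ℝ) → ℝ}
    (h : ∀ i ∈ s, IsWordPoly q C (p i)) :
    IsWordPoly q (s.card * C) (fun t => ∑ i ∈ s, p i t) := by
  classical
  choose! c b e using h
  refine ⟨fun w => ∑ i ∈ s, c i w, fun w => ?_, fun t => ?_⟩
  · refine (Finset.abs_sum_le_sum_abs _ _).trans ?_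
    exact (Finset.sum_le_card_nsmul _ _ C fun i hi => b i hi w).trans (by simp)
  · simp only [Finset.sum_mul]
    rw [Finset.sum_comm]
    exact Finset.sum_congr rfl fun i hi => e i hi t

/-- A Taylor polynomial, in coordinates `t` in which `x - z = D (t + e)`. -/
lemma IsWordPoly.taylor {q : ℕ} {c : (Fin d → ℕ) → ℝ} {D C : ℝ} (hD : 0 ≤ D)
    (hc : ∀ u, ∑ i, u i ≤ q → |c u| * D ^ (∑ i, u i) ≤ C) {e : Fin d → ℝ}
    (he : ∀ i, |e i| ≤ 1) :
    IsWordPoly q ((q + 1) ^ d * C) (fun t =>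
      ∑ u ∈ indexBox d q, cutoff q c (0 + u) * monomialDiv u fun i => D * (t i + e i)) := by
  have hC : 0 ≤ C := le_trans (by positivity) (hc 0 (by simp))
  have h := IsWordPoly.sum (q := q) (C := C) (indexBox d q)
    (p := fun u t => cutoff q c (0 + u) * monomialDiv u fun i => D * (t i + e i)) fun u _ => ?_
  · rw [card_indexBox] at h
    push_cast at h
    exact h
  · by_cases hu : ∑ i, u i ≤ q
    · have h1 := (IsWordPoly.const (d := d)
        (c u * D ^ (∑ i, u i) * ∏ i, ((u i).factorial : ℝ)⁻¹)).mul (IsWordPoly.prod u he)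
      have h2 : (fun t : Fin d → ℝ => cutoff q c (0 + u) * monomialDiv u fun i => D * (t i + e i)) =
          fun t => (c u * D ^ (∑ i, u i) * ∏ i, ((u i).factorial : ℝ)⁻¹) *
            ∏ i, (t i + e i) ^ u i := by
        funext t
        simp only [zero_add, cutoff, hu, if_true, monomialDiv, div_eq_mul_inv, mul_pow,
          Finset.prod_mul_distrib, Finset.prod_pow_eq_pow_sum]
        ring
      rw [h2]
      refine h1.mono (by omega) ?_
      rw [mul_one, abs_mul, abs_mul, abs_of_nonneg (pow_nonneg hD _)]
      refine le_trans (mul_le_of_le_one_right (by positivity) ?_) (hc u hu)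
      rw [Finset.abs_prod]
      refine Finset.prod_le_one (fun i _ => abs_nonneg _) fun i _ => ?_
      rw [abs_of_nonneg (by positivity)]
      exact inv_le_one_of_one_le₀ (by exact_mod_cast Nat.one_le_iff_ne_zero.2 (Nat.factorial_ne_zero _))
    · have h2 : (fun t : Fin d → ℝ => cutoff q c (0 + u) * monomialDiv u fun i => D * (t i + e i)) =
          fun _ => 0 := by
        funext t
        simp [cutoff, hu]
      rw [h2]
      exact (IsWordPoly.const (d := d) 0).mono (Nat.zero_le _) (by simpa using hC)

end Words

/-! ### Local polynomial approximation of Hölder functions -/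

section Holder

variable {d : ℕ}

local notation "E" => EuclideanSpace ℝ (Fin d)

/-- The jet of a function in a Hölder ball is bounded in all degrees, with a bound that depends on
`Ω`, `L` and `s` only: in the top degree this follows from the bound for the oscillation and the
mean value theorem on a segment in `Ω`. -/
lemma exists_jet_of_holderBall {s L : ℝ} (hs : 1 ≤ s) (hL : 0 < L) {Ω : Set E}
    (hb : Bornology.IsBounded Ω) (hc : Convex ℝ Ω) (hi : (interior Ω).Nonempty) :
    ∃ M : ℝ, 0 ≤ M ∧ ∀ f ∈ holderBall s L Ω, ∃ F : (Fin d → ℕ) → E → ℝ, IsJet ⌊s⌋₊ Ω F ∧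
      (∀ x ∈ Ω, F 0 x = f x) ∧ (∀ v, ∑ i, v i ≤ ⌊s⌋₊ → ∀ x ∈ Ω, |F v x| ≤ M) ∧
      ∀ v, ∑ i, v i = ⌊s⌋₊ → ∀ x ∈ Ω, ∀ y ∈ Ω,
        |F v x - F v y| ≤ L * ‖x - y‖ ^ (s - (⌊s⌋₊ : ℝ)) := by
  classical
  set q := ⌊s⌋₊ with hq
  have hq1 : 1 ≤ q := Nat.one_le_floor_iff _ |>.2 hs
  have hqs : (q : ℝ) ≤ s := Nat.floor_le (by linarith)
  have hu : UniqueDiffOn ℝ Ω := uniqueDiffOn_convex hc hi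
  have hcl : Ω ⊆ closure (interior Ω) := by
    rw [hc.closure_interior_eq_closure_of_nonempty_interior hi]
    exact subset_closure
  obtain ⟨x₀, hx₀⟩ := hi
  obtain ⟨ε, hε, hball⟩ := Metric.isOpen_iff.1 isOpen_interior x₀ hx₀
  have hball' : ∀ y ∈ Metric.ball x₀ ε, Ω ∈ 𝓝 y := fun y hy =>
    mem_interior_iff_mem_nhds.1 (hball hy)
  obtain ⟨R, hR⟩ := hb.exists_norm_le
  set ρ := ε / 2 with hρ
  have hρ0 : 0 < ρ := by positivity
  have hR0 : 0 ≤ R := (norm_nonneg _).trans (hR x₀ (interior_subset hx₀))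
  set κ := s - (q : ℝ) with hκ
  have hκ0 : 0 ≤ κ := by rw [hκ]; linarith
  refine ⟨L + 2 * L / ρ + L * (2 * R) ^ κ, by positivity, fun f hf => ?_⟩
  obtain ⟨hf, hn⟩ := hf
  have hle := le_trans le_self_add hn
  have hle' := le_trans le_add_self hn
  have hlow : ∀ v : Fin d → ℕ, ∑ i, v i < q → ∀ x ∈ Ω, |mixedPartial Ω v f x| ≤ L := by
    intro v hv x hx
    have h1 : ‖mixedPartial Ω v f x‖ₑ ≤ ENNReal.ofReal L := by
      refine le_trans ?_ hle
      refine le_iSup₂_of_le v hv ?_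
      refine le_iSup₂_of_le x hx ?_
      exact le_rfl
    rw [← ofReal_norm, ENNReal.ofReal_le_ofReal_iff hL.le] at h1
    exact h1
  have hhol : ∀ v : Fin d → ℕ, ∑ i, v i = q → ∀ x ∈ Ω, ∀ y ∈ Ω,
      |mixedPartial Ω v f x - mixedPartial Ω v f y| ≤ L * ‖x - y‖ ^ κ := by
    intro v hv x hx y hy
    by_cases hxy : x = y
    · subst hxy
      simp only [sub_self, abs_zero]
      positivity
    · have h1 : ‖mixedPartial Ω v f x - mixedPartial Ω v f y‖ₑ / ENNReal.ofReal (‖x - y‖ ^ κ) ≤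
          ENNReal.ofReal L := by
        refine le_trans ?_ hle'
        refine le_iSup₂_of_le v hv ?_
        refine le_iSup₂_of_le x hx ?_
        refine le_iSup₂_of_le y hy ?_
        refine le_iSup_of_le hxy ?_
        exact le_rfl
      have hpos : 0 < ‖x - y‖ ^ κ := Real.rpow_pos_of_pos (norm_pos_iff.2 (sub_ne_zero.2 hxy)) _
      rw [ENNReal.div_le_iff (by simpa using hpos) ENNReal.ofReal_ne_top, ← ENNReal.ofReal_mul hL.le,
        ← ofReal_norm, ENNReal.ofReal_le_ofReal_iff (by positivity)] at h1
      exact h1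
  have hjet := isJet_mixedPartial hu hcl hf
  refine ⟨fun v => mixedPartial Ω v f, hjet,
    fun x hx => mixedPartial_zero hu (hf.of_le (by simp)) hx, ?_, hhol⟩
  intro v hv x hx
  have hp1 : 0 ≤ 2 * L / ρ := by positivity
  have hp2 : 0 ≤ L * (2 * R) ^ κ := by positivity
  rcases hv.lt_or_eq with hv | hv
  · have := hlow v hv x hx
    linarith
  · obtain ⟨i, hvi⟩ : ∃ i, v i ≠ 0 := by
      by_contra! h
      simp [h] at hv
      omega
    set v' := v - Pi.single i 1 with hv'
    have hvv : v' + Pi.single i 1 = v := by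
      ext k
      by_cases hk : k = i
      · subst hk
        simp only [hv', Pi.add_apply, Pi.sub_apply, Pi.single_eq_same]
        omega
      · simp [hv', hk]
    have hsum : ∑ k, v' k + 1 = q := by rw [← sum_add_single v' i, hvv, hv]
    have hmem : ∀ t ∈ Set.Icc (0 : ℝ) ρ, x₀ + t • EuclideanSpace.single i (1 : ℝ) ∈
        Metric.ball x₀ ε := by
      intro t ht
      rw [Metric.mem_ball, dist_eq_norm, add_sub_cancel_left, norm_smul, Real.norm_eq_abs,
        abs_of_nonneg ht.1]
      simp
      linarith [ht.2]
    have hder : ∀ t ∈ Set.Icc (0 : ℝ) ρ, HasDerivAt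
        (fun t : ℝ => mixedPartial Ω v' f (x₀ + t • EuclideanSpace.single i (1 : ℝ)))
        (mixedPartial Ω v f (x₀ + t • EuclideanSpace.single i (1 : ℝ))) t := by
      intro t ht
      have h1 := (hjet v' (by omega) _ (mem_of_mem_nhds (hball' _ (hmem t ht)))).hasFDerivAt
        (hball' _ (hmem t ht))
      have h2 : HasDerivAt (fun t : ℝ => x₀ + t • EuclideanSpace.single i (1 : ℝ))
          (EuclideanSpace.single i (1 : ℝ)) t := by
        simpa using ((hasDerivAt_id t).smul_const (EuclideanSpace.single i (1 : ℝ))).const_add x₀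
      have h3 := h1.comp_hasDerivAt t h2
      refine h3.congr_deriv ?_
      simp [hvv]
    obtain ⟨t, ht, hslope⟩ := exists_hasDerivAt_eq_slope _ _ hρ0
      (fun t ht => (hder t ht).continuousAt.continuousWithinAt)
      (fun t ht => hder t (Set.Ioo_subset_Icc_self ht))
    set y := x₀ + t • EuclideanSpace.single i (1 : ℝ) with hy
    have hmemΩ : ∀ t ∈ Set.Icc (0 : ℝ) ρ, x₀ + t • EuclideanSpace.single i (1 : ℝ) ∈ Ω :=
      fun t ht => mem_of_mem_nhds (hball' _ (hmem t ht))
    have hyΩ : y ∈ Ω := hmemΩ t (Set.Ioo_subset_Icc_self ht)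
    have hyb : |mixedPartial Ω v f y| ≤ 2 * L / ρ := by
      rw [hslope, abs_div, sub_zero, abs_of_pos hρ0]
      gcongr
      have h1 := hlow v' (by omega) _ (hmemΩ ρ ⟨hρ0.le, le_rfl⟩)
      have h2 := hlow v' (by omega) _ (hmemΩ 0 ⟨le_rfl, hρ0.le⟩)
      calc _ ≤ _ := abs_sub _ _
        _ ≤ 2 * L := by linarith
    have hxy : ‖x - y‖ ≤ 2 * R := by
      refine (norm_sub_le _ _).trans ?_
      linarith [hR x hx, hR y hyΩ]
    have h3 : L * ‖x - y‖ ^ κ ≤ L * (2 * R) ^ κ := by gcongr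
    have h4 := hhol v hv x hx y hyΩ
    have h5 := abs_sub_abs_le_abs_sub (mixedPartial Ω v f x) (mixedPartial Ω v f y)
    linarith

lemma norm_le_of_abs_le {x : E} {r : ℝ} (h : ∀ i, |x i| ≤ r) : ‖x‖ ≤ d * r := by
  have hx : x = ∑ i, x i • EuclideanSpace.single i (1 : ℝ) := by
    ext k
    simp [Finset.sum_apply, Pi.single_apply]
  rw [hx]
  refine (norm_sum_le _ _).trans ?_
  refine (Finset.sum_le_card_nsmul _ _ r fun i _ => ?_).trans (by simp)
  rw [norm_smul]
  simpa using h i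

/-- The arithmetic of the error bounds: a jet of size `L (d r) ^ (s - q)` in the top degree has size
`O(r ^ (s - n))` in degree `n`, if it vanishes at a point at distance at most `d r`. -/
lemma jet_bound_arith (hd : 1 ≤ d) {q n : ℕ} {s L r : ℝ} (hL : 0 ≤ L) (hr : 0 < r)
    (hsq : s ≤ q + 1) (hn : n ≤ q) :
    L * (d * r) ^ (s - (q : ℝ)) * (d * (d * r)) ^ (q - n) * r ^ n ≤
      L * (d : ℝ) ^ (2 * q + 1) * r ^ s := by
  have hd' : (1 : ℝ) ≤ d := by exact_mod_cast hd
  have h1 : ((d : ℝ) * r) ^ (s - (q : ℝ)) ≤ d * r ^ (s - (q : ℝ)) := by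
    rw [Real.mul_rpow (by positivity) hr.le]
    gcongr
    calc (d : ℝ) ^ (s - (q : ℝ)) ≤ (d : ℝ) ^ (1 : ℝ) :=
          Real.rpow_le_rpow_of_exponent_le hd' (by linarith)
      _ = d := Real.rpow_one _
  have h2 : ((d : ℝ) * (d * r)) ^ (q - n) ≤ (d : ℝ) ^ (2 * q) * r ^ (q - n) := by
    rw [← mul_assoc, mul_pow, ← sq, ← pow_mul]
    gcongr
    omega
  have h3 : r ^ s = r ^ (s - (q : ℝ)) * r ^ (q - n) * r ^ n := by
    rw [mul_assoc, ← pow_add, Nat.sub_add_cancel hn, ← Real.rpow_natCast r q,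
      ← Real.rpow_add hr, sub_add_cancel]
  calc _ ≤ L * (d * r ^ (s - (q : ℝ))) * ((d : ℝ) ^ (2 * q) * r ^ (q - n)) * r ^ n := by gcongr
    _ = _ := by rw [h3]; ring

/-- The approximation on one block of side `1 / g`, divided into cells of side `1 / (g m)`: one
polynomial `p` for the block, corrected in each cell `j` by `(1 / g) ^ s` times a polynomial with
bounded coefficients. -/
lemma exists_block_poly (hd : 1 ≤ d) {q : ℕ} {s L M : ℝ} (hL : 0 ≤ L) (hqs : (q : ℝ) ≤ s)
    (hsq : s ≤ q + 1) {Ω : Set E} (hΩ : Convex ℝ Ω) {F : (Fin d → ℕ) → E → ℝ}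
    (hF : IsJet q Ω F) (hM0 : 0 ≤ M) (hM : ∀ v, ∑ i, v i ≤ q → ∀ x ∈ Ω, |F v x| ≤ M)
    (hH : ∀ v, ∑ i, v i = q → ∀ x ∈ Ω, ∀ y ∈ Ω, |F v x - F v y| ≤ L * ‖x - y‖ ^ (s - (q : ℝ)))
    {g m : ℝ} (hg : 1 ≤ g) (hm : 0 < m) (h : Fin d → ℝ) :
    ∃ (p : (Fin q → Option (Fin d)) → ℝ) (ρ : (Fin d → ℕ) → (Fin q → Option (Fin d)) → ℝ),
      (∀ w, |p w| ≤ (q + 1) ^ d * M) ∧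
      (∀ j w, |ρ j w| ≤ (q + 1) ^ d * (L * (d : ℝ) ^ (2 * q + 1))) ∧
      ∀ j : Fin d → ℕ, ∀ x ∈ Ω, (∀ i, g * x i + h i ∈ Set.Icc (0 : ℝ) 1) →
        (∀ i, m * (g * x i + h i) ∈ Set.Icc (j i : ℝ) (j i + 1)) →
        |F 0 x - ∑ w, (p w + g⁻¹ ^ s * ρ j w) * wordProd (fun i => g * x i + h i) w| ≤
          L * (d : ℝ) ^ (2 * q + 1) * (g⁻¹ / m) ^ s := by
  classical
  have hg0 : 0 < g := by linarith
  have hD0 : 0 < g⁻¹ := by positivity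
  have hD1 : g⁻¹ ≤ 1 := inv_le_one_of_one_le₀ hg
  set D := g⁻¹ with hD
  have hgD : ∀ y : ℝ, D * (g * y) = y := fun y => by rw [hD]; field_simp
  -- A block that does not meet `Ω` needs no approximation.
  by_cases hne : ∃ z ∈ Ω, ∀ i, g * z i + h i ∈ Set.Icc (0 : ℝ) 1
  swap
  · refine ⟨0, 0, fun w => by simpa using by positivity, fun j w => by simpa using by positivity,
      fun j x hx hx1 => absurd ⟨x, hx, hx1⟩ hne⟩
  obtain ⟨z, hz, hzt⟩ := hne
  have hdist : ∀ {x y : E} {r : ℝ}, (∀ i, |(g * x i + h i) - (g * y i + h i)| ≤ r) →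
      ‖x - y‖ ≤ d * (D * r) := by
    intro x y r hxy
    refine norm_le_of_abs_le fun i => ?_
    have e : (x - y) i = D * ((g * x i + h i) - (g * y i + h i)) := by
      rw [show (g * x i + h i) - (g * y i + h i) = g * (x i - y i) by ring, hgD]
      simp
    rw [e, abs_mul, abs_of_pos hD0]
    gcongr
    exact hxy i
  have hunit : ∀ {a b : ℝ}, a ∈ Set.Icc (0 : ℝ) 1 → b ∈ Set.Icc (0 : ℝ) 1 → |a - b| ≤ 1 := by
    intro a b ha hb
    exact abs_sub_le_iff.2 ⟨by linarith [ha.2, hb.1], by linarith [hb.2, ha.1]⟩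
  -- A Taylor polynomial at a point of the block, in word form.
  have hword : ∀ (c : (Fin d → ℕ) → ℝ) (y : E) (C : ℝ), (∀ i, g * y i + h i ∈ Set.Icc (0 : ℝ) 1) →
      (∀ u, ∑ i, u i ≤ q → |c u| * D ^ (∑ i, u i) ≤ C) →
      ∃ a : (Fin q → Option (Fin d)) → ℝ, (∀ w, |a w| ≤ (q + 1) ^ d * C) ∧
        ∀ x : E, taylorJet q c y 0 x = ∑ w, a w * wordProd (fun i => g * x i + h i) w := by
    intro c y C hy hc
    obtain ⟨a, ha, e⟩ := IsWordPoly.taylor hD0.le hc (e := fun i => -(g * y i + h i)) fun i => by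
      rw [abs_neg, abs_of_nonneg (hy i).1]
      exact (hy i).2
    refine ⟨a, ha, fun x => ?_⟩
    rw [← e, taylorJet]
    refine Finset.sum_congr rfl fun u _ => ?_
    congr 2
    funext i
    rw [show g * x i + h i + -(g * y i + h i) = g * (x i - y i) by ring, hgD]
  obtain ⟨p, hp, hpe⟩ := hword (fun u => F u z) z M hzt fun u hu => by
    have h1 : D ^ (∑ i, u i) ≤ 1 := pow_le_one₀ hD0.le hD1
    calc |F u z| * D ^ (∑ i, u i) ≤ |F u z| * 1 := by gcongr
      _ ≤ M := by rw [mul_one]; exact hM u hu z hz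
  set P := taylorJet q (fun u => F u z) z with hP
  set G : (Fin d → ℕ) → E → ℝ := fun v x => F v x - P v x with hGdef
  have hG : IsJet q Ω G := hF.sub (isJet_taylorJet _ _ _ _)
  have hGz : ∀ v, ∑ i, v i < q → G v z = 0 := fun v hv => by
    simp only [hGdef, hP]
    rw [taylorJet_center _ _ _ hv.le, sub_self]
  have hGtop : ∀ v, ∑ i, v i = q → ∀ x ∈ Ω, ∀ y ∈ Ω,
      |G v x - G v y| ≤ L * ‖x - y‖ ^ (s - (q : ℝ)) := fun v hv x hx y hy => by
    simp only [hGdef, hP]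
    rw [taylorJet_top _ _ _ hv, taylorJet_top _ _ _ hv, sub_sub_sub_cancel_right]
    exact hH v hv x hx y hy
  have hκ : 0 ≤ s - (q : ℝ) := by linarith
  have hcell : ∀ j : Fin d → ℕ, ∃ a : (Fin q → Option (Fin d)) → ℝ,
      (∀ w, |a w| ≤ (q + 1) ^ d * (L * (d : ℝ) ^ (2 * q + 1) * D ^ s)) ∧
      ∀ x ∈ Ω, (∀ i, g * x i + h i ∈ Set.Icc (0 : ℝ) 1) →
        (∀ i, m * (g * x i + h i) ∈ Set.Icc (j i : ℝ) (j i + 1)) →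
        |G 0 x - ∑ w, a w * wordProd (fun i => g * x i + h i) w| ≤
          L * (d : ℝ) ^ (2 * q + 1) * (D / m) ^ s := by
    intro j
    -- The cells that do not meet `Ω` are treated in the same way.
    by_cases hne : ∃ y ∈ Ω, (∀ i, g * y i + h i ∈ Set.Icc (0 : ℝ) 1) ∧
        (∀ i, m * (g * y i + h i) ∈ Set.Icc (j i : ℝ) (j i + 1))
    swap
    · exact ⟨0, fun w => by simpa using by positivity,
        fun x hx hx1 hx2 => absurd ⟨x, hx, hx1, hx2⟩ hne⟩
    obtain ⟨y, hy, hyt, hyj⟩ := hne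
    obtain ⟨a, ha, hae⟩ := hword (fun u => G u y) y (L * (d : ℝ) ^ (2 * q + 1) * D ^ s) hyt
      fun u hu => by
        have hyz : ‖y - z‖ ≤ d * D := by
          simpa using hdist (r := 1) fun i => hunit (hyt i) (hzt i)
        have h1 := hG.abs_le hΩ hz hGz (ρ := d * D) (K := L * (d * D) ^ (s - (q : ℝ)))
          (by positivity) (fun v hv x hx hxz => by
            have h2 := hGtop v hv x hx z hz
            have h3 : G v z = 0 := by
              simp only [hGdef, hP]
              rw [taylorJet_center _ _ _ hv.le, sub_self]
            rw [h3, sub_zero] at h2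
            exact h2.trans (by gcongr)) (q - ∑ i, u i) (v := u) (by omega) hy hyz
        calc |G u y| * D ^ (∑ i, u i)
            ≤ L * (d * D) ^ (s - (q : ℝ)) * (d * (d * D)) ^ (q - ∑ i, u i) * D ^ (∑ i, u i) := by
              gcongr
          _ ≤ _ := jet_bound_arith hd hL hD0 hsq hu
    refine ⟨a, ha, fun x hx hxt hxj => ?_⟩
    rw [← hae]
    have hDm : 0 < D / m := by positivity
    have hQ := hG.sub (isJet_taylorJet q (fun u => G u y) y Ω)
    have hxy : ‖x - y‖ ≤ d * (D / m) := by
      have := hdist (x := x) (y := y) (r := 1 / m) fun i => by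
        have e : (g * x i + h i) - (g * y i + h i) =
            (m * (g * x i + h i) - m * (g * y i + h i)) / m := by field_simp
        rw [e, abs_div, abs_of_pos hm]
        gcongr
        exact abs_sub_le_iff.2 ⟨by linarith [(hxj i).2, (hyj i).1],
          by linarith [(hyj i).2, (hxj i).1]⟩
      simpa [div_eq_mul_inv] using this
    have h1 := hQ.abs_le hΩ hy (fun v hv => by
      rw [taylorJet_center _ _ _ hv.le, sub_self]) (ρ := d * (D / m))
      (K := L * (d * (D / m)) ^ (s - (q : ℝ))) (by positivity) (fun v hv x hx hxy => by
        rw [taylorJet_top _ _ _ hv]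
        exact (hGtop v hv x hx y hy).trans (by gcongr)) q (v := 0) (by simp) hx hxy
    refine h1.trans ?_
    have := jet_bound_arith (n := 0) hd hL hDm hsq (Nat.zero_le _)
    simpa using this
  choose a ha hae using hcell
  have hDs : 0 < D ^ s := Real.rpow_pos_of_pos hD0 s
  refine ⟨p, fun j w => a j w / D ^ s, hp, fun j w => ?_, fun j x hx hxt hxj => ?_⟩
  · rw [abs_div, abs_of_pos hDs, div_le_iff₀ hDs]
    exact (ha j w).trans (le_of_eq (by ring))
  · have h1 := hae j x hx hxt hxj
    have e : F 0 x - ∑ w, (p w + D ^ s * (a j w / D ^ s)) * wordProd (fun i => g * x i + h i) w =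
        G 0 x - ∑ w, a j w * wordProd (fun i => g * x i + h i) w := by
      simp only [hGdef, hpe, mul_div_cancel₀ _ hDs.ne', add_mul, Finset.sum_add_distrib]
      ring
    rw [e]
    exact h1

end Holder

/-! ### The partition of unity -/

lemma tri_sub_natCast (y : ℝ) (n : ℕ) : tri (y - n) = tri y := by
  rw [tri, tri, Int.fract_sub_natCast]

/-- A triangle wave only takes a nonzero value at a cut off argument if nothing was cut off. -/
lemma clip_of_tri_ne_zero {m : ℕ} {t : ℝ} (h : tri (m * clip t) ≠ 0) :
    0 < t ∧ t < 1 ∧ clip t = t := by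
  have h0 : 0 < t := by
    by_contra! h'
    rw [clip_of_nonpos h', mul_zero] at h
    exact h (by simpa using tri_natCast 0)
  have h1 : t < 1 := by
    by_contra! h'
    rw [clip_of_one_le h', mul_one, tri_natCast] at h
    exact h rfl
  exact ⟨h0, h1, clip_of_mem h0.le h1.le⟩

/-- The pieces of a triangle wave of frequency `m` on the unit intervals in `[0, n]` add up. -/
lemma sum_tri_clip (m n : ℕ) {y : ℝ} (h0 : 0 ≤ y) (h1 : y < n) :
    ∑ k : Fin n, tri (m * clip (y - (k : ℕ))) = tri (m * y) := by
  have hfl : ⌊y⌋₊ < n := (Nat.floor_lt h0).2 h1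
  have hle := Nat.floor_le h0
  rw [Finset.sum_eq_single (⟨⌊y⌋₊, hfl⟩ : Fin n)]
  · rw [clip_of_mem (by simpa using hle) (by linarith [Nat.lt_floor_add_one y]), mul_sub,
      ← Nat.cast_mul, tri_sub_natCast]
  · intro k _ hk
    by_contra h
    obtain ⟨h2, h3, -⟩ := clip_of_tri_ne_zero h
    refine hk (Fin.ext ?_)
    exact ((Nat.floor_eq_iff h0).2 ⟨by linarith, by linarith⟩).symm
  · simp

/-- The offset of the local coordinates of the block `b`: its first component numbers the blocks of
one grid, and the second one says whether that grid is shifted by half a cell. -/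
noncomputable def blockOffset {n : ℕ} (m : ℕ) (c : ℝ) (b : Fin (n + 1) × Bool) : ℝ :=
  c + (if b.2 then 1 / (2 * (m : ℝ)) else 0) - (b.1 : ℕ)

/-- The products of triangle waves that belong to the blocks form a partition of unity. -/
lemma sum_prod_tri {d n m : ℕ} (hm : 1 ≤ m) {g c : ℝ} {x : Fin d → ℝ}
    (hx : ∀ i, g * x i + c ∈ Set.Icc (0 : ℝ) n) :
    ∑ b : Fin d → Fin (n + 1) × Bool,
      ∏ i, tri (m * localCoord g (fun i => blockOffset m c (b i)) x i) = 1 := by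
  have hm' : (1 : ℝ) ≤ m := by exact_mod_cast hm
  have h2 : 1 / (2 * (m : ℝ)) < 1 := by
    rw [div_lt_one (by positivity)]
    linarith
  have h2' : 0 < 1 / (2 * (m : ℝ)) := by positivity
  have key : ∀ i, ∑ b : Fin (n + 1) × Bool, tri (m * clip (g * x i + blockOffset m c b)) = 1 := by
    intro i
    have e : ∀ κ : Bool, ∑ k : Fin (n + 1), tri (m * clip (g * x i + blockOffset m c (k, κ))) =
        tri (m * (g * x i + c + if κ then 1 / (2 * (m : ℝ)) else 0)) := by
      intro κ
      have h3 : (0 : ℝ) ≤ (if κ then 1 / (2 * (m : ℝ)) else 0) ∧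
          (if κ then 1 / (2 * (m : ℝ)) else 0) < 1 := by
        split_ifs
        · exact ⟨h2'.le, h2⟩
        · norm_num
      rw [← sum_tri_clip m (n + 1) (add_nonneg (hx i).1 h3.1)
        (by push_cast; linarith [(hx i).2, h3.2])]
      refine Finset.sum_congr rfl fun k _ => ?_
      simp only [blockOffset]
      congr 3
      ring
    rw [Fintype.sum_prod_type_right]
    simp only [e, Fintype.sum_bool, if_true, Bool.false_eq_true, if_false, add_zero]
    rw [mul_add, show (m : ℝ) * (1 / (2 * m)) = 1 / 2 by field_simp, add_comm]
    exact tri_add_tri _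
  have := Finset.prod_univ_sum (fun _ : Fin d => (Finset.univ : Finset (Fin (n + 1) × Bool)))
    (fun i b => tri (m * clip (g * x i + blockOffset m c b)))
  rw [Fintype.piFinset_univ] at this
  simp only [localCoord]
  rw [← this]
  simp [key]

/-- At most `2 ^ d` blocks are active at a point. -/
lemma card_active_le {d n m : ℕ} {g c : ℝ} {x : Fin d → ℝ} :
    (Finset.univ.filter fun b : Fin d → Fin (n + 1) × Bool =>
      ∀ i, tri (m * localCoord g (fun i => blockOffset m c (b i)) x i) ≠ 0).card ≤ 2 ^ d := by
  classical
  refine (Finset.card_le_card_of_injOn (t := (Finset.univ : Finset (Fin d → Bool)))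
    (fun b i => (b i).2) (fun b _ => Finset.mem_coe.2 (Finset.mem_univ _)) ?_).trans (by simp)
  intro b hb b' hb' h
  simp only [Finset.coe_filter, Finset.mem_univ, true_and, Set.mem_ofPred_eq] at hb hb'
  funext i
  have hκ : (b i).2 = (b' i).2 := congrFun h i
  obtain ⟨h1, h2, -⟩ := clip_of_tri_ne_zero (hb i)
  obtain ⟨h3, h4, -⟩ := clip_of_tri_ne_zero (hb' i)
  simp only [blockOffset] at h1 h2 h3 h4
  rw [← hκ] at h3 h4
  refine Prod.ext (Fin.ext ?_) hκ
  have h5 : (((b i).1 : ℕ) : ℝ) < ((b' i).1 : ℕ) + 1 := by linarith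
  have h6 : (((b' i).1 : ℕ) : ℝ) < ((b i).1 : ℕ) + 1 := by linarith
  have h5' : ((b i).1 : ℕ) < ((b' i).1 : ℕ) + 1 := by exact_mod_cast h5
  have h6' : ((b' i).1 : ℕ) < ((b i).1 : ℕ) + 1 := by exact_mod_cast h6
  omega

/-! ### The network as a sum over the blocks -/

lemma Hid.nonneg {d w S h : ℕ} {B : ℝ} {v : Fin w → (Fin d → ℝ) → ℝ} (hv : Hid d B w S h v)
    (i : Fin w) (x : Fin d → ℝ) : 0 ≤ v i x := by
  cases hv <;> exact le_max_right _ _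

lemma St.nonneg {d w h : ℕ} {B : ℝ} {L : List ((Fin d → ℝ) → ℝ)} (hL : St d B w h L) :
    ∀ g ∈ L, ∀ x, 0 ≤ g x := by
  obtain ⟨v, S, -, hv, e⟩ := hL
  intro g hg x
  obtain ⟨j, rfl⟩ := e g hg
  exact hv.nonneg j x

section Block

variable {d : ℕ}

local notation "E" => EuclideanSpace ℝ (Fin d)

/-- The depth of the subnetworks: `k` binary digits in each of two groups, tables with entries of
`l` bits, and a tree of `r` levels of multiplications of precision `4 ^ (-m)`. -/
def blockDepth (d k l m r : ℕ) : ℕ :=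
  6 * k + 3 * (2 ^ k) ^ d + 4 * ((2 ^ k) ^ d * l) + 10 + r * (2 * m + 4)

/-- The approximation of `F 0` times one member of the partition of unity. The accuracy of the
table lookup is `2 ^ (-l)` except close to the left walls of the cells, where the triangle waves
are at most `2 θ`. -/
lemma exists_block (hd : 1 ≤ d) {q : ℕ} {s L M : ℝ} (hL : 0 < L) (hqs : (q : ℝ) ≤ s)
    (hsq : s ≤ q + 1) {Ω : Set E} (hΩ : Convex ℝ Ω) {F : (Fin d → ℕ) → E → ℝ}
    (hF : IsJet q Ω F) (hM0 : 0 ≤ M) (hM : ∀ v, ∑ i, v i ≤ q → ∀ x ∈ Ω, |F v x| ≤ M)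
    (hH : ∀ v, ∑ i, v i = q → ∀ x ∈ Ω, ∀ y ∈ Ω, |F v x - F v y| ≤ L * ‖x - y‖ ^ (s - (q : ℝ)))
    {B : ℝ} (hB : 10 ≤ B) {σ θ : ℝ} (hσ : 0 ≤ σ) (hσB : 2 * σ + 1 ≤ B)
    {g : ℝ} {h : Fin d → ℝ} (hg1 : 1 ≤ g) (hg : |g| ≤ B) (hh : ∀ i, |1 - h i| ≤ B)
    {k l m r H : ℕ} (hσθ : 2 ^ (2 * k) ≤ σ * θ) (hn : (d * (2 ^ k) ^ d + 1 : ℝ) ≤ B)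
    (hr : d + q + 1 ≤ 2 ^ r) (hdepth : blockDepth d k l m r ≤ H) {K C : ℝ}
    (hK : K = (q + 1) ^ d * (L * (d : ℝ) ^ (2 * q + 1))) (hC : C = (q + 1) ^ d * M + K)
    (hCB : 2 * C ≤ B) :
    ∃ f : (Fin d → ℝ) → ℝ,
      Out d B ((d + 1) ^ q * (2 * (2 ^ r * (6 * d))))
        ((d + 1) ^ q * (2 * (H * layerSize d (2 ^ r * (6 * d))))) H f ∧
      (∀ x, (∃ i, tri (((2 ^ (2 * k) : ℕ) : ℝ) * localCoord g h x i) = 0) → f x = 0) ∧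
      ∀ x ∈ Ω, (∀ i, tri (((2 ^ (2 * k) : ℕ) : ℝ) * localCoord g h (fun i => x i) i) ≠ 0) →
        |(∏ i, tri (((2 ^ (2 * k) : ℕ) : ℝ) * localCoord g h (fun i => x i) i)) * F 0 x -
            f (fun i => x i)| ≤
          L * (d : ℝ) ^ (2 * q + 1) * (g⁻¹ / 2 ^ (2 * k)) ^ s +
          (d + 1) ^ q * (4 * C * (2 ^ r / 4 ^ m) + 2 * K * g⁻¹ ^ s * (1 / 2 ^ l + 2 * θ)) := by
  classical
  push_cast
  have hB0 : 0 ≤ B := by linarith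
  have hd' : (1 : ℝ) ≤ d := by exact_mod_cast hd
  have hK0 : 0 < K := by rw [hK]; positivity
  have hC0 : 0 < C := by
    have : 0 ≤ ((q : ℝ) + 1) ^ d * M := by positivity
    linarith
  have hg0 : 0 < g := by linarith
  have hs0 : 0 ≤ s := (Nat.cast_nonneg q).trans hqs
  obtain ⟨p, ρ, hp, hρ, happ⟩ := exists_block_poly hd hL.le hqs hsq hΩ hF hM0 hM hH hg1
    (m := 2 ^ (2 * k)) (by positivity) h
  rw [← hK] at hρ
  set η := g⁻¹ ^ s with hη
  have hη0 : 0 ≤ η := by positivity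
  have hη1 : η ≤ 1 := Real.rpow_le_one (by positivity) (inv_le_one_of_one_le₀ hg1) hs0
  have hρ' : ∀ w j, (ρ j w + K) / (2 * K) ∈ Set.Icc (0 : ℝ) 1 := fun w j => by
    have := abs_le.1 (hρ j w)
    exact ⟨div_nonneg (by linarith) (by positivity), (div_le_one (by positivity)).2 (by linarith)⟩
  choose z hz hz1 hz2 using fun w =>
    St.exists_cell_lookup hd hB hσ hσB hg hh k l hσθ hn (hρ' w)
  have hp' : ∀ w, -(C - K) ≤ p w ∧ p w ≤ C - K := fun w => by
    have := abs_le.1 (hp w)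
    rw [hC, add_sub_cancel_right]
    exact this
  have hηK : η * K ≤ K := mul_le_of_le_one_left hK0.le hη1
  have hηK0 : 0 ≤ η * K := by positivity
  -- The coefficients may be negative, and the factors of a product have to lie in `[0, 1]`: the
  -- coefficient `c` is written as `2 C ((c + C) / (2 C)) - 2 C (1 / 2)`, with one subnetwork for
  -- each of the two terms.
  choose P hP hP0 hP1 using fun w => St.exists_term hd hB hg hh k m r q hr (by omega) (hz w) (hz1 w)
    (base := (p w + C - η * K) / (2 * C)) (scale := η * K / C)
    (div_nonneg (by linarith [(hp' w).1]) (by positivity)) (by positivity)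
    (by
      rw [show η * K / C = 2 * (η * K) / (2 * C) by field_simp, ← add_div,
        div_le_one (by positivity)]
      linarith [(hp' w).2]) w
  choose P' hP' hP0' hP1' using fun w => St.exists_term hd hB hg hh k m r q hr (by omega) (hz w)
    (hz1 w) (base := 1 / 2) (scale := 0) (by norm_num) le_rfl (by norm_num) w
  have hpad : ∀ {f : (Fin d → ℝ) → ℝ} {c : ℝ}, |c| ≤ B →
      St d B (2 ^ r * (6 * d)) (6 * k + 3 * (2 ^ k) ^ d + 4 * ((2 ^ k) ^ d * l) + 9 + 1 +
        r * (2 * m + 4)) [f] →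
      Out d B (2 ^ r * (6 * d)) (H * layerSize d (2 ^ r * (6 * d))) H (fun x => c * f x) := by
    intro f c hc hf
    refine St.out (hf.pad (by linarith) ?_ hf.nonneg hdepth) hB0 hc
    have := Nat.one_le_two_pow (n := r)
    simp only [List.length_singleton]
    nlinarith
  have hH1 : 1 ≤ H := by
    simp only [blockDepth] at hdepth
    omega
  have hcard : (Finset.univ : Finset (Fin q → Option (Fin d))).card = (d + 1) ^ q := by simp
  refine ⟨fun x => ∑ w, (2 * C * P w x + -(2 * C) * P' w x), ?_, fun x hx => ?_, fun x hx hact => ?_⟩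
  · have := Out.sum hB0 hH1 (Finset.univ : Finset (Fin q → Option (Fin d))) fun w _ =>
      (hpad (c := 2 * C) (by rwa [abs_of_pos (by positivity)]) (hP w)).add hB0
        (hpad (c := -(2 * C)) (by rwa [abs_neg, abs_of_pos (by positivity)]) (hP' w))
    rw [hcard] at this
    simpa only [two_mul] using this
  · exact Finset.sum_eq_zero fun w _ => by simp [hP0 w x hx, hP0' w x hx]
  · set V := localCoord g h (fun i => x i) with hV
    set Φ := ∏ i, tri (2 ^ (2 * k) * V i) with hΦ
    have hΦ0 : 0 ≤ Φ := Finset.prod_nonneg fun i _ => (tri_mem _).1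
    have hΦ1 : Φ ≤ 1 := Finset.prod_le_one (fun i _ => (tri_mem _).1) fun i _ => (tri_mem _).2
    have hV1 : ∀ i, 0 < g * x i + h i ∧ g * x i + h i < 1 ∧ V i = g * x i + h i := fun i =>
      clip_of_tri_ne_zero (m := 2 ^ (2 * k)) (by push_cast; exact hact i)
    have hVe : V = fun i => g * x i + h i := funext fun i => (hV1 i).2.2
    have hVI : ∀ i, V i ∈ Set.Icc (0 : ℝ) 1 := localCoord_mem _ _ _
    have hm0 : (0 : ℝ) < 2 ^ (2 * k) := by positivity
    have hy0 : ∀ i, 0 ≤ 2 ^ (2 * k) * V i := fun i => mul_nonneg hm0.le (hVI i).1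
    set j : Fin d → ℕ := fun i => ⌊2 ^ (2 * k) * V i⌋₊ with hj
    have hj1 : ∀ i, (j i : ℝ) ≤ 2 ^ (2 * k) * V i := fun i => Nat.floor_le (hy0 i)
    have hj2 : ∀ i, 2 ^ (2 * k) * V i < j i + 1 := fun i => Nat.lt_floor_add_one _
    have hfr : ∀ i, Int.fract (2 ^ (2 * k) * V i) = 2 ^ (2 * k) * V i - j i := fun i => by
      rw [Int.fract, hj, natCast_floor_eq_intCast_floor (hy0 i)]
    have hpoly := happ j x hx (fun i => ⟨(hV1 i).1.le, (hV1 i).2.1.le⟩) (fun i => by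
      rw [← (hV1 i).2.2]
      exact ⟨hj1 i, (hj2 i).le⟩)
    rw [← hVe] at hpoly
    have hwp := fun w : Fin q → Option (Fin d) => wordProd_mem hVI w
    have hlook : ∀ w, Φ * |z w (fun i => x i) - (ρ j w + K) / (2 * K)| ≤ 1 / 2 ^ l + 2 * θ := by
      intro w
      have hθ : 0 ≤ θ := by
        by_contra! hθ
        have : σ * θ ≤ 0 := mul_nonpos_of_nonneg_of_nonpos hσ hθ.le
        linarith
      have hl : (0 : ℝ) ≤ 1 / 2 ^ l := by positivity
      by_cases hgood : ∀ i, θ ≤ Int.fract (2 ^ (2 * k) * V i)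
      · have h1 := hz2 w (fun i => x i) j (fun i => Int.fract (2 ^ (2 * k) * V i)) fun i => by
          refine ⟨?_, hgood i, Int.fract_nonneg _, Int.fract_lt_one _, ?_⟩
          · have h2 : (j i : ℝ) < 2 ^ (2 * k) := by
              refine (hj1 i).trans_lt (mul_lt_of_lt_one_right hm0 ?_)
              rw [(hV1 i).2.2]
              exact (hV1 i).2.1
            exact_mod_cast h2
          · rw [hfr, ← hV]
            field_simp
            ring
        have h2 := mul_le_of_le_one_left (abs_nonneg (z w (fun i => x i) - (ρ j w + K) / (2 * K))) hΦ1
        linarith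
      -- Close to a wall of a cell the lookup may return anything in `[0, 1]`.
      · push Not at hgood
        obtain ⟨i, hi⟩ := hgood
        have h1 : Φ ≤ 2 * θ := by
          rw [hΦ, ← Finset.mul_prod_erase _ _ (Finset.mem_univ i)]
          have h2 : ∏ i ∈ Finset.univ.erase i, tri (2 ^ (2 * k) * V i) ≤ 1 :=
            Finset.prod_le_one (fun i _ => (tri_mem _).1) fun i _ => (tri_mem _).2
          have h3 := mul_le_of_le_one_right (tri_mem (2 ^ (2 * k) * V i)).1 h2
          linarith [tri_le (2 ^ (2 * k) * V i)]
        have h2 : |z w (fun i => x i) - (ρ j w + K) / (2 * K)| ≤ 1 := by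
          have a1 := hz1 w (fun i => x i)
          have a2 := hρ' w j
          exact abs_sub_le_iff.2 ⟨by linarith [a1.2, a2.1], by linarith [a2.2, a1.1]⟩
        have h3 := mul_le_of_le_one_right hΦ0 h2
        linarith
    have hterm : ∀ w, |Φ * ((p w + η * ρ j w) * wordProd V w) -
        (2 * C * P w (fun i => x i) + -(2 * C) * P' w (fun i => x i))| ≤
        4 * C * (2 ^ r / 4 ^ m) + 2 * K * η * (1 / 2 ^ l + 2 * θ) := by
      intro w
      have h1 := hP1 w (fun i => x i)
      have h2 := hP1' w (fun i => x i)
      rw [← hV, ← hΦ] at h1 h2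
      set A := Φ * wordProd V w * ((p w + C - η * K) / (2 * C) + η * K / C * z w (fun i => x i))
      set A' := Φ * wordProd V w * (1 / 2 + 0 * z w (fun i => x i))
      set Δ := z w (fun i => x i) - (ρ j w + K) / (2 * K) with hΔ
      have e : Φ * ((p w + η * ρ j w) * wordProd V w) -
          (2 * C * P w (fun i => x i) + -(2 * C) * P' w (fun i => x i)) =
          2 * C * (P' w (fun i => x i) - A') - 2 * C * (P w (fun i => x i) - A) -
            2 * K * η * wordProd V w * (Φ * Δ) := by
        simp only [A, A', hΔ]
        field_simp
        ring
      rw [e]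
      have h3 : |2 * K * η * wordProd V w * (Φ * Δ)| ≤ 2 * K * η * (1 / 2 ^ l + 2 * θ) := by
        rw [abs_mul, abs_mul Φ, abs_of_nonneg hΦ0,
          abs_of_nonneg (mul_nonneg (by positivity) (hwp w).1)]
        refine mul_le_mul (mul_le_of_le_one_right (by positivity) (hwp w).2) (hlook w)
          (by positivity) (by positivity)
      have h4 : ∀ {t : ℝ}, |t| ≤ 2 ^ r / 4 ^ m → |2 * C * t| ≤ 2 * C * (2 ^ r / 4 ^ m) := by
        intro t ht
        rw [abs_mul, abs_of_pos (by positivity : 0 < 2 * C)]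
        gcongr
      calc _ ≤ |2 * C * (P' w (fun i => x i) - A')| + |2 * C * (P w (fun i => x i) - A)| +
            |2 * K * η * wordProd V w * (Φ * Δ)| :=
            (abs_sub _ _).trans (add_le_add_left (abs_sub _ _) _)
        _ ≤ 2 * C * (2 ^ r / 4 ^ m) + 2 * C * (2 ^ r / 4 ^ m) +
            2 * K * η * (1 / 2 ^ l + 2 * θ) := add_le_add (add_le_add (h4 h2) (h4 h1)) h3
        _ = _ := by ring
    have e : Φ * F 0 x - ∑ w, (2 * C * P w (fun i => x i) + -(2 * C) * P' w (fun i => x i)) =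
        Φ * (F 0 x - ∑ w, (p w + η * ρ j w) * wordProd V w) +
        ∑ w, (Φ * ((p w + η * ρ j w) * wordProd V w) -
          (2 * C * P w (fun i => x i) + -(2 * C) * P' w (fun i => x i))) := by
      rw [Finset.sum_sub_distrib, ← Finset.mul_sum]
      ring
    rw [e]
    refine (abs_add_le _ _).trans (add_le_add ?_ ?_)
    · rw [abs_mul, abs_of_nonneg hΦ0]
      exact (mul_le_of_le_one_left (abs_nonneg _) hΦ1).trans hpoly
    · refine (Finset.abs_sum_le_sum_abs _ _).trans ?_
      refine (Finset.sum_le_card_nsmul _ _ _ fun w _ => hterm w).trans (le_of_eq ?_)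
      rw [hcard, nsmul_eq_mul]
      push_cast
      rfl

/-- The network for a jet on a bounded convex set. -/
lemma exists_out (hd : 1 ≤ d) {q : ℕ} {s L M : ℝ} (hL : 0 < L) (hqs : (q : ℝ) ≤ s)
    (hsq : s ≤ q + 1) {Ω : Set E} (hΩ : Convex ℝ Ω) {F : (Fin d → ℕ) → E → ℝ}
    (hF : IsJet q Ω F) (hM0 : 0 ≤ M) (hM : ∀ v, ∑ i, v i ≤ q → ∀ x ∈ Ω, |F v x| ≤ M)
    (hH : ∀ v, ∑ i, v i = q → ∀ x ∈ Ω, ∀ y ∈ Ω, |F v x - F v y| ≤ L * ‖x - y‖ ^ (s - (q : ℝ)))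
    {B : ℝ} (hB : 10 ≤ B) {σ θ : ℝ} (hσ : 0 ≤ σ) (hσB : 2 * σ + 1 ≤ B)
    {R : ℝ} (hR : 1 ≤ R) (hΩR : ∀ x ∈ Ω, ‖x‖ ≤ R) {n : ℕ} (hnR : 2 * R ≤ n) (hnB : (n : ℝ) + 1 ≤ B)
    {k l m r H : ℕ} (hσθ : 2 ^ (2 * k) ≤ σ * θ) (hn : (d * (2 ^ k) ^ d + 1 : ℝ) ≤ B)
    (hr : d + q + 1 ≤ 2 ^ r) (hdepth : blockDepth d k l m r ≤ H) {K C : ℝ}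
    (hK : K = (q + 1) ^ d * (L * (d : ℝ) ^ (2 * q + 1))) (hC : C = (q + 1) ^ d * M + K)
    (hCB : 2 * C ≤ B) :
    ∃ f : (Fin d → ℝ) → ℝ,
      Out d B ((2 * (n + 1)) ^ d * ((d + 1) ^ q * (2 * (2 ^ r * (6 * d)))))
        ((2 * (n + 1)) ^ d * ((d + 1) ^ q * (2 * (H * layerSize d (2 ^ r * (6 * d)))))) H f ∧
      ∀ x ∈ Ω, |F 0 x - f (fun i => x i)| ≤ 2 ^ d *
          (L * (d : ℝ) ^ (2 * q + 1) * (2 * R / n / 2 ^ (2 * k)) ^ s +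
          (d + 1) ^ q * (4 * C * (2 ^ r / 4 ^ m) +
            2 * K * (2 * R / n) ^ s * (1 / 2 ^ l + 2 * θ))) := by
  classical
  have hn0 : (0 : ℝ) < n := by linarith
  have hg1 : 1 ≤ (n : ℝ) / (2 * R) := by rwa [one_le_div (by positivity)]
  have hgn : (n : ℝ) / (2 * R) ≤ n := div_le_self hn0.le (by linarith)
  have hginv : ((n : ℝ) / (2 * R))⁻¹ = 2 * R / n := inv_div _ _
  set g := (n : ℝ) / (2 * R) with hg
  have hB0 : 0 ≤ B := by linarith
  have hoff : ∀ b : Fin (n + 1) × Bool, |1 - blockOffset (2 ^ (2 * k)) ((n : ℝ) / 2) b| ≤ B := by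
    intro b
    have h1 : ((b.1 : ℕ) : ℝ) ≤ n := by exact_mod_cast Nat.lt_succ_iff.1 b.1.2
    have h2 : (0 : ℝ) ≤ (b.1 : ℕ) := Nat.cast_nonneg _
    have h3 : (0 : ℝ) ≤ (if b.2 then 1 / (2 * ((2 ^ (2 * k) : ℕ) : ℝ)) else 0) ∧
        (if b.2 then 1 / (2 * ((2 ^ (2 * k) : ℕ) : ℝ)) else 0) ≤ 1 := by
      have h4 : (1 : ℝ) ≤ ((2 ^ (2 * k) : ℕ) : ℝ) := by exact_mod_cast Nat.one_le_two_pow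
      split_ifs
      · exact ⟨by positivity, (div_le_one (by positivity)).2 (by linarith)⟩
      · norm_num
    rw [blockOffset]
    exact abs_le.2 ⟨by linarith [h3.2], by linarith [h3.1]⟩
  choose f hf1 hf2 hf3 using fun b : Fin d → Fin (n + 1) × Bool =>
    exists_block hd hL hqs hsq hΩ hF hM0 hM hH hB hσ hσB
      (h := fun i => blockOffset (2 ^ (2 * k)) ((n : ℝ) / 2) (b i)) hg1
      (by rw [abs_of_pos (by linarith)]; linarith) (fun i => hoff (b i)) (l := l) hσθ hn hr hdepth
      hK hC hCB
  rw [hginv] at hf3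
  have hH1 : 1 ≤ H := by
    simp only [blockDepth] at hdepth
    omega
  have hcard : (Finset.univ : Finset (Fin d → Fin (n + 1) × Bool)).card = (2 * (n + 1)) ^ d := by
    simp [mul_comm]
  refine ⟨fun x => ∑ b, f b x, ?_, fun x hx => ?_⟩
  · have := Out.sum hB0 hH1 (Finset.univ : Finset (Fin d → Fin (n + 1) × Bool)) fun b _ => hf1 b
    rwa [hcard] at this
  · have hpou := sum_prod_tri (d := d) (n := n) (m := 2 ^ (2 * k)) (g := g) (c := (n : ℝ) / 2)
      (x := fun i => x i) Nat.one_le_two_pow fun i => by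
        have h1 : |x i| ≤ R := (PiLp.norm_apply_le x i).trans (hΩR x hx)
        have h2 : |g * x i| ≤ n / 2 := by
          rw [abs_mul, abs_of_pos (by linarith)]
          calc g * |x i| ≤ g * R := by gcongr
            _ = n / 2 := by rw [hg]; field_simp
        have h3 := abs_le.1 h2
        exact ⟨by linarith [h3.1], by linarith [h3.2]⟩
    have e : F 0 x - ∑ b, f b (fun i => x i) =
        ∑ b : Fin d → Fin (n + 1) × Bool, ((∏ i, tri (((2 ^ (2 * k) : ℕ) : ℝ) *
          localCoord g (fun i => blockOffset (2 ^ (2 * k)) ((n : ℝ) / 2) (b i)) (fun i => x i) i)) *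
            F 0 x - f b (fun i => x i)) := by
      rw [Finset.sum_sub_distrib, ← Finset.sum_mul, hpou, one_mul]
    rw [e, ← Finset.sum_filter_of_ne (p := fun b => ∀ i, tri (((2 ^ (2 * k) : ℕ) : ℝ) *
          localCoord g (fun i => blockOffset (2 ^ (2 * k)) ((n : ℝ) / 2) (b i)) (fun i => x i) i) ≠ 0)]
    · refine (Finset.abs_sum_le_sum_abs _ _).trans ?_
      refine (Finset.sum_le_card_nsmul _ _ _ fun b hb =>
        hf3 b x hx (Finset.mem_filter.1 hb).2).trans ?_
      rw [nsmul_eq_mul]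
      have hθ : 0 ≤ θ := by
        by_contra! hθ
        have h1 : σ * θ ≤ 0 := mul_nonpos_of_nonneg_of_nonpos hσ hθ.le
        have h2 : (0 : ℝ) < 2 ^ (2 * k) := by positivity
        linarith
      have hK0 : 0 ≤ K := by rw [hK]; positivity
      have hC0 : 0 ≤ C := by rw [hC]; positivity
      have hR0 : 0 ≤ R := by linarith
      refine mul_le_mul_of_nonneg_right ?_ (by positivity)
      exact_mod_cast card_active_le
    · intro b _ hb i hi
      refine hb ?_
      rw [hf2 b _ ⟨i, hi⟩, Finset.prod_eq_zero (Finset.mem_univ i) hi, zero_mul, sub_zero]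

end Block

/-! ### The choice of the parameters -/

/-- The number of binary digits: with `2 k` digits for the cells of a block and `l` bits for the
entries of the tables, the lookup has depth `o(T)`, as `d / (2 s) < 1`. -/
lemma eventually_exists_digits {d : ℕ} {s : ℝ} (hs : 1 ≤ s) (hsd : (d : ℝ) / 2 < s) :
    ∀ᶠ T : ℝ in atTop, ∃ k l : ℕ, T ≤ ((2 : ℝ) ^ (2 * k)) ^ s ∧ (2 : ℝ) ^ (2 * k) ≤ 4 * T ∧
      ((2 : ℝ) ^ k) ^ d ≤ 2 ^ d * T ∧ T ≤ 2 ^ l ∧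
      6 * k + 3 * ((2 : ℝ) ^ k) ^ d + 4 * (((2 : ℝ) ^ k) ^ d * l) + 10 ≤ T := by
  have hs0 : 0 < s := by linarith
  -- The depth is `O(T ^ α log T)`, and `log T = o(T ^ β)` with `α + 2 β = 1`.
  set α : ℝ := d / (2 * s) with hα
  have hα1 : α < 1 := by
    rw [hα, div_lt_one (by positivity)]
    linarith
  have hα0 : 0 ≤ α := by positivity
  set β : ℝ := (1 - α) / 2 with hβ
  have hβ0 : 0 < β := by rw [hβ]; linarith
  have h1 : ∀ᶠ T : ℝ in atTop, 16 + 7 * (2 : ℝ) ^ d ≤ T ^ β :=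
    (tendsto_rpow_atTop hβ0).eventually_ge_atTop _
  have h2 : ∀ᶠ T : ℝ in atTop, 2 ≤ T ^ β := (tendsto_rpow_atTop hβ0).eventually_ge_atTop _
  have hlog2 : 0 < Real.log 2 := Real.log_pos (by norm_num)
  have h3 : ∀ᶠ T : ℝ in atTop, ‖Real.log T‖ ≤ Real.log 2 / 2 * ‖T ^ β‖ :=
    (isLittleO_log_rpow_atTop hβ0).bound (by positivity)
  filter_upwards [h1, h2, h3, eventually_ge_atTop 1] with T hT1 hT2 hT3 hT
  have hT0 : 0 < T := by linarith
  have hTβ : 0 ≤ T ^ β := by positivity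
  have hlog : 0 ≤ Real.logb 2 T := Real.logb_nonneg (by norm_num) hT
  have hlogβ : Real.logb 2 T + 1 ≤ T ^ β := by
    rw [Real.norm_of_nonneg (Real.log_nonneg hT), Real.norm_of_nonneg hTβ] at hT3
    have : Real.logb 2 T ≤ T ^ β / 2 := by
      rw [Real.logb, div_le_iff₀ hlog2]
      linarith
    linarith
  set k := ⌈Real.logb 2 T / (2 * s)⌉₊ with hk
  set l := ⌈Real.logb 2 T⌉₊ with hl
  have hk1 : Real.logb 2 T / (2 * s) ≤ k := Nat.le_ceil _
  have hk2 : (k : ℝ) < Real.logb 2 T / (2 * s) + 1 := Nat.ceil_lt_add_one (by positivity)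
  have hl1 : Real.logb 2 T ≤ l := Nat.le_ceil _
  have hl2 : (l : ℝ) < Real.logb 2 T + 1 := Nat.ceil_lt_add_one hlog
  have hpow : ∀ y : ℝ, (2 : ℝ) ^ (Real.logb 2 T * y) = T ^ y := fun y => by
    rw [Real.rpow_mul (by norm_num), Real.rpow_logb (by norm_num) (by norm_num) hT0]
  have h2k : (2 : ℝ) ^ k ≤ 2 * T ^ (1 / (2 * s)) := by
    rw [← hpow, ← Real.rpow_natCast, mul_comm, ← Real.rpow_add_one (by norm_num)]
    refine Real.rpow_le_rpow_of_exponent_le (by norm_num) (hk2.le.trans (le_of_eq ?_))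
    ring
  have h2kd : ((2 : ℝ) ^ k) ^ d ≤ 2 ^ d * T ^ α := by
    refine (pow_le_pow_left₀ (by positivity) h2k d).trans (le_of_eq ?_)
    rw [mul_pow, ← Real.rpow_natCast (T ^ (1 / (2 * s))), ← Real.rpow_mul hT0.le, hα]
    congr 2
    ring
  have hTα : T ^ α ≤ T := Real.rpow_le_self_of_one_le hT hα1.le
  refine ⟨k, l, ?_, ?_, h2kd.trans (by gcongr), ?_, ?_⟩
  · have : T = 2 ^ (Real.logb 2 T / (2 * s) * (2 * s)) := by
      rw [div_mul_cancel₀ _ (by positivity), Real.rpow_logb (by norm_num) (by norm_num) hT0]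
    rw [← Real.rpow_natCast, ← Real.rpow_mul (by norm_num)]
    nth_rewrite 1 [this]
    refine Real.rpow_le_rpow_of_exponent_le (by norm_num) ?_
    push_cast
    nlinarith
  · rw [mul_comm, pow_mul]
    refine (pow_le_pow_left₀ (by positivity) h2k 2).trans ?_
    rw [mul_pow, ← Real.rpow_natCast (T ^ (1 / (2 * s))), ← Real.rpow_mul hT0.le]
    have : T ^ (1 / (2 * s) * ((2 : ℕ) : ℝ)) ≤ T := by
      refine Real.rpow_le_self_of_one_le hT ?_
      push_cast
      rw [show 1 / (2 * s) * 2 = 1 / s by field_simp]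
      rw [div_le_one hs0]
      exact hs
    linarith
  · rw [← Real.rpow_natCast]
    exact (Real.logb_le_iff_le_rpow (by norm_num) hT0).1 hl1
  · have hTα1 : 1 ≤ T ^ α := Real.one_le_rpow hT hα0
    have hk3 : (k : ℝ) ≤ T ^ β := by
      have : Real.logb 2 T / (2 * s) ≤ Real.logb 2 T := div_le_self hlog (by linarith)
      linarith
    have hl3 : (l : ℝ) ≤ T ^ β := by linarith
    have hβ1 : 1 ≤ T ^ β := by linarith
    have e : T = T ^ α * T ^ β * T ^ β := by
      rw [← Real.rpow_add hT0, ← Real.rpow_add hT0, hβ]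
      ring_nf
      exact (Real.rpow_one _).symm
    have g1 : 1 ≤ T ^ α * T ^ β := one_le_mul_of_one_le_of_one_le hTα1 hβ1
    have g2 : (k : ℝ) ≤ T ^ α * T ^ β := hk3.trans (le_mul_of_one_le_left hTβ hTα1)
    have g3 : ((2 : ℝ) ^ k) ^ d ≤ 2 ^ d * (T ^ α * T ^ β) :=
      h2kd.trans (by gcongr; exact le_mul_of_one_le_right (by positivity) hβ1)
    have g4 : ((2 : ℝ) ^ k) ^ d * l ≤ 2 ^ d * (T ^ α * T ^ β) := by
      calc _ ≤ 2 ^ d * T ^ α * T ^ β := by gcongr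
        _ = _ := by ring
    calc _ ≤ (16 + 7 * (2 : ℝ) ^ d) * (T ^ α * T ^ β) := by linarith
      _ ≤ T ^ β * (T ^ α * T ^ β) := by gcongr
      _ = T := by rw [mul_comm]; exact e.symm

/-- The bound for the entries of the networks is larger than any multiple of `log (1 / δ) ^ 2`. -/
lemma eventually_sq_log_le_bound {d : ℕ} (hd : 1 ≤ d) {s : ℝ} (hs : 1 ≤ s) {A : ℝ} (hA : 0 < A) :
    ∀ᶠ δ : ℝ in 𝓝[>] 0, A * Real.logb 2 δ⁻¹ ^ 2 ≤ (numN d s δ : ℝ) ^ (1 / (d : ℝ)) ∧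
      ((numN d s δ : ℝ) ^ (1 / (d : ℝ))) ^ (-s) ≤ δ * Real.logb 2 δ⁻¹ := by
  have hs0 : 0 < s := by linarith
  have hlog2 : 0 < Real.log 2 := Real.log_pos (by norm_num)
  have hlog2' : Real.log 2 ≤ 1 := by linarith [Real.log_two_lt_d9]
  have hT : Tendsto (fun δ : ℝ => Real.logb 2 δ⁻¹) (𝓝[>] 0) atTop :=
    (Real.tendsto_logb_atTop (by norm_num)).comp tendsto_inv_nhdsGT_zero
  have h1 : ∀ᶠ T : ℝ in atTop, T ^ (2 * s + 1) * Real.exp (-Real.log 2 * T) ≤ (A ^ s)⁻¹ :=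
    ((tendsto_rpow_mul_exp_neg_mul_atTop_nhds_zero (2 * s + 1) _ hlog2).eventually
      (gt_mem_nhds (by positivity : 0 < (A ^ s)⁻¹))).mono fun _ h => h.le
  filter_upwards [hT.eventually h1, hT.eventually_ge_atTop 1, self_mem_nhdsWithin] with δ h1 h2 h3
  have hδ : 0 < δ := h3
  set T := Real.logb 2 δ⁻¹ with hTdef
  have hT0 : 0 < T := by linarith
  have e1 : |δ * Real.log δ| = δ * (T * Real.log 2) := by
    have : T * Real.log 2 = -Real.log δ := by
      rw [hTdef, Real.logb, div_mul_cancel₀ _ hlog2.ne', Real.log_inv]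
    rw [abs_mul, abs_of_pos hδ, ← abs_neg (Real.log δ), ← this, abs_of_pos (by positivity)]
  have e2 : Real.exp (-Real.log 2 * T) = δ := by
    rw [hTdef, Real.logb, neg_mul, mul_div_cancel₀ _ hlog2.ne', Real.log_inv, neg_neg,
      Real.exp_log hδ]
  have hle : δ * (T * Real.log 2) ≤ δ * T := by
    gcongr
    exact mul_le_of_le_one_right hT0.le hlog2'
  have hpos : 0 < δ * (T * Real.log 2) := by positivity
  have hB : (δ * T) ^ (-(1 / s)) ≤ (numN d s δ : ℝ) ^ (1 / (d : ℝ)) := by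
    have hd0 : (0 : ℝ) < d := by exact_mod_cast hd
    calc (δ * T) ^ (-(1 / s)) ≤ (δ * (T * Real.log 2)) ^ (-(1 / s)) :=
          Real.rpow_le_rpow_of_nonpos hpos hle (by simp [hs0.le])
      _ = ((δ * (T * Real.log 2)) ^ (-((d : ℝ) / s))) ^ (1 / (d : ℝ)) := by
          rw [← Real.rpow_mul hpos.le]
          congr 1
          field_simp
      _ ≤ _ := by
          refine Real.rpow_le_rpow (by positivity) ?_ (by positivity)
          rw [numN, e1]
          exact Nat.le_ceil _
  constructor
  · refine le_trans ?_ hB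
    rw [e2, Real.rpow_add_one hT0.ne', le_inv_comm₀ (by positivity) (by positivity)] at h1
    have h4 : (A * T ^ 2) ^ s ≤ (δ * T)⁻¹ := by
      rw [Real.mul_rpow hA.le (by positivity), ← Real.rpow_natCast, ← Real.rpow_mul hT0.le]
      push_cast
      calc A ^ s * T ^ (2 * s) ≤ (T ^ (2 * s) * T * δ)⁻¹ * T ^ (2 * s) := by gcongr
        _ = (δ * T)⁻¹ := by field_simp
    calc A * T ^ 2 = ((A * T ^ 2) ^ s) ^ (1 / s) := by
          rw [← Real.rpow_mul (by positivity), mul_one_div_cancel hs0.ne', Real.rpow_one]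
      _ ≤ (δ * T)⁻¹ ^ (1 / s) := by gcongr
      _ = _ := by rw [Real.inv_rpow (by positivity), Real.rpow_neg (by positivity)]
  · calc ((numN d s δ : ℝ) ^ (1 / (d : ℝ))) ^ (-s) ≤ ((δ * T) ^ (-(1 / s))) ^ (-s) :=
          Real.rpow_le_rpow_of_nonpos (by positivity) hB (by linarith)
      _ = δ * T := by
          rw [← Real.rpow_mul (by positivity)]
          rw [show -(1 / s) * -s = 1 by field_simp, Real.rpow_one]

/-- The depth has room for a tree of multiplications of precision `δ`, on top of subnetworks of
depth `log₂ (1 / δ)`. -/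
lemma le_depthH {d : ℕ} {s δ : ℝ} (hs : 1 ≤ s) (hδ : 0 < δ) {m : ℕ}
    (hm : (m : ℝ) ≤ Real.logb 2 δ⁻¹ / 2 + 1) {D : ℕ} (hD : (D : ℝ) ≤ Real.logb 2 δ⁻¹) :
    D + (Nat.clog 2 (degM d s) + 1) * (2 * m + 4) ≤ depthH d s 1 δ - 1 := by
  have hM : 3 ≤ degM d s := by
    refine le_trans ?_ (le_max_right _ _)
    exact Nat.le_floor (by push_cast; linarith)
  have hc : 2 ≤ Nat.clog 2 (degM d s) := by
    have : Nat.clog 2 3 ≤ Nat.clog 2 (degM d s) := Nat.clog_mono_right 2 hM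
    have h3 : Nat.clog 2 3 = 2 := by decide +kernel
    omega
  rw [depthH, show ⌈Real.logb 2 (degM d s)⌉₊ = Nat.clog 2 (degM d s) from
    Real.natCeil_logb_natCast 2 _]
  set c := Nat.clog 2 (degM d s)
  set T := Real.logb 2 δ⁻¹ with hTdef
  set Z := ⌈Real.logb 2 (3 ^ degM d s / (δ * 1)) + 5⌉₊ with hZ
  have h1 : T + 5 ≤ Z := by
    refine le_trans ?_ (Nat.le_ceil _)
    have : T ≤ Real.logb 2 (3 ^ degM d s / (δ * 1)) := by
      refine Real.logb_le_logb_of_le (by norm_num) (by positivity) ?_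
      rw [mul_one, div_eq_mul_inv]
      exact le_mul_of_one_le_left (by positivity) (one_le_pow₀ (by norm_num))
    linarith
  have hc' : (2 : ℝ) ≤ c := by exact_mod_cast hc
  have key : (D : ℝ) + (c + 1) * (2 * m + 4) ≤ 2 + 2 * Z * c := by
    have h2 : (c + 1) * (2 * (m : ℝ) + 4) ≤ (c + 1) * (T + 6) :=
      mul_le_mul_of_nonneg_left (by linarith) (by positivity)
    have h3 : 2 * (T + 5) * c ≤ 2 * Z * c := by gcongr
    nlinarith
  have key' : D + (c + 1) * (2 * m + 4) ≤ 2 + 2 * Z * c := by exact_mod_cast key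
  omega

/-- The width factor `W₀`. The subnetworks have width `2 ^ r * (6 * d)`; the first factor bounds
the total width of those that are used for each unit of `N`, and the second one makes `W₀ ^ 2` large
enough for the number of nonzero entries. -/
def widthFactor (d q r : ℕ) : ℕ :=
  2 ^ d * ((d + 1) ^ q * (2 * (2 ^ r * (6 * d)))) * (2 ^ r * (6 * d) + d + 2)

/-- If `(n + 1) ^ d ≤ N`, then a sum over the blocks is small enough for the sieve. -/
lemma Out.mem_sieve {d q r n : ℕ} (hd : 1 ≤ d) {s δ : ℝ} {f : (Fin d → ℝ) → ℝ}
    (hn : (n + 1) ^ d ≤ numN d s δ)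
    (hf : Out d ((numN d s δ : ℝ) ^ (1 / (d : ℝ)))
      ((2 * (n + 1)) ^ d * ((d + 1) ^ q * (2 * (2 ^ r * (6 * d)))))
      ((2 * (n + 1)) ^ d * ((d + 1) ^ q * (2 * ((depthH d s 1 δ - 1) *
        layerSize d (2 ^ r * (6 * d)))))) (depthH d s 1 δ - 1) f) :
    (fun x : EuclideanSpace ℝ (Fin d) => f (fun i => x i)) ∈
      sieve d s 1 (widthFactor d q r) δ := by
  have hB : (0 : ℝ) ≤ (numN d s δ : ℝ) ^ (1 / (d : ℝ)) := by positivity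
  have hH : 3 ≤ depthH d s 1 δ := Nat.le_add_right _ _
  obtain ⟨h, hh⟩ : ∃ h, depthH d s 1 δ = h + 1 := ⟨depthH d s 1 δ - 1, by omega⟩
  have hh1 : 1 ≤ h := by omega
  rw [sieve]
  rw [hh, Nat.add_sub_cancel] at hf ⊢
  generalize (numN d s δ : ℝ) ^ (1 / (d : ℝ)) = B at *
  generalize numN d s δ = N at *
  set w := 2 ^ r * (6 * d) with hw
  set Q := (d + 1) ^ q with hQ
  have hw1 : 1 ≤ w := Nat.mul_pos (by positivity) (by omega)
  have hQ1 : 1 ≤ Q := Nat.one_le_pow _ _ (by omega)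
  set a := 2 ^ d * (Q * (2 * w)) with ha
  have ha1 : 1 ≤ a := Nat.mul_pos (by positivity) (Nat.mul_pos hQ1 (by omega))
  have hW : widthFactor d q r = a * (w + d + 2) := rfl
  set W := widthFactor d q r
  have e1 : (2 * (n + 1)) ^ d * (Q * (2 * w)) ≤ a * N := by
    rw [mul_pow, ha]
    calc 2 ^ d * (n + 1) ^ d * (Q * (2 * w)) = 2 ^ d * (Q * (2 * w)) * (n + 1) ^ d := by ring
      _ ≤ _ := Nat.mul_le_mul_left _ hn
  have e2 : (2 * (n + 1)) ^ d * (Q * (2 * (h * layerSize d w))) ≤ a * (w + d + 1) * h * N := by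
    calc _ = (2 * (n + 1)) ^ d * (Q * (2 * w)) * ((w + d + 1) * h) := by
          rw [layerSize]; ring
      _ ≤ a * N * ((w + d + 1) * h) := Nat.mul_le_mul_right _ e1
      _ = _ := by ring
  have e3 : a ≤ W := by
    rw [hW]
    exact Nat.le_mul_of_pos_right _ (by omega)
  -- `W₀ ^ 2` leaves room for the entries of the output layer.
  have e4 : a * (w + d + 1) * h + W ≤ h * W ^ 2 + 1 := by
    have h1 : a * (w + d + 1) + a = W := by rw [hW]; ring
    have h2 : 2 ≤ W := by
      rw [hW]
      nlinarith
    have h3 : W + W ≤ W ^ 2 := by nlinarith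
    have h4 : W ≤ h * W := Nat.le_mul_of_pos_left _ hh1
    calc a * (w + d + 1) * h + W ≤ W * h + h * W := by
          gcongr
          omega
      _ = h * (W + W) := by ring
      _ ≤ h * W ^ 2 := Nat.mul_le_mul_left _ h3
      _ ≤ _ := Nat.le_succ _
  refine Out.mem_reluClass hB (hf.mono_width hB hh1 (e1.trans (Nat.mul_le_mul_right _ e3))) ?_
  calc _ ≤ a * (w + d + 1) * h * N + W * N := by gcongr
    _ = (a * (w + d + 1) * h + W) * N := by ring
    _ ≤ _ := Nat.mul_le_mul_right _ e4

/-- All conditions on the parameters of the construction can be met for small `δ`, with errors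
`O(δ)`. -/
lemma eventually_exists_params {d : ℕ} (hd : 1 ≤ d) {s : ℝ} (hs : 1 ≤ s) (hsd : (d : ℝ) / 2 < s)
    {R A : ℝ} (hR : 1 ≤ R) (hA : 10 ≤ A) :
    ∀ᶠ δ : ℝ in 𝓝[>] 0, 0 < δ ∧ A ≤ (numN d s δ : ℝ) ^ (1 / (d : ℝ)) ∧
      ∃ (n k l m : ℕ) (σ θ : ℝ), 0 ≤ σ ∧ 2 * σ + 1 ≤ (numN d s δ : ℝ) ^ (1 / (d : ℝ)) ∧
      2 * R ≤ n ∧ (n : ℝ) + 1 ≤ (numN d s δ : ℝ) ^ (1 / (d : ℝ)) ∧ (n + 1) ^ d ≤ numN d s δ ∧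
      2 ^ (2 * k) ≤ σ * θ ∧ (d * (2 ^ k) ^ d + 1 : ℝ) ≤ (numN d s δ : ℝ) ^ (1 / (d : ℝ)) ∧
      blockDepth d k l m (Nat.clog 2 (degM d s) + 1) ≤ depthH d s 1 δ - 1 ∧
      1 / 4 ^ m ≤ δ ∧ (2 * R / n / 2 ^ (2 * k)) ^ s ≤ (4 * R) ^ s * δ ∧
      (2 * R / n) ^ s * (1 / 2 ^ l + 2 * θ) ≤ 3 * (4 * R) ^ s * δ := by
  have hs0 : 0 < s := by linarith
  have hT : Tendsto (fun δ : ℝ => Real.logb 2 δ⁻¹) (𝓝[>] 0) atTop :=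
    (Real.tendsto_logb_atTop (by norm_num)).comp tendsto_inv_nhdsGT_zero
  filter_upwards [self_mem_nhdsWithin, hT.eventually_ge_atTop 1,
    hT.eventually (eventually_exists_digits hs hsd),
    eventually_sq_log_le_bound hd hs (A := A + 2 * R + 10 + d * 2 ^ d) (by positivity)]
    with δ hδ hT1 hdig hbd
  obtain ⟨k, l, hk1, hk2, hk3, hl, hdep⟩ := hdig
  obtain ⟨hB1, hB2⟩ := hbd
  have hδ : 0 < δ := hδ
  set B := (numN d s δ : ℝ) ^ (1 / (d : ℝ)) with hB
  set T := Real.logb 2 δ⁻¹ with hTdef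
  have hT0 : 0 < T := by linarith
  have hTT : 1 ≤ T ^ 2 := one_le_pow₀ hT1
  have hTT' : T ≤ T ^ 2 := le_self_pow₀ hT1 (by norm_num)
  have hd2 : (0 : ℝ) ≤ d * 2 ^ d := by positivity
  have hBA : A + 2 * R + 10 + d * 2 ^ d ≤ B :=
    (le_mul_of_one_le_right (by positivity) hTT).trans hB1
  have hB0 : 0 < B := by linarith
  have hfl : (⌊B⌋₊ : ℝ) ≤ B := Nat.floor_le hB0.le
  have hfl' : B < ⌊B⌋₊ + 1 := Nat.lt_floor_add_one B
  have hfl1 : 1 ≤ ⌊B⌋₊ := Nat.le_floor (by push_cast; linarith)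
  have hn1 : ((⌊B⌋₊ - 1 : ℕ) : ℝ) = ⌊B⌋₊ - 1 := by push_cast [hfl1]; rfl
  -- `n` blocks in each direction, `n + 1` because of the shifted grids.
  set n := ⌊B⌋₊ - 1 with hn
  have hnB : B / 2 ≤ n := by linarith
  have hn0 : (0 : ℝ) < n := by linarith
  have hBs : (2 * R / n) ^ s ≤ (4 * R) ^ s * (δ * T) := by
    calc (2 * R / n) ^ s ≤ (2 * R / (B / 2)) ^ s := by gcongr
      _ = (4 * R) ^ s * B ^ (-s) := by
          rw [show 2 * R / (B / 2) = 4 * R * B⁻¹ by field_simp; norm_num,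
            Real.mul_rpow (by positivity) (by positivity), Real.inv_rpow hB0.le,
            Real.rpow_neg hB0.le]
      _ ≤ _ := by gcongr
  set m := ⌈T / 2⌉₊ with hm
  have hm1 : T / 2 ≤ m := Nat.le_ceil _
  have hm2 : (m : ℝ) < T / 2 + 1 := Nat.ceil_lt_add_one (by positivity)
  refine ⟨hδ, by linarith, n, k, l, m, 2 ^ (2 * k) * T, 1 / T, by positivity, ?_, by linarith,
    by linarith, ?_, ?_, ?_, ?_, ?_, ?_, ?_⟩
  · have h1 : 2 ^ (2 * k) * T ≤ 4 * T * T := by gcongr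
    have h2 : 0 ≤ (A + 2 * R + 1 + d * 2 ^ d) * T ^ 2 := by positivity
    nlinarith
  · have hd0 : (d : ℝ) ≠ 0 := by positivity
    have h1 : ((⌊B⌋₊ : ℝ)) ^ d ≤ numN d s δ := by
      calc (⌊B⌋₊ : ℝ) ^ d ≤ B ^ d := by gcongr
        _ = numN d s δ := by
          rw [hB, ← Real.rpow_natCast, ← Real.rpow_mul (by positivity), one_div_mul_cancel hd0,
            Real.rpow_one]
    rw [hn, Nat.sub_add_cancel hfl1]
    exact_mod_cast h1
  · rw [mul_assoc, mul_one_div_cancel hT0.ne', mul_one]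
  · have h1 : d * ((2 : ℝ) ^ k) ^ d ≤ d * (2 ^ d * T) := by gcongr
    have h2 : d * 2 ^ d * T ≤ d * 2 ^ d * T ^ 2 := by gcongr
    have h3 : 1 ≤ (A + 2 * R + 10) * T ^ 2 := by nlinarith
    nlinarith
  · refine le_depthH hs hδ hm2.le (D := 6 * k + 3 * (2 ^ k) ^ d +
      4 * ((2 ^ k) ^ d * l) + 10) ?_
    push_cast
    exact hdep
  · have h1 : δ⁻¹ ≤ 4 ^ m := by
      calc δ⁻¹ = 2 ^ T := (Real.rpow_logb (by norm_num) (by norm_num) (by positivity)).symm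
        _ ≤ 2 ^ ((2 * m : ℕ) : ℝ) :=
          Real.rpow_le_rpow_of_exponent_le (by norm_num) (by push_cast; linarith)
        _ = 4 ^ m := by rw [Real.rpow_natCast, pow_mul]; norm_num
    rw [one_div]
    exact inv_le_of_inv_le₀ hδ h1
  · rw [Real.div_rpow (by positivity) (by positivity), div_le_iff₀ (by positivity)]
    calc _ ≤ (4 * R) ^ s * (δ * T) := hBs
      _ = (4 * R) ^ s * δ * T := by ring
      _ ≤ _ := by gcongr
  · have h1 : (1 : ℝ) / 2 ^ l ≤ 1 / T := by gcongr
    calc _ ≤ (4 * R) ^ s * (δ * T) * (1 / T + 2 * (1 / T)) := by gcongr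
      _ = _ := by field_simp; norm_num

lemma empNorm_le_supNorm {d n : ℕ} (hn : 1 ≤ n) {Ω : Set (EuclideanSpace ℝ (Fin d))}
    {x : Fin n → EuclideanSpace ℝ (Fin d)} (hx : ∀ i, x i ∈ Ω)
    (g : EuclideanSpace ℝ (Fin d) → ℝ) : empNorm x g ≤ supNorm Ω g := by
  by_cases htop : supNorm Ω g = ⊤
  · rw [htop]
    exact le_top
  have h : ∀ i, |g (x i)| ≤ (supNorm Ω g).toReal := by
    intro i
    have h1 : ‖g (x i)‖ₑ ≤ supNorm Ω g := le_iSup₂ (f := fun y (_ : y ∈ Ω) => ‖g y‖ₑ) (x i) (hx i)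
    have h2 := ENNReal.toReal_mono htop h1
    simpa using h2
  rw [empNorm]
  refine ENNReal.ofReal_le_of_le_toReal (Real.sqrt_le_iff.2 ⟨ENNReal.toReal_nonneg, ?_⟩)
  have hn0 : (0 : ℝ) < n := by exact_mod_cast hn
  rw [one_div, inv_mul_le_iff₀ hn0]
  refine (Finset.sum_le_card_nsmul _ _ ((supNorm Ω g).toReal ^ 2) fun i _ => ?_).trans (by simp)
  rw [← sq_abs]
  exact pow_le_pow_left₀ (abs_nonneg _) (h i) 2

end ReLUApprox

theorem proposition1 (d : ℕ) (hd : 1 ≤ d) (s : ℝ) (hs : 1 ≤ s) (hsd : (d : ℝ) / 2 < s) :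
    ∃ C₀ : ℝ, 0 < C₀ ∧ ∃ W₀ : ℕ, 0 < W₀ ∧
      ∀ Ω : Set (EuclideanSpace ℝ (Fin d)),
        Bornology.IsBounded Ω → Convex ℝ Ω → (interior Ω).Nonempty →
        ∀ L : ℝ, 0 < L →
          (∀ δ ∈ Set.Ioo (0 : ℝ) 1, ∀ n : ℕ, 1 ≤ n →
            ∀ x : Fin n → EuclideanSpace ℝ (Fin d), (∀ i, x i ∈ Ω) →
              ReLUApprox.approxError (ReLUApprox.empNorm x)
                  (ReLUApprox.holderBall s L Ω) (ReLUApprox.sieve d s C₀ W₀ δ) ≤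
                ReLUApprox.approxError (ReLUApprox.supNorm Ω)
                  (ReLUApprox.holderBall s L Ω) (ReLUApprox.sieve d s C₀ W₀ δ)) ∧
          ∃ C : ℝ, 0 < C ∧ ∀ᶠ δ in 𝓝[>] (0 : ℝ),
            ReLUApprox.approxError (ReLUApprox.supNorm Ω)
                (ReLUApprox.holderBall s L Ω) (ReLUApprox.sieve d s C₀ W₀ δ) ≤
              ENNReal.ofReal (C * δ) := by
  set q := ⌊s⌋₊ with hq
  -- A tree with `r` levels has room for `d` triangle waves, `q` coordinates and one coefficient.
  set r := Nat.clog 2 (ReLUApprox.degM d s) + 1 with hr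
  have hqs : (q : ℝ) ≤ s := Nat.floor_le (by linarith)
  have hsq : s ≤ q + 1 := (Nat.lt_floor_add_one s).le
  have hdq : d + q + 1 ≤ 2 ^ r := by
    have h1 : ReLUApprox.degM d s ≤ 2 ^ Nat.clog 2 (ReLUApprox.degM d s) :=
      Nat.le_pow_clog (by norm_num) _
    have h2 : d ≤ ReLUApprox.degM d s := le_max_left _ _
    have h3 : q + 2 ≤ ReLUApprox.degM d s := by
      refine le_trans (Nat.le_floor ?_) (le_max_right _ _)
      push_cast
      linarith
    rw [hr, pow_succ]
    omega
  refine ⟨1, one_pos, ReLUApprox.widthFactor d q r, ?_, fun Ω hΩb hΩc hΩi L hL => ⟨?_, ?_⟩⟩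
  · rw [ReLUApprox.widthFactor]
    positivity
  · intro δ _ n hn x hx
    exact iSup₂_mono fun f _ => iInf₂_mono fun g _ => ReLUApprox.empNorm_le_supNorm hn hx _
  · obtain ⟨M, hM0, hjet⟩ := ReLUApprox.exists_jet_of_holderBall hs hL hΩb hΩc hΩi
    obtain ⟨R₀, hR₀⟩ := hΩb.exists_norm_le
    set R := max R₀ 1 with hR
    set K : ℝ := (q + 1) ^ d * (L * (d : ℝ) ^ (2 * q + 1)) with hK
    set C : ℝ := (q + 1) ^ d * M + K with hC
    have hR1 : 1 ≤ R := le_max_right _ _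
    have hd0 : (0 : ℝ) < d := by exact_mod_cast hd
    have hK0 : 0 < K := by positivity
    have hC0 : 0 < C := by positivity
    refine ⟨2 ^ d * (L * (d : ℝ) ^ (2 * q + 1) * (4 * R) ^ s +
      (d + 1) ^ q * (4 * C * 2 ^ r + 2 * K * (3 * (4 * R) ^ s))), by positivity, ?_⟩
    filter_upwards [ReLUApprox.eventually_exists_params hd hs hsd hR1 (A := 10 + 2 * C)
      (by linarith)] with δ hδ
    obtain ⟨hδ, hB, n, k, l, m, σ, θ, hσ, hσB, hnR, hnB, hnN, hσθ, hkB, hdepth, he1, he2, he3⟩ := hδ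
    refine iSup₂_le fun f hf => ?_
    obtain ⟨F, hF, hF0, hFM, hFH⟩ := hjet f hf
    obtain ⟨g, hg, hgF⟩ := ReLUApprox.exists_out hd hL hqs hsq hΩc hF hM0 hFM hFH (by linarith) hσ
      hσB hR1 (fun x hx => (hR₀ x hx).trans (le_max_left _ _)) hnR hnB hσθ hkB hdq hdepth hK hC
      (by linarith)
    refine iInf₂_le_of_le _ (hg.mem_sieve hd hnN) (iSup₂_le fun x hx => ?_)
    rw [← ofReal_norm]
    refine ENNReal.ofReal_le_ofReal ?_
    simp only [Pi.sub_apply, Real.norm_eq_abs]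
    rw [← hF0 x hx]
    refine (hgF x hx).trans ?_
    calc _ = 2 ^ d * (L * (d : ℝ) ^ (2 * q + 1) * (2 * R / n / 2 ^ (2 * k)) ^ s +
          (d + 1) ^ q * (4 * C * (2 ^ r * (1 / 4 ^ m)) +
            2 * K * ((2 * R / n) ^ s * (1 / 2 ^ l + 2 * θ)))) := by ring
      _ ≤ 2 ^ d * (L * (d : ℝ) ^ (2 * q + 1) * ((4 * R) ^ s * δ) +
          (d + 1) ^ q * (4 * C * (2 ^ r * δ) + 2 * K * (3 * (4 * R) ^ s * δ))) := by gcongr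
      _ = _ := by ring
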